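/- Let $\mathbb F_q$ be a finite field with $q$ elements, $A=\mathbb F_q[\theta]$, $k=\mathbb F_q(\theta)$ with a fixed algebraic closure $\overline k$, and $|f/g|_\infty=q^{\deg f-\deg g}$, $|0|_\infty=0$ on $k$. For an $A$-algebra $L$ let $C:A\to \operatorname{End}_{\mathbb F_q}(L)$ be the Carlitz module, i.e. the $\mathbb F_q$-algebra homomorphism with $C_\theta(z)=\theta z+z^q$. Let $v\in A$ be monic irreducible of degree $d$ and let $\mathfrak n\in A$ be monic and relatively prime to $v$. Let $\Lambda_{\mathfrak n}=\{\lambda\in\overline k: C_{\mathfrak n}(\lambda)=0\}$, let $K_{\mathfrak n}=k(\Lambda_{\mathfrak n})$, and let $\mathcal O_{\mathfrak n}$ be the integral closure of $A$ in $K_{\mathfrak n}$. Let $\mathfrak P_{\mathfrak n}$ be any prime of $\mathcal O_{\mathfrak n}$ above $v$, let $\ell$ be its residue degree over $v$, put $\mathbb F_{\mathfrak P}=\mathcal O_{\mathfrak n}/\mathfrak P_{\mathfrak n}$, and let $\psi:\mathbb F_{\mathfrak P}\to\mathbb F_{q^{d\ell}}\subseteq\overline k$ be any $\mathbb F_q$-algebra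 isomorphism. Let $\omega$ be the inverse of the reduction map from $\Lambda_{\mathfrak n}$ to the $\mathfrak n$-torsion of the Carlitz module over $\mathbb F_{\mathfrak P}$. Let $K_{\mathfrak n,d\ell}=K_{\mathfrak n}\cdot k\mathbb F_{q^{d\ell}}$, let $\mathcal O_{\mathfrak n,d\ell}$ be the integral closure of $A$ in it, and for $x\in\mathfrak n^{-1}A$ put $$\mathcal G^{\rm geo}_x=1+\sum_{z\in\mathbb F_{\mathfrak P}^\times}\omega\bigl(C_{x(v^\ell-1)}(z^{-1})\bigr)\,\psi(z)\in K_{\mathfrak n,d\ell}.$$ For $a\in A$ relatively prime to $\mathfrak n$ let $\rho_a\in\operatorname{Gal}(K_{\mathfrak n}/k)$ be the automorphism with $\rho_a(\lambda)=C_a(\lambda)$ for all $\lambda\in\Lambda_{\mathfrak n}$, and for $s\ge 0$ let $\sigma_{a,s}\in\operatorname{Gal}(K_{\mathfrak n,d\ell}/k)$ be the automorphism that restricts to $\rho_a$ on $K_{\mathfrak n}$ and to $c\mapsto c^{q^s}$ on $\mathbb F_{q^{d\ell}}$; put $\tau_q=\sigma_{1,1}$ and $G^{\rm geo}_\ell(x)=\prod_{s=0}^{d\ell-1}\tau_q^s(\mathcal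 G^{\rm geo}_x)$. Let $\mathfrak P_{\mathfrak n,d\ell}\subseteq\mathcal O_{\mathfrak n,d\ell}$ be the ideal corresponding to the kernel of $\mathbb F_{q^{d\ell}}\otimes_{\mathbb F_q}\mathcal O_{\mathfrak n}\to\mathbb F_{q^{d\ell}}$, $\epsilon\otimes\alpha\mapsto\epsilon\,\psi(\overline\alpha)$, under the canonical isomorphism $\mathbb F_{q^{d\ell}}\otimes_{\mathbb F_q}\mathcal O_{\mathfrak n}\simeq\mathcal O_{\mathfrak n,d\ell}$. For an ideal $I$ and an element $\eta=\sum_\sigma m_\sigma\sigma$ of the integral group ring of the Galois group write $I^\eta=\prod_\sigma\sigma(I)^{m_\sigma}$. Finally put $$\eta_{\mathfrak n,d\ell}=\sum_a\sigma_{a,\deg a}^{-1}\in\mathbb Z[\operatorname{Gal}(K_{\mathfrak n,d\ell}/k)],\qquad \eta_{\mathfrak n}=\sum_a\rho_a^{-1}\in\mathbb Z[\operatorname{Gal}(K_{\mathfrak n}/k)],$$ both sums over the monic $a\in A$ with $\deg a<\deg\mathfrak n$ and $(a,\mathfrak n)=1$. **Theorem.** Let $x\in k$ with $0<|x|_\infty<1$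 be of the form $x=a_0/\mathfrak n$ with $a_0\in A$, $\deg a_0<\deg\mathfrak n$ and $(a_0,\mathfrak n)=1$. Then $\mathfrak P_{\mathfrak n,d\ell}$ is a prime ideal lying above $\mathfrak P_{\mathfrak n}$, and $$\mathcal G^{\rm geo}_x\cdot\mathcal O_{\mathfrak n,d\ell}=\mathfrak P_{\mathfrak n,d\ell}^{\,\sigma_{a_0,\deg\mathfrak n}\cdot\eta_{\mathfrak n,d\ell}}.$$ Consequently, $G^{\rm geo}_\ell(x)$ lies in $K_{\mathfrak n}$ and $$G^{\rm geo}_\ell(x)\cdot\mathcal O_{\mathfrak n}=\mathfrak P_{\mathfrak n}^{\,\rho_{a_0}\cdot\eta_{\mathfrak n}}.$$ -/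

import Mathlib

open Polynomial
open scoped Pointwise nonZeroDivisors TensorProduct

noncomputable section

namespace GeometricGauss

open Classical in
/-- The absolute value at infinity on `k = F(θ)`: `|0| = 0` and `|f / g| = q ^ (deg f - deg g)`. -/
def inftyAbs (F : Type*) [Field F] [Fintype F] (x : RatFunc F) : ℝ :=
  if x = 0 then 0 else (Fintype.card F : ℝ) ^ x.intDegree

/-! ### The Carlitz module -/

section Carlitz

variable (F : Type*) [Field F] [Fintype F]
variable (L : Type*) [CommRing L] [Algebra F L] [Algebra F[X] L]

/-- The operator `C_θ = θ + τ` on an `F[θ]`-algebra `L`, where `F` is the finite field with `q`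
elements and `τ` is the `q`-th power map: `C_θ(z) = θ z + z ^ q`. -/
def carlitzTheta : L →ₗ[F] L :=
  LinearMap.mulLeft F (algebraMap F[X] L X) + (FiniteField.frobeniusAlgHom F L).toLinearMap

/-- The Carlitz module `a ↦ C_a` over `L`: the homomorphism of `F`-algebras from `F[θ]` to the
`F`-linear endomorphisms of `L` that sends `θ` to `C_θ`. -/
def carlitz : F[X] →ₐ[F] Module.End F L :=
  aeval (carlitzTheta F L)

/-- The `n`-torsion of the Carlitz module over `L`. -/
def torsion (n : F[X]) : Set L := {z | carlitz F L n z = 0}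

end Carlitz

/-! ### Fields and rings of integers -/

section Fields

variable (F : Type*) [Field F] [Fintype F]

/-- The algebraic closure of the rational function field `k = F(θ)`. -/
abbrev kbar : Type _ := AlgebraicClosure (RatFunc F)

/-- The cyclotomic function field `K_n = k(Λ_n)`. -/
def cycField (n : F[X]) : IntermediateField (RatFunc F) (kbar F) :=
  IntermediateField.adjoin (RatFunc F) (torsion F (kbar F) n)

/-- The finite field with `q ^ m` elements inside the algebraic closure of `k`, for `m ≥ 1`:
the subfield generated over `F` by the roots of `X ^ (q ^ m) - X`. -/
def constField (m : ℕ) : IntermediateField F (kbar F) :=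
  IntermediateField.adjoin F ((X ^ (Fintype.card F ^ m) - X : F[X]).rootSet (kbar F))

/-- The compositum `K_{n,m}` of `K_n` and the constant field extension of `k` of degree `m`. -/
def compField (n : F[X]) (m : ℕ) : IntermediateField (RatFunc F) (kbar F) :=
  cycField F n ⊔ IntermediateField.adjoin (RatFunc F) (constField F m : Set (kbar F))

variable {F}

instance isScalarTower_intermediateField (K : IntermediateField (RatFunc F) (kbar F)) :
    IsScalarTower F F[X] K :=
  IsScalarTower.of_algebraMap_eq fun r =>
    Subtype.ext (IsScalarTower.algebraMap_apply F F[X] (kbar F) r)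

/-- The integral closure of `A = F[θ]` in an intermediate field of `k` and its algebraic
closure. -/
abbrev integers (K : IntermediateField (RatFunc F) (kbar F)) : Subalgebra F[X] K :=
  integralClosure F[X] K

instance isFractionRing_integers (K : IntermediateField (RatFunc F) (kbar F)) :
    IsFractionRing (integers K) K :=
  have : Algebra.IsAlgebraic F[X] K :=
    (IsFractionRing.comap_isAlgebraic_iff (K := RatFunc F)).mpr inferInstance
  IsIntegralClosure.isFractionRing_of_algebraic F[X] (integers K) fun x hx => by
    rw [IsScalarTower.algebraMap_apply F[X] (RatFunc F) K] at hx
    simpa using hx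

theorem cycField_le_compField (n : F[X]) (m : ℕ) : cycField F n ≤ compField F n m :=
  le_sup_left

theorem mem_compField_of_mem_constField (n : F[X]) (m : ℕ) {c : kbar F}
    (hc : c ∈ constField F m) : c ∈ compField F n m :=
  (le_sup_right : _ ≤ compField F n m) (IntermediateField.subset_adjoin _ _ hc)

theorem isIntegral_of_mem_constField (m : ℕ) {c : kbar F} (hc : c ∈ constField F m) :
    IsIntegral F c := by
  have h : Algebra.IsAlgebraic F (constField F m) := by
    refine IntermediateField.isAlgebraic_adjoin fun x hx => ?_
    obtain ⟨hp, hx⟩ := mem_rootSet.mp hx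
    exact IsAlgebraic.isIntegral ⟨_, hp, hx⟩
  have h2 := (h.isAlgebraic ⟨c, hc⟩).isIntegral
  exact h2.map (constField F m).val

/-- The inclusion of the ring of integers of `K_n` in that of `K_{n,m}`. -/
def integersIncl (n : F[X]) (m : ℕ) :
    integers (cycField F n) →ₐ[F[X]] integers (compField F n m) :=
  ((IntermediateField.inclusion (cycField_le_compField n m)).restrictScalars F[X]).mapIntegralClosure

/-- The inclusion of the constant field in the ring of integers of `K_{n,m}`. -/
def constIncl (n : F[X]) (m : ℕ) :
    constField F m →ₐ[F] integers (compField F n m) where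
  toFun c := ⟨⟨c, mem_compField_of_mem_constField n m c.2⟩, by
    have h := (isIntegral_of_mem_constField m c.2).tower_top (A := F[X])
    exact (isIntegral_algHom_iff ((compField F n m).val.restrictScalars F[X])
      (compField F n m).val.injective).mp h⟩
  map_one' := rfl
  map_mul' _ _ := rfl
  map_zero' := rfl
  map_add' _ _ := rfl
  commutes' r := by
    apply Subtype.ext
    apply Subtype.ext
    rfl

end Fields

/-! ### Galois groups and group rings -/

section Galois

variable {F : Type*} [Field F] [Fintype F]

open Classical in
/-- The element `ρ_a` of `Gal(K_n/k)`, for `a` prime to `n`: the automorphism that acts on the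
`n`-torsion of the Carlitz module as `C_a`. -/
def rho (n a : F[X]) : Gal(cycField F n/RatFunc F) :=
  if h : ∃ σ : Gal(cycField F n/RatFunc F),
      ∀ z : cycField F n, z ∈ torsion F (cycField F n) n →
        σ z = carlitz F (cycField F n) a z
  then h.choose else 1

open Classical in
/-- The element `σ_{a,s}` of `Gal(K_{n,m}/k)`, for `a` prime to `n`: the automorphism that acts on
the `n`-torsion of the Carlitz module as `C_a`, hence restricts to `ρ_a` on `K_n`, and acts on the
field of constants as the `s`-th power of the `q`-Frobenius. -/
def sigma (n : F[X]) (m : ℕ) (a : F[X]) (s : ℕ) : Gal(compField F n m/RatFunc F) :=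
  if h : ∃ σ : Gal(compField F n m/RatFunc F),
      (∀ z : compField F n m, z ∈ torsion F (compField F n m) n →
        σ z = carlitz F (compField F n m) a z) ∧
      (∀ c : compField F n m, (c : kbar F) ∈ constField F m → σ c = c ^ (Fintype.card F ^ s))
  then h.choose else 1

/-- The power `I ^ η = ∏ σ, σ(I) ^ (η σ)` of an ideal `I` by an element `η` of the integral group
ring, as a fractional ideal. -/
def idealPow {K : IntermediateField (RatFunc F) (kbar F)} (I : Ideal (integers K))
    (η : MonoidAlgebra ℤ Gal(K/RatFunc F)) : FractionalIdeal (integers K)⁰ K :=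
  η.coeff.prod fun σ e =>
    ((σ • I : Ideal (integers K)) : FractionalIdeal (integers K)⁰ K) ^ e.toNat /
      ((σ • I : Ideal (integers K)) : FractionalIdeal (integers K)⁰ K) ^ (-e).toNat

theorem finite_degree_lt (n : F[X]) : {a : F[X] | a.degree < n.degree}.Finite := by
  have h : Finite (degreeLT F n.natDegree) :=
    Finite.of_equiv _ (degreeLTEquiv F n.natDegree).symm.toEquiv
  refine (Set.toFinite (degreeLT F n.natDegree : Set F[X])).subset fun a ha => ?_
  exact mem_degreeLT.mpr (lt_of_lt_of_le ha degree_le_natDegree)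

variable (F) in
/-- The finite set of monic `a` with `deg a < deg n` and `a` prime to `n`. -/
def monicCoprime (n : F[X]) : Finset F[X] :=
  Set.Finite.toFinset (s := {a : F[X] | a.Monic ∧ a.degree < n.degree ∧ IsCoprime a n})
    ((finite_degree_lt n).subset fun _ h => h.2.1)

/-- The element `η_n = ∑ ρ_a⁻¹` of `ℤ[Gal(K_n/k)]`. -/
def etaCyc (n : F[X]) : MonoidAlgebra ℤ Gal(cycField F n/RatFunc F) :=
  ∑ a ∈ monicCoprime F n, MonoidAlgebra.single (rho n a)⁻¹ 1

/-- The element `η_{n,m} = ∑ σ_{a, deg a}⁻¹` of `ℤ[Gal(K_{n,m}/k)]`. -/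
def etaComp (n : F[X]) (m : ℕ) : MonoidAlgebra ℤ Gal(compField F n m/RatFunc F) :=
  ∑ a ∈ monicCoprime F n, MonoidAlgebra.single (sigma n m a a.natDegree)⁻¹ 1

end Galois

/-! ### Geometric Gauss sums -/

section GaussSum

variable {F : Type*} [Field F] [Fintype F] {n : F[X]}

/-- The geometric Teichmüller character, that is, the inverse of the reduction map from the
`n`-torsion of the Carlitz module in the ring of integers of `K_n` to the `n`-torsion of the
Carlitz module over the residue field of `P`. -/
def teichmuller (P : Ideal (integers (cycField F n))) :
    integers (cycField F n) ⧸ P → integers (cycField F n) :=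
  Function.invFunOn (Ideal.Quotient.mk P) (torsion F (integers (cycField F n)) n)

/-- The geometric Gauss sum
`1 + ∑ ω(C_{x (v ^ l - 1)}(z⁻¹)) ψ(z)`, the sum over the nonzero elements `z` of the (finite)
residue field of `P`, for `x ∈ n⁻¹ A`, where `l` is the residue degree of `P` over `v`. As
`x (v ^ l - 1)` lies in `A`, it is equal to its numerator. -/
def gaussSum (P : Ideal (integers (cycField F n))) (v : F[X]) (l : ℕ)
    (ψ : (integers (cycField F n) ⧸ P) ≃ₐ[F] constField F (v.natDegree * l)) (x : RatFunc F) :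
    compField F n (v.natDegree * l) :=
  1 + ∑ᶠ z : (integers (cycField F n) ⧸ P)ˣ,
    (integersIncl n (v.natDegree * l) (teichmuller P (carlitz F (integers (cycField F n) ⧸ P)
      (x * algebraMap F[X] (RatFunc F) (v ^ l - 1)).num
      (↑z⁻¹ : integers (cycField F n) ⧸ P))) : compField F n (v.natDegree * l)) *
    (constIncl n (v.natDegree * l) (ψ z) : compField F n (v.natDegree * l))

/-- The monomial `∏ (0 ≤ s < m) τ_q ^ s (G)`, where `τ_q = σ_{1,1}` is the `q`-Frobenius on the
constants, extended to `K_{n,m}` by the identity on `K_n`. -/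
def frobMonomial {m : ℕ} (G : compField F n m) : compField F n m :=
  ∏ s ∈ Finset.range m, (sigma n m 1 1 ^ s) G

/-- The homomorphism `ε ⊗ α ↦ ε ψ(α mod P)` from `F_{q ^ m} ⊗ O_n` to `F_{q ^ m}`. -/
def tensorResidue {m : ℕ} (P : Ideal (integers (cycField F n)))
    (ψ : (integers (cycField F n) ⧸ P) ≃ₐ[F] constField F m) :
    constField F m ⊗[F] integers (cycField F n) →ₐ[F] constField F m :=
  Algebra.TensorProduct.productMap (AlgHom.id F (constField F m))
    (ψ.toAlgHom.comp (Ideal.Quotient.mkₐ F P))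

/-- The canonical map `ε ⊗ α ↦ ε α` from `F_{q ^ m} ⊗ O_n` to `O_{n,m}`. -/
def tensorIntegers (n : F[X]) (m : ℕ) :
    constField F m ⊗[F] integers (cycField F n) →ₐ[F] integers (compField F n m) :=
  Algebra.TensorProduct.productMap (constIncl n m) ((integersIncl n m).restrictScalars F)

/-- The prime of `K_{n,m}` above `P` attached to `ψ`: the kernel of `ε ⊗ α ↦ ε ψ(α mod P)`,
transported to `O_{n,m}` by the canonical map `F_{q ^ m} ⊗ O_n → O_{n,m}`, which is an
isomorphism. -/
def primeAbove {m : ℕ} (P : Ideal (integers (cycField F n)))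
    (ψ : (integers (cycField F n) ⧸ P) ≃ₐ[F] constField F m) :
    Ideal (integers (compField F n m)) :=
  (RingHom.ker (tensorResidue P ψ)).map (tensorIntegers n m)

end GaussSum

end GeometricGauss

end

/-!
Write `q = #F`, `d = deg v`, `m = d l`, `v ^ l - 1 = n c` and `C_a = ∑ [a, i] τ ^ i`. Up to the
action of the Galois group the Gauss sum is `g = 1 + ∑ ω(C_c(z⁻¹)) ψ(z) ^ (q ^ s)` with
`s = deg c`. As `C_{v ^ l}` fixes the torsion point `ω(C_c(z⁻¹))`, this point is congruent to
`C_{v ^ l c}(ψ(z)⁻¹)` modulo a high power of the prime above `P`. Orthogonality of the characters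
of `F_{q ^ m}ˣ` then leaves `g ≡ -[v ^ l c, s]`, because the contribution of the leading
coefficient `[v ^ l c, s + m] = 1` cancels the summand `1`. The recursion that comes from
`C_θ C_a = C_a C_θ` shows that `v ^ (l - ⌊s / d⌋)` divides `[v ^ l c, s]`. This bounds below the
multiplicity of each conjugate of the prime in `g`, and the right-hand side divides `(g)`.

Equality follows from a bound at infinity: `|λ| ^ (q - 1) ≤ |θ|` for all torsion points `λ`, so
that the norm of `g` to `F[θ]` has degree at most `#Gal / (q - 1)`, which is the degree of the norm
of the right-hand side.

Finally `O_{n,m} = F_{q ^ m} ⊗ O_n` is unramified over `O_n`, with `P O_{n,m}` the product of the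
conjugates of the prime under the Frobenius `τ_q` of the constants, and an ideal of `O_n` is the
contraction of its extension to `O_{n,m}`. Hence the product of the `τ_q`-conjugates of the Gauss
sum has the factorization that is claimed in `O_n`.
-/

noncomputable section

namespace GeometricGauss

section TwistedPolynomials

variable (F : Type*) [Field F] [Fintype F]

/-- The operator `θ + φ` on an `F[θ]`-module, to which the coefficient expansion of `C_a` applies
as soon as `φ` is `q`-semilinear. -/
def thetaAdd {M : Type*} [AddCommGroup M] [Module F M] [Module F[X] M] [IsScalarTower F F[X] M]
    (φ : Module.End F M) : Module.End F M :=
  Algebra.lsmul F F M (X : F[X]) + φ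

/-- Left multiplication by `τ` on the twisted polynomials `∑ u_i τ ^ i` over `F[θ]`, which are
encoded as the ordinary polynomials `∑ u_i X ^ i`; the rule is `τ u = u ^ q τ`. -/
def twistTau : Module.End F F[X][X] :=
  LinearMap.mulLeft F X ∘ₗ (mapAlgHom (FiniteField.frobeniusAlgHom F F[X])).toLinearMap

variable {F}

/-- The coefficients `[a, i]` of `C_a = ∑ [a, i] τ ^ i`, read off from the action of `a` on the
twisted polynomials by left multiplication by `C_a`. -/
def carlitzCoeff (a : F[X]) (i : ℕ) : F[X] := (aeval (thetaAdd F (twistTau F)) a 1).coeff i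

theorem map_aeval_apply_of_intertwines {R M N : Type*} [CommSemiring R] [AddCommMonoid M]
    [Module R M] [AddCommMonoid N] [Module R N] {f : M →ₗ[R] N} {S : Module.End R M}
    {T : Module.End R N} (h : ∀ x, f (S x) = T (f x)) (a : R[X]) (x : M) :
    f (aeval S a x) = aeval T a (f x) := by
  induction a using Polynomial.induction_on generalizing x with
  | C c => simp only [aeval_C, Module.algebraMap_end_apply, map_smul]
  | add a b ha hb => simp only [map_add, LinearMap.add_apply, ha, hb]
  | monomial k c ih =>
    simp only [pow_succ, ← mul_assoc, map_mul _ _ X, aeval_X, Module.End.mul_apply, ih, h]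

theorem coeff_twistTau_succ (u : F[X][X]) (i : ℕ) :
    (twistTau F u).coeff (i + 1) = u.coeff i ^ Fintype.card F := by
  simp [twistTau]

theorem coeff_twistTau_zero (u : F[X][X]) : (twistTau F u).coeff 0 = 0 := by
  simp [twistTau]

theorem twistTau_monomial (i : ℕ) (c : F[X]) :
    twistTau F (monomial i c) = monomial (i + 1) (c ^ Fintype.card F) := by
  simp [twistTau, X_mul_monomial]

theorem twistTau_smul (c : F[X]) (u : F[X][X]) :
    twistTau F (c • u) = c ^ Fintype.card F • twistTau F u := by
  ext1 (_ | i)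
  · simp only [coeff_smul, coeff_twistTau_zero, smul_zero]
  · simp only [coeff_smul, coeff_twistTau_succ, smul_eq_mul, mul_pow]

theorem coeff_twistTau_pow (u : F[X][X]) {i j : ℕ} (hj : j ≤ i) :
    ((twistTau F ^ j) u).coeff i = u.coeff (i - j) ^ Fintype.card F ^ j := by
  induction j generalizing i with
  | zero => simp
  | succ j ih =>
    obtain ⟨i, rfl⟩ := Nat.exists_eq_add_of_lt hj
    rw [pow_succ', Module.End.mul_apply, coeff_twistTau_succ, ih (by lia), ← pow_mul, ← pow_succ]
    congr 2
    lia

theorem coeff_twistTau_pow_of_lt (u : F[X][X]) {i j : ℕ} (hij : i < j) :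
    ((twistTau F ^ j) u).coeff i = 0 := by
  induction j generalizing i with
  | zero => lia
  | succ j ih =>
    rw [pow_succ', Module.End.mul_apply]
    cases i with
    | zero => exact coeff_twistTau_zero _
    | succ i => rw [coeff_twistTau_succ, ih (by lia), zero_pow Fintype.card_ne_zero]

end TwistedPolynomials

section CarlitzCoeff

variable {F : Type*} [Field F] [Fintype F]

theorem carlitzCoeff_add (a b : F[X]) (i : ℕ) :
    carlitzCoeff (a + b) i = carlitzCoeff a i + carlitzCoeff b i := by
  simp only [carlitzCoeff, map_add, LinearMap.add_apply, coeff_add]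

theorem carlitzCoeff_C (c : F) (i : ℕ) : carlitzCoeff (C c) i = if i = 0 then C c else 0 := by
  simp only [carlitzCoeff, aeval_C, Module.algebraMap_end_apply, coeff_smul, coeff_one, smul_ite,
    smul_zero, smul_eq_C_mul, mul_one]

theorem carlitzCoeff_one (i : ℕ) : carlitzCoeff (1 : F[X]) i = if i = 0 then 1 else 0 := by
  rw [← C_1, carlitzCoeff_C]

theorem aeval_X_mul_one (a : F[X]) :
    aeval (thetaAdd F (twistTau F)) (X * a) 1 =
      (X : F[X]) • aeval (thetaAdd F (twistTau F)) a 1 +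
        twistTau F (aeval (thetaAdd F (twistTau F)) a 1) := by
  rw [map_mul, aeval_X, Module.End.mul_apply, thetaAdd, LinearMap.add_apply, Algebra.lsmul_coe]

theorem carlitzCoeff_X_mul_zero (a : F[X]) :
    carlitzCoeff (X * a) 0 = X * carlitzCoeff a 0 := by
  simp only [carlitzCoeff, aeval_X_mul_one, coeff_add, coeff_smul, smul_eq_mul,
    coeff_twistTau_zero, add_zero]

theorem carlitzCoeff_X_mul_succ (a : F[X]) (i : ℕ) :
    carlitzCoeff (X * a) (i + 1) =
      X * carlitzCoeff a (i + 1) + carlitzCoeff a i ^ Fintype.card F := by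
  simp only [carlitzCoeff, aeval_X_mul_one, coeff_add, coeff_smul, smul_eq_mul,
    coeff_twistTau_succ]

theorem carlitzCoeff_zero (a : F[X]) : carlitzCoeff a 0 = a := by
  induction a using Polynomial.induction_on with
  | C c => rw [carlitzCoeff_C, if_pos rfl]
  | add a b ha hb => rw [carlitzCoeff_add, ha, hb]
  | monomial k c ih => rw [pow_succ', mul_left_comm, carlitzCoeff_X_mul_zero, ih]

theorem carlitzCoeff_X_pow_of_lt {k i : ℕ} (hki : k < i) : carlitzCoeff (X ^ k : F[X]) i = 0 := by
  induction k generalizing i with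
  | zero => rw [pow_zero, carlitzCoeff_one, if_neg hki.ne']
  | succ k ih =>
    obtain ⟨i, rfl⟩ := Nat.exists_eq_add_of_lt hki
    rw [pow_succ', carlitzCoeff_X_mul_succ, ih (by lia), ih (by lia), mul_zero,
      zero_pow Fintype.card_ne_zero, add_zero]

theorem carlitzCoeff_X_pow_self (k : ℕ) : carlitzCoeff (X ^ k : F[X]) k = 1 := by
  induction k with
  | zero => rw [pow_zero, carlitzCoeff_one, if_pos rfl]
  | succ k ih =>
    rw [pow_succ', carlitzCoeff_X_mul_succ, carlitzCoeff_X_pow_of_lt k.lt_succ_self, ih, mul_zero,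
      one_pow, zero_add]

theorem carlitzCoeff_eq_sum_X_pow (a : F[X]) (i : ℕ) : carlitzCoeff a i =
    ∑ k ∈ Finset.range (a.natDegree + 1), a.coeff k • carlitzCoeff (X ^ k) i := by
  simp only [carlitzCoeff, aeval_eq_sum_range (p := a), map_pow, aeval_X, LinearMap.sum_apply,
    finsetSum_coeff, LinearMap.smul_apply, coeff_smul]

theorem carlitzCoeff_of_natDegree_lt {a : F[X]} {i : ℕ} (h : a.natDegree < i) :
    carlitzCoeff a i = 0 := by
  rw [carlitzCoeff_eq_sum_X_pow]
  refine Finset.sum_eq_zero fun k hk => ?_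
  rw [carlitzCoeff_X_pow_of_lt ((Finset.mem_range_succ_iff.mp hk).trans_lt h), smul_zero]

theorem carlitzCoeff_natDegree (a : F[X]) : carlitzCoeff a a.natDegree = C a.leadingCoeff := by
  rw [carlitzCoeff_eq_sum_X_pow, Finset.sum_range_succ, Finset.sum_eq_zero, zero_add,
    carlitzCoeff_X_pow_self, smul_eq_C_mul, mul_one, leadingCoeff]
  intro k hk
  rw [carlitzCoeff_X_pow_of_lt (Finset.mem_range.mp hk), smul_zero]

/-- The map `∑ u_i τ ^ i ↦ ∑ u_i φ ^ i (z)` intertwines left multiplication by `θ + τ` with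
`θ + φ`. -/
theorem aeval_thetaAdd_apply {M : Type*} [AddCommGroup M] [Module F M] [Module F[X] M]
    [IsScalarTower F F[X] M] {φ : Module.End F M}
    (hφ : ∀ (c : F[X]) (z : M), φ (c • z) = c ^ Fintype.card F • φ z) (a : F[X]) (z : M)
    {B : ℕ} (hB : a.natDegree < B) :
    aeval (thetaAdd F φ) a z = ∑ i ∈ Finset.range B, carlitzCoeff a i • (φ ^ i) z := by
  let evalAt : F[X][X] →ₗ[F[X]] M := lsum fun i => LinearMap.toSpanSingleton F[X] M ((φ ^ i) z)
  have evalAt_monomial (i : ℕ) (c : F[X]) : evalAt (monomial i c) = c • (φ ^ i) z := by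
    simp [evalAt, lsum_apply]
  have evalAt_thetaAdd (u : F[X][X]) :
      evalAt (thetaAdd F (twistTau F) u) = thetaAdd F φ (evalAt u) := by
    induction u using Polynomial.induction_on' with
    | add p r hp hr => simp only [map_add, hp, hr]
    | monomial i c =>
      simp only [thetaAdd, LinearMap.add_apply, Algebra.lsmul_coe, map_add, map_smul,
        evalAt_monomial, twistTau_monomial, hφ, pow_succ', Module.End.mul_apply]
  have evalAt_one : evalAt 1 = z := by
    rw [← C_1, ← monomial_zero_left, evalAt_monomial, one_smul, pow_zero, Module.End.one_apply]
  have hdeg : (aeval (thetaAdd F (twistTau F)) a 1).natDegree < B :=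
    (natDegree_le_iff_coeff_eq_zero.mpr fun _ hi => carlitzCoeff_of_natDegree_lt hi).trans_lt hB
  calc aeval (thetaAdd F φ) a z = evalAt (aeval (thetaAdd F (twistTau F)) a 1) := by
        conv_lhs => rw [← evalAt_one]
        exact (map_aeval_apply_of_intertwines (f := evalAt.restrictScalars F)
          evalAt_thetaAdd a 1).symm
    _ = ∑ i ∈ Finset.range B, carlitzCoeff a i • (φ ^ i) z :=
        sum_over_range' (f := fun i c => c • (φ ^ i) z) _ (fun i => zero_smul _ _) B hdeg

theorem carlitzCoeff_mul (a b : F[X]) (i : ℕ) :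
    carlitzCoeff (a * b) i = ∑ j ∈ Finset.range (i + 1),
      carlitzCoeff a j * carlitzCoeff b (i - j) ^ Fintype.card F ^ j := by
  have hB : i + 1 ≤ max (i + 1) (a.natDegree + 1) := le_max_left _ _
  rw [carlitzCoeff, map_mul, Module.End.mul_apply,
    aeval_thetaAdd_apply twistTau_smul a _ (a.natDegree.lt_succ_self.trans_le (le_max_right _ _)),
    finsetSum_coeff, ← Finset.sum_range_add_sum_Ico _ hB, Finset.sum_eq_zero (s := Finset.Ico _ _),
    add_zero]
  · refine Finset.sum_congr rfl fun j hj => ?_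
    rw [coeff_smul, coeff_twistTau_pow _ (Finset.mem_range_succ_iff.mp hj), smul_eq_mul,
      carlitzCoeff, carlitzCoeff]
  · intro j hj
    rw [coeff_smul, coeff_twistTau_pow_of_lt _ (Finset.mem_Ico.mp hj).1, smul_zero]

theorem carlitzCoeff_mul_X_succ (a : F[X]) (i : ℕ) : carlitzCoeff (a * X) (i + 1) =
    carlitzCoeff a (i + 1) * X ^ Fintype.card F ^ (i + 1) + carlitzCoeff a i := by
  have h1 : carlitzCoeff (X : F[X]) 1 = 1 := by
    simpa only [pow_one] using carlitzCoeff_X_pow_self (F := F) 1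
  rw [carlitzCoeff_mul, Finset.sum_range_succ, Finset.sum_range_succ, Finset.sum_eq_zero, zero_add,
    add_comm, Nat.sub_self, carlitzCoeff_zero, Nat.add_sub_cancel_left, h1, one_pow, mul_one]
  intro j hj
  have hdeg : (X : F[X]).natDegree < i + 1 - j := by
    rw [natDegree_X]
    have := Finset.mem_range.mp hj
    lia
  rw [carlitzCoeff_of_natDegree_lt hdeg, zero_pow (pow_ne_zero _ Fintype.card_ne_zero), mul_zero]

/-- Both sides compute the coefficient of `τ ^ (i + 1)` in `C_θ C_a = C_a C_θ`. -/
theorem carlitzCoeff_succ_mul_X_pow_sub_X (a : F[X]) (i : ℕ) :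
    carlitzCoeff a (i + 1) * (X ^ Fintype.card F ^ (i + 1) - X) =
      carlitzCoeff a i ^ Fintype.card F - carlitzCoeff a i := by
  have h := carlitzCoeff_mul_X_succ a i
  rw [mul_comm a X, carlitzCoeff_X_mul_succ] at h
  linear_combination -h

theorem dvd_carlitzCoeff {v : F[X]} (hv : Irreducible v) {i : ℕ} (hi : i < v.natDegree) :
    v ∣ carlitzCoeff v i := by
  induction i with
  | zero => rw [carlitzCoeff_zero]
  | succ i ih =>
    have hvi : v ∣ carlitzCoeff v i := ih (by lia)
    have hmul : v ∣ carlitzCoeff v (i + 1) * (X ^ Fintype.card F ^ (i + 1) - X) := by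
      rw [carlitzCoeff_succ_mul_X_pow_sub_X]
      exact dvd_sub (hvi.trans (dvd_pow_self _ Fintype.card_ne_zero)) hvi
    refine (hv.prime.dvd_or_dvd hmul).resolve_right fun hdvd => ?_
    rw [← Nat.card_eq_fintype_card] at hdvd
    exact hi.not_ge (Nat.le_of_dvd i.succ_pos (hv.natDegree_dvd_of_dvd_X_pow_card_pow_sub_X hdvd))

theorem pow_dvd_carlitzCoeff_pow_mul {v : F[X]} (hv : Irreducible v) (c : F[X]) (l i : ℕ) :
    v ^ (l - i / v.natDegree) ∣ carlitzCoeff (v ^ l * c) i := by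
  have hd : 0 < v.natDegree := hv.natDegree_pos
  induction l generalizing i with
  | zero => simp
  | succ l ih =>
    rw [pow_succ', mul_assoc, carlitzCoeff_mul]
    refine Finset.dvd_sum fun j hj => ?_
    have hright : v ^ (l - (i - j) / v.natDegree) ∣
        carlitzCoeff (v ^ l * c) (i - j) ^ Fintype.card F ^ j :=
      (ih _).trans (dvd_pow_self _ (pow_ne_zero _ Fintype.card_ne_zero))
    rcases lt_or_ge j v.natDegree with hjd | hjd
    · have hle : (i - j) / v.natDegree ≤ i / v.natDegree := Nat.div_le_div_right (Nat.sub_le i j)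
      refine (pow_dvd_pow v (by lia : _ ≤ 1 + (l - (i - j) / v.natDegree))).trans ?_
      rw [pow_add, pow_one]
      exact mul_dvd_mul (dvd_carlitzCoeff hv hjd) hright
    · have hle : (i - j) / v.natDegree ≤ i / v.natDegree - 1 := by
        rw [← Nat.sub_mul_div, mul_one]
        exact Nat.div_le_div_right (Nat.sub_le_sub_left hjd i)
      have hpos : 0 < i / v.natDegree :=
        Nat.div_pos (hjd.trans (Finset.mem_range_succ_iff.mp hj)) hd
      exact (pow_dvd_pow v (by lia)).trans (hright.trans (dvd_mul_left _ _))

end CarlitzCoeff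

section CarlitzModule

variable {F : Type*} [Field F] [Fintype F]
variable {L : Type*} [CommRing L] [Algebra F L] [Algebra F[X] L]

theorem mem_torsion {n : F[X]} {z : L} : z ∈ torsion F L n ↔ carlitz F L n z = 0 := Iff.rfl

theorem carlitz_C (c : F) (z : L) : carlitz F L (C c) z = algebraMap F L c * z := by
  rw [carlitz, aeval_C, Module.algebraMap_end_apply, Algebra.smul_def]

theorem carlitz_X (z : L) :
    carlitz F L X z = algebraMap F[X] L X * z + z ^ Fintype.card F := by
  simp [carlitz, carlitzTheta]

theorem carlitz_mul (a b : F[X]) (z : L) :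
    carlitz F L (a * b) z = carlitz F L a (carlitz F L b z) := by
  rw [map_mul, Module.End.mul_apply]

theorem carlitz_one (z : L) : carlitz F L 1 z = z := by
  rw [map_one, Module.End.one_apply]

theorem carlitz_sub (a b : F[X]) (z : L) :
    carlitz F L (a - b) z = carlitz F L a z - carlitz F L b z := by
  rw [map_sub, LinearMap.sub_apply]

theorem carlitz_comm (a b : F[X]) (z : L) :
    carlitz F L a (carlitz F L b z) = carlitz F L b (carlitz F L a z) := by
  rw [← carlitz_mul, mul_comm, carlitz_mul]

theorem sub_mem_torsion {n : F[X]} {x y : L} (hx : x ∈ torsion F L n) (hy : y ∈ torsion F L n) :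
    x - y ∈ torsion F L n := by
  rw [mem_torsion, map_sub, mem_torsion.mp hx, mem_torsion.mp hy, sub_zero]

theorem carlitz_mem_torsion {n : F[X]} {x : L} (a : F[X]) (hx : x ∈ torsion F L n) :
    carlitz F L a x ∈ torsion F L n := by
  rw [mem_torsion, carlitz_comm, mem_torsion.mp hx, map_zero]

theorem carlitz_eq_of_dvd_sub {n a b : F[X]} (h : n ∣ a - b) {x : L} (hx : x ∈ torsion F L n) :
    carlitz F L a x = carlitz F L b x := by
  obtain ⟨c, hc⟩ := h
  rw [← sub_eq_zero, ← carlitz_sub, hc, mul_comm, carlitz_mul, mem_torsion.mp hx, map_zero]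

variable [IsScalarTower F F[X] L]

theorem carlitz_map {L' : Type*} [CommRing L'] [Algebra F L'] [Algebra F[X] L']
    [IsScalarTower F F[X] L'] (φ : L →ₐ[F[X]] L') (a : F[X]) (z : L) :
    φ (carlitz F L a z) = carlitz F L' a (φ z) :=
  map_aeval_apply_of_intertwines (f := (φ.restrictScalars F).toLinearMap)
    (fun z => by simp [carlitzTheta]) a z

theorem carlitz_eq_sum (a : F[X]) (z : L) {B : ℕ} (hB : a.natDegree < B) :
    carlitz F L a z = ∑ i ∈ Finset.range B,
      algebraMap F[X] L (carlitzCoeff a i) * z ^ Fintype.card F ^ i := by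
  let frob : Module.End F L := (FiniteField.frobeniusAlgHom F L).toLinearMap
  have hθ : carlitzTheta F L = thetaAdd F frob := by
    ext z
    simp [carlitzTheta, thetaAdd, frob, Algebra.smul_def]
  have hfrob (i : ℕ) (z : L) : (frob ^ i) z = z ^ Fintype.card F ^ i := by
    induction i with
    | zero => simp
    | succ i ih => rw [pow_succ', Module.End.mul_apply, ih, pow_succ, pow_mul]; rfl
  have hsemi (c : F[X]) (z : L) : frob (c • z) = c ^ Fintype.card F • frob z := smul_pow _ _ _
  rw [carlitz, hθ, aeval_thetaAdd_apply hsemi a z hB]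
  simp only [hfrob, Algebra.smul_def]

theorem carlitz_mem_ideal (I : Ideal L) (a : F[X]) {z : L} (hz : z ∈ I) : carlitz F L a z ∈ I := by
  rw [carlitz_eq_sum a z a.natDegree.lt_succ_self]
  exact I.sum_mem fun i _ =>
    I.mul_mem_left _ (I.pow_mem_of_mem hz _ (pow_pos Fintype.card_pos _))

theorem map_mem_torsion {L' : Type*} [CommRing L'] [Algebra F L'] [Algebra F[X] L']
    [IsScalarTower F F[X] L'] (φ : L →ₐ[F[X]] L') {n : F[X]} {x : L} (hx : x ∈ torsion F L n) :
    φ x ∈ torsion F L' n := by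
  rw [mem_torsion, ← carlitz_map, mem_torsion.mp hx, map_zero]

theorem map_mem_torsion_iff {L' : Type*} [CommRing L'] [Algebra F L'] [Algebra F[X] L']
    [IsScalarTower F F[X] L'] {φ : L →ₐ[F[X]] L'} (hφ : Function.Injective φ) {n : F[X]} {x : L} :
    φ x ∈ torsion F L' n ↔ x ∈ torsion F L n := by
  rw [mem_torsion, mem_torsion, ← carlitz_map, map_eq_zero_iff φ hφ]

theorem exists_carlitz_eq_add_mul_mul (a : F[X]) (z : L) :
    ∃ y, carlitz F L a z = (algebraMap F[X] L a + y * z) * z := by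
  have hpow (i : ℕ) : z ^ 2 ∣ z ^ Fintype.card F ^ (i + 1) :=
    pow_dvd_pow z (Fintype.one_lt_card.trans_le (Nat.le_self_pow i.succ_ne_zero _))
  have hdvd : z ^ 2 ∣ ∑ i ∈ Finset.range a.natDegree,
      algebraMap F[X] L (carlitzCoeff a (i + 1)) * z ^ Fintype.card F ^ (i + 1) :=
    Finset.dvd_sum fun i _ => (hpow i).mul_left _
  obtain ⟨y, hy⟩ := hdvd
  refine ⟨y, ?_⟩
  rw [carlitz_eq_sum a z a.natDegree.lt_succ_self, Finset.sum_range_succ', hy, carlitzCoeff_zero]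
  ring

theorem eq_zero_of_mem_torsion_of_mem_ideal [IsDomain L] {n : F[X]} {I : Ideal L}
    (hn : algebraMap F[X] L n ∉ I) {z : L} (hz : z ∈ torsion F L n) (hzI : z ∈ I) : z = 0 := by
  obtain ⟨y, hy⟩ := exists_carlitz_eq_add_mul_mul n z
  rw [mem_torsion.mp hz] at hy
  refine (mul_eq_zero.mp hy.symm).resolve_left fun h => hn ?_
  rw [eq_neg_of_add_eq_zero_left h]
  exact I.neg_mem (I.mul_mem_left _ hzI)

section PrimeOfLevel

variable {v : F[X]} {I : Ideal L}

theorem carlitz_mem_pow_succ (hv : Irreducible v) (hvI : algebraMap F[X] L v ∈ I) {k : ℕ}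
    (hk : 1 ≤ k) {z : L} (hz : z ∈ I ^ k) : carlitz F L v z ∈ I ^ (k + 1) := by
  rw [carlitz_eq_sum v z v.natDegree.lt_succ_self]
  refine Ideal.sum_mem _ fun i hi => ?_
  rcases (Finset.mem_range_succ_iff.mp hi).lt_or_eq with hlt | rfl
  · obtain ⟨c, hc⟩ := dvd_carlitzCoeff hv hlt
    rw [hc, map_mul, pow_succ', mul_assoc]
    exact Ideal.mul_mem_mul hvI (Ideal.mul_mem_left _ _
      (Ideal.pow_mem_of_mem _ hz _ (pow_pos Fintype.card_pos _)))
  · have hq : 2 ≤ Fintype.card F ^ v.natDegree :=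
      Fintype.one_lt_card.trans_le (Nat.le_self_pow hv.natDegree_pos.ne' _)
    refine Ideal.mul_mem_left _ _ (Ideal.pow_le_pow_right (show k + 1 ≤ k * 2 by lia) ?_)
    rw [pow_mul]
    exact Ideal.pow_le_pow_right hq (Ideal.pow_mem_pow hz _)

theorem carlitz_pow_mem_pow_succ (hv : Irreducible v) (hvI : algebraMap F[X] L v ∈ I) (k : ℕ)
    {z : L} (hz : z ∈ I) : carlitz F L (v ^ k) z ∈ I ^ (k + 1) := by
  induction k with
  | zero => simpa [carlitz_one] using hz
  | succ k ih =>
    rw [pow_succ' v, carlitz_mul]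
    exact carlitz_mem_pow_succ hv hvI k.succ_pos ih

theorem carlitz_sub_pow_mem (hvm : v.Monic) (hv : Irreducible v) (hvI : algebraMap F[X] L v ∈ I)
    (z : L) : carlitz F L v z - z ^ Fintype.card F ^ v.natDegree ∈ I := by
  rw [carlitz_eq_sum v z v.natDegree.lt_succ_self, Finset.sum_range_succ, carlitzCoeff_natDegree,
    hvm.leadingCoeff, C_1, map_one, one_mul, add_sub_cancel_right]
  refine I.sum_mem fun i hi => I.mul_mem_right _ ?_
  exact I.mem_of_dvd (map_dvd _ (dvd_carlitzCoeff hv (Finset.mem_range.mp hi))) hvI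

theorem carlitz_pow_sub_pow_mem (hvm : v.Monic) (hv : Irreducible v)
    (hvI : algebraMap F[X] L v ∈ I) (k : ℕ) (z : L) :
    carlitz F L (v ^ k) z - z ^ Fintype.card F ^ (v.natDegree * k) ∈ I := by
  induction k with
  | zero => simp
  | succ k ih =>
    have hih := carlitz_mem_ideal I v ih
    have hfrob := carlitz_sub_pow_mem hvm hv hvI (z ^ Fintype.card F ^ (v.natDegree * k))
    rw [map_sub, ← carlitz_mul, ← pow_succ'] at hih
    rw [← pow_mul, ← pow_add] at hfrob
    simpa only [sub_add_sub_cancel, Nat.mul_succ] using I.add_mem hih hfrob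

end PrimeOfLevel

end CarlitzModule

section CarlitzPoly

variable {F : Type*} [Field F] [Fintype F]

/-- The polynomial `C_a(X) = ∑ [a, i] X ^ (q ^ i)`, whose roots are the `a`-torsion points. -/
def carlitzPoly (a : F[X]) : F[X][X] := carlitz F F[X][X] a X

theorem carlitzPoly_eq_sum (a : F[X]) : carlitzPoly a =
    ∑ i ∈ Finset.range (a.natDegree + 1), C (carlitzCoeff a i) * X ^ Fintype.card F ^ i :=
  carlitz_eq_sum a X a.natDegree.lt_succ_self

theorem derivative_carlitzPoly (a : F[X]) : derivative (carlitzPoly a) = C a := by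
  have hq : (Fintype.card F : F[X][X]) = 0 := by
    rw [← map_natCast (algebraMap F F[X][X]), FiniteField.cast_card_eq_zero, map_zero]
  rw [carlitzPoly_eq_sum, derivative_sum, Finset.sum_range_succ', Finset.sum_eq_zero]
  · simp [carlitzCoeff_zero]
  · intro i _
    rw [derivative_C_mul, derivative_X_pow, Nat.cast_pow, C_pow, C_eq_natCast, hq,
      zero_pow i.succ_ne_zero, zero_mul, mul_zero]

theorem degree_carlitzPoly_sub_lt (a : F[X]) :
    (carlitzPoly a - C (C a.leadingCoeff) * X ^ Fintype.card F ^ a.natDegree).degree <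
      ((Fintype.card F ^ a.natDegree : ℕ) : WithBot ℕ) := by
  rw [carlitzPoly_eq_sum, Finset.sum_range_succ, carlitzCoeff_natDegree, add_sub_cancel_right]
  refine (degree_sum_le _ _).trans_lt ((Finset.sup_lt_iff (WithBot.bot_lt_coe _)).mpr ?_)
  intro i hi
  refine (degree_C_mul_X_pow_le _ _).trans_lt ?_
  exact_mod_cast Nat.pow_lt_pow_right Fintype.one_lt_card (Finset.mem_range.mp hi)

theorem coeff_carlitzPoly_card_pow_natDegree (a : F[X]) :
    (carlitzPoly a).coeff (Fintype.card F ^ a.natDegree) = C a.leadingCoeff := by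
  have h := coeff_eq_zero_of_degree_lt (degree_carlitzPoly_sub_lt a)
  rwa [coeff_sub, coeff_C_mul, coeff_X_pow_self, mul_one, sub_eq_zero] at h

theorem natDegree_carlitzPoly {a : F[X]} (ha : a ≠ 0) :
    (carlitzPoly a).natDegree = Fintype.card F ^ a.natDegree := by
  refine le_antisymm ?_ (le_natDegree_of_ne_zero ?_)
  · rw [← sub_add_cancel (carlitzPoly a) (C (C a.leadingCoeff) * X ^ Fintype.card F ^ a.natDegree)]
    exact natDegree_add_le_of_degree_le
      (natDegree_le_of_degree_le (degree_carlitzPoly_sub_lt a).le) (natDegree_C_mul_X_pow_le _ _)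
  · rw [coeff_carlitzPoly_card_pow_natDegree]
    exact C_ne_zero.mpr (leadingCoeff_ne_zero.mpr ha)

theorem leadingCoeff_carlitzPoly {a : F[X]} (ha : a ≠ 0) :
    (carlitzPoly a).leadingCoeff = C a.leadingCoeff := by
  rw [leadingCoeff, natDegree_carlitzPoly ha, coeff_carlitzPoly_card_pow_natDegree]

theorem monic_carlitzPoly {a : F[X]} (ha : a.Monic) : (carlitzPoly a).Monic := by
  rw [Polynomial.Monic, leadingCoeff_carlitzPoly ha.ne_zero, ha.leadingCoeff, C_1]

theorem aeval_carlitzPoly {L : Type*} [CommRing L] [Algebra F L] [Algebra F[X] L]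
    [IsScalarTower F F[X] L] (a : F[X]) (z : L) : aeval z (carlitzPoly a) = carlitz F L a z := by
  rw [carlitzPoly, carlitz_map (aeval z : F[X][X] →ₐ[F[X]] L), aeval_X]

end CarlitzPoly

section TorsionCount

variable {F : Type*} [Field F] [Fintype F]
variable {L : Type*} [CommRing L] [IsDomain L] [Algebra F L] [Algebra F[X] L]
  [IsScalarTower F F[X] L]

theorem natDegree_map_carlitzPoly {a : F[X]} (ha : a ≠ 0) :
    ((carlitzPoly a).map (algebraMap F[X] L)).natDegree = Fintype.card F ^ a.natDegree := by
  rw [natDegree_map_of_leadingCoeff_ne_zero, natDegree_carlitzPoly ha]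
  rw [leadingCoeff_carlitzPoly ha, ← algebraMap_eq, ← IsScalarTower.algebraMap_apply]
  exact (map_ne_zero_iff _ (algebraMap F L).injective).mpr (leadingCoeff_ne_zero.mpr ha)

theorem torsion_eq_rootSet {a : F[X]} (ha : a ≠ 0) :
    torsion F L a = (carlitzPoly a).rootSet L := by
  have hne : (carlitzPoly a).map (algebraMap F[X] L) ≠ 0 := fun h => by
    have hdeg := natDegree_map_carlitzPoly (L := L) ha
    rw [h, natDegree_zero] at hdeg
    exact (pow_pos Fintype.card_pos _).ne hdeg
  ext z
  rw [mem_rootSet', aeval_carlitzPoly, mem_torsion]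
  exact ⟨fun h => ⟨hne, h⟩, And.right⟩

theorem finite_torsion {a : F[X]} (ha : a ≠ 0) : (torsion F L a).Finite :=
  torsion_eq_rootSet (L := L) ha ▸ rootSet_finite _ L

theorem ncard_torsion_le {a : F[X]} (ha : a ≠ 0) :
    (torsion F L a).ncard ≤ Fintype.card F ^ a.natDegree := by
  classical
  rw [torsion_eq_rootSet ha, rootSet_def, Set.ncard_coe_finset, aroots_def]
  exact (Multiset.toFinset_card_le _).trans
    ((card_roots' _).trans (natDegree_map_carlitzPoly ha).le)

theorem ncard_torsion_of_isSepClosed {L : Type*} [Field L] [IsSepClosed L] [Algebra F L]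
    [Algebra F[X] L] [IsScalarTower F F[X] L] {a : F[X]} (ha : algebraMap F[X] L a ≠ 0) :
    (torsion F L a).ncard = Fintype.card F ^ a.natDegree := by
  classical
  have ha0 : a ≠ 0 := fun h => ha (h ▸ map_zero _)
  have hsep : ((carlitzPoly a).map (algebraMap F[X] L)).Separable := by
    rw [separable_def, derivative_map, derivative_carlitzPoly, map_C]
    exact isCoprime_one_right.of_isCoprime_of_dvd_right (isUnit_C.mpr ha.isUnit).dvd
  rw [torsion_eq_rootSet ha0, rootSet_def, Set.ncard_coe_finset, aroots_def,
    Multiset.toFinset_card_of_nodup (nodup_roots hsep),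
    ← (IsSepClosed.splits_of_separable _ hsep).natDegree_eq_card_roots,
    natDegree_map_carlitzPoly ha0]

theorem ncard_degree_lt {n : F[X]} (hn : n ≠ 0) :
    {a : F[X] | a.degree < n.degree}.ncard = Fintype.card F ^ n.natDegree := by
  have h : {a : F[X] | a.degree < n.degree} = (degreeLT F n.natDegree : Set F[X]) := by
    ext a
    rw [SetLike.mem_coe, mem_degreeLT, degree_eq_natDegree hn]
    rfl
  rw [h, ← Nat.card_coe_set_eq]
  refine (Nat.card_congr (degreeLTEquiv F n.natDegree).toEquiv).trans ?_
  simp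

/-- If `n ∤ a`, then `n`-torsion killed by `a` is contained in the torsion of the remainder of `a`
modulo `n`, which has too few elements. -/
theorem dvd_of_forall_carlitz_eq_zero {n : F[X]} (hn : n ≠ 0)
    (hcard : (torsion F L n).ncard = Fintype.card F ^ n.natDegree) {a : F[X]}
    (h : ∀ z ∈ torsion F L n, carlitz F L a z = 0) : n ∣ a := by
  by_contra hdvd
  have hr : a % n ≠ 0 := mt EuclideanDomain.mod_eq_zero.mp hdvd
  have hsub : torsion F L n ⊆ torsion F L (a % n) := fun z hz => by
    rw [mem_torsion, ← h z hz]
    exact carlitz_eq_of_dvd_sub ⟨-(a / n), by linear_combination EuclideanDomain.mod_add_div a n⟩ hz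
  have hle := (Set.ncard_le_ncard hsub (finite_torsion hr)).trans (ncard_torsion_le hr)
  rw [hcard, Nat.pow_le_pow_iff_right Fintype.one_lt_card] at hle
  exact hle.not_gt (natDegree_lt_natDegree hr (EuclideanDomain.mod_lt a hn))

theorem exists_mem_torsion_forall_dvd {n : F[X]} (hn : n ≠ 0)
    (hcard : (torsion F L n).ncard = Fintype.card F ^ n.natDegree) :
    ∃ g ∈ torsion F L n, ∀ a, carlitz F L a g = 0 → n ∣ a := by
  let M := Module.AEval' (carlitzTheta F L)
  let e : L ≃ₗ[F] M := Module.AEval'.of (carlitzTheta F L)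
  have smul_e (a : F[X]) (z : L) : a • e z = e (carlitz F L a z) :=
    (Module.AEval.of_aeval_smul (R := F) (a := carlitzTheta F L) a z).symm
  let T : Submodule F[X] M := Submodule.torsionBy F[X] M n
  have e_mem (z : L) : e z ∈ T ↔ z ∈ torsion F L n := by
    rw [Submodule.mem_torsionBy_iff, smul_e, LinearEquiv.map_eq_zero_iff, mem_torsion]
  have : Finite T :=
    ((finite_torsion hn).image e).subset (fun x hx => by
      obtain ⟨z, rfl⟩ := e.surjective x
      exact Set.mem_image_of_mem e ((e_mem z).mp hx)) |>.to_subtype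
  have : Module.Finite F[X] T := Module.Finite.of_finite
  obtain ⟨⟨x, hx⟩, hker⟩ := Module.exists_ker_toSpanSingleton_eq_annihilator (R := F[X]) (M := T)
  obtain ⟨g, rfl⟩ := e.surjective x
  refine ⟨g, (e_mem g).mp hx, fun a ha => dvd_of_forall_carlitz_eq_zero hn hcard fun z hz => ?_⟩
  have ha_mem : a ∈ Module.annihilator F[X] T := by
    rw [← hker, LinearMap.mem_ker, LinearMap.toSpanSingleton_apply]
    apply Subtype.ext
    rw [Submodule.coe_smul, smul_e, ha, map_zero, Submodule.coe_zero]
  have hz0 := congrArg Subtype.val (Module.mem_annihilator.mp ha_mem ⟨e z, (e_mem z).mpr hz⟩)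
  rwa [Submodule.coe_smul, smul_e, Submodule.coe_zero, LinearEquiv.map_eq_zero_iff] at hz0

theorem exists_eq_carlitz_of_mem_torsion {n : F[X]} (hn : n ≠ 0)
    (hcard : (torsion F L n).ncard = Fintype.card F ^ n.natDegree) {g : L}
    (hg : g ∈ torsion F L n) (hgn : ∀ a, carlitz F L a g = 0 → n ∣ a) {z : L}
    (hz : z ∈ torsion F L n) : ∃ a, z = carlitz F L a g := by
  have hinj : Set.InjOn (fun a => carlitz F L a g) {a : F[X] | a.degree < n.degree} := by
    intro a ha b hb hab
    have hdvd : n ∣ a - b := hgn _ (by rw [carlitz_sub]; exact sub_eq_zero.mpr hab)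
    exact sub_eq_zero.mp (eq_zero_of_dvd_of_degree_lt hdvd
      ((degree_sub_le _ _).trans_lt (max_lt ha hb)))
  have himage : (fun a => carlitz F L a g) '' {a : F[X] | a.degree < n.degree} = torsion F L n := by
    refine Set.eq_of_subset_of_ncard_le ?_ ?_ (finite_torsion hn)
    · rintro _ ⟨a, _, rfl⟩
      exact carlitz_mem_torsion a hg
    · rw [hinj.ncard_image, hcard, ncard_degree_lt hn]
  rw [← himage] at hz
  obtain ⟨a, _, rfl⟩ := hz
  exact ⟨a, rfl⟩

end TorsionCount

section Integers

variable {F : Type*} [Field F]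

theorem algebraMap_kbar_injective : Function.Injective (algebraMap F[X] (kbar F)) := by
  rw [IsScalarTower.algebraMap_eq F[X] (RatFunc F) (kbar F)]
  exact (algebraMap (RatFunc F) (kbar F)).injective.comp (IsFractionRing.injective F[X] (RatFunc F))

section Instances

variable (K : IntermediateField (RatFunc F) (kbar F))

instance faithfulSMul_integers : FaithfulSMul F[X] (integers K) := by
  refine (faithfulSMul_iff_algebraMap_injective _ _).mpr fun a b h => ?_
  exact algebraMap_kbar_injective (congrArg (fun z : integers K => ((z : K) : kbar F)) h)

variable [FiniteDimensional (RatFunc F) K]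

instance isDedekindDomain_integers [Algebra.IsSeparable (RatFunc F) K] :
    IsDedekindDomain (integers K) :=
  integralClosure.isDedekindDomain F[X] (RatFunc F) K

instance finite_integers [Algebra.IsSeparable (RatFunc F) K] : Module.Finite F[X] (integers K) :=
  IsIntegralClosure.finite F[X] (RatFunc F) K (integers K)

instance isGaloisGroup_integers [IsGalois (RatFunc F) K] :
    IsGaloisGroup Gal(K/RatFunc F) F[X] (integers K) :=
  IsGaloisGroup.of_isFractionRing _ F[X] (integers K) (RatFunc F) K

end Instances

variable [Fintype F] {n : F[X]} {K : IntermediateField (RatFunc F) (kbar F)}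

theorem isIntegral_of_mem_torsion {L : Type*} [CommRing L] [Algebra F L] [Algebra F[X] L]
    [IsScalarTower F F[X] L] (hn : n.Monic) {z : L} (hz : z ∈ torsion F L n) :
    IsIntegral F[X] z :=
  ⟨carlitzPoly n, monic_carlitzPoly hn, by
    rw [← aeval_def, aeval_carlitzPoly, mem_torsion.mp hz]⟩

theorem coe_mem_torsion_iff {z : K} : (z : kbar F) ∈ torsion F (kbar F) n ↔ z ∈ torsion F K n :=
  map_mem_torsion_iff (φ := K.val.restrictScalars F[X]) K.val.injective

theorem coe_mem_torsion_integers_iff {z : integers K} :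
    (z : K) ∈ torsion F K n ↔ z ∈ torsion F (integers K) n :=
  map_mem_torsion_iff (φ := (integers K).val) Subtype.val_injective

theorem ncard_torsion_kbar (hn : n ≠ 0) :
    (torsion F (kbar F) n).ncard = Fintype.card F ^ n.natDegree :=
  ncard_torsion_of_isSepClosed ((map_ne_zero_iff _ algebraMap_kbar_injective).mpr hn)

theorem ncard_torsion (hn : n ≠ 0) (hK : torsion F (kbar F) n ⊆ K) :
    (torsion F K n).ncard = Fintype.card F ^ n.natDegree := by
  have himage : (fun z : K => (z : kbar F)) '' torsion F K n = torsion F (kbar F) n := by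
    ext z
    constructor
    · rintro ⟨z, hz, rfl⟩
      exact coe_mem_torsion_iff.mpr hz
    · exact fun hz => ⟨⟨z, hK hz⟩, coe_mem_torsion_iff.mp hz, rfl⟩
  rw [← ncard_torsion_kbar hn, ← himage, Set.ncard_image_of_injective _ Subtype.val_injective]

theorem ncard_torsion_integers (hn : n.Monic) (hK : torsion F (kbar F) n ⊆ K) :
    (torsion F (integers K) n).ncard = Fintype.card F ^ n.natDegree := by
  have himage : (fun z : integers K => (z : K)) '' torsion F (integers K) n = torsion F K n := by
    ext z
    constructor
    · rintro ⟨z, hz, rfl⟩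
      exact coe_mem_torsion_integers_iff.mpr hz
    · exact fun hz =>
        ⟨⟨z, isIntegral_of_mem_torsion hn hz⟩, coe_mem_torsion_integers_iff.mp hz, rfl⟩
  rw [← ncard_torsion hn.ne_zero hK, ← himage,
    Set.ncard_image_of_injective _ Subtype.val_injective]

end Integers

section Frobenius

theorem finite_quotient_span {F : Type*} [Field F] [Finite F] {w : F[X]} (hw : w ≠ 0) :
    Finite (F[X] ⧸ Ideal.span {w}) :=
  have : Module.Finite F (F[X] ⧸ Ideal.span {w}) := (AdjoinRoot.powerBasis hw).finite
  Module.finite_of_finite F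

theorem natCard_quotient_span {F : Type*} [Field F] {w : F[X]} (hw : w ≠ 0) :
    Nat.card (F[X] ⧸ Ideal.span {w}) = Nat.card F ^ w.natDegree := by
  have : Module.Finite F (F[X] ⧸ Ideal.span {w}) := (AdjoinRoot.powerBasis hw).finite
  rw [Module.natCard_eq_pow_finrank (K := F), finrank_quotient_span_eq_natDegree]

theorem finite_quotient_of_liesOver {R S : Type*} [CommRing R] [CommRing S] [Algebra R S]
    [Module.Finite R S] (p : Ideal R) (P : Ideal S) [P.LiesOver p] [Finite (R ⧸ p)] :
    Finite (S ⧸ P) :=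
  Module.finite_of_finite (R ⧸ p)

theorem eq_of_isIntegral_of_sub_mem {k B : Type*} [Field k] [CommRing B] [IsDomain B] [Algebra k B]
    {I : Ideal B} (hI : I ≠ ⊤) {x y : B} (hx : IsIntegral k x) (hy : IsIntegral k y)
    (h : x - y ∈ I) : x = y := by
  by_contra hne
  exact hI (I.eq_top_of_isUnit_mem h ((hx.sub hy).isUnit (sub_ne_zero.mpr hne)))

variable {F : Type*} [Field F] [Fintype F] {K : IntermediateField (RatFunc F) (kbar F)}

/-- The automorphism `σ` of `K` acts on the `n`-torsion of the Carlitz module as `C_a`, and on the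
constants as the `s`-th power of the `q`-Frobenius. -/
def ActsAs (n a : F[X]) (s : ℕ) (σ : Gal(K/RatFunc F)) : Prop :=
  (∀ z : K, z ∈ torsion F K n → σ z = carlitz F K a z) ∧
    ∀ c : K, IsIntegral F c → σ c = c ^ Fintype.card F ^ s

theorem ActsAs.mul {n a b : F[X]} {s t : ℕ} {σ τ : Gal(K/RatFunc F)} (hσ : ActsAs n a s σ)
    (hτ : ActsAs n b t τ) : ActsAs n (a * b) (s + t) (σ * τ) := by
  refine ⟨fun z hz => ?_, fun c hc => ?_⟩
  · rw [AlgEquiv.mul_apply, hτ.1 z hz, hσ.1 _ (carlitz_mem_torsion b hz), carlitz_mul]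
  · rw [AlgEquiv.mul_apply, hτ.2 c hc, map_pow, hσ.2 c hc, ← pow_mul, pow_add]

theorem actsAs_one (n : F[X]) : ActsAs n 1 0 (1 : Gal(K/RatFunc F)) :=
  ⟨fun z _ => by rw [carlitz_one, AlgEquiv.one_apply],
    fun c _ => by rw [pow_zero, pow_one, AlgEquiv.one_apply]⟩

theorem carlitz_algEquiv (σ : Gal(K/RatFunc F)) (a : F[X]) (z : K) :
    σ (carlitz F K a z) = carlitz F K a (σ z) :=
  carlitz_map ((σ : K →ₐ[RatFunc F] K).restrictScalars F[X]) a z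

theorem algEquiv_mem_torsion (σ : Gal(K/RatFunc F)) {n : F[X]} {z : K} (hz : z ∈ torsion F K n) :
    σ z ∈ torsion F K n :=
  map_mem_torsion ((σ : K →ₐ[RatFunc F] K).restrictScalars F[X]) hz

section

variable [FiniteDimensional (RatFunc F) K] [IsGalois (RatFunc F) K]

theorem exists_smul_sub_pow_mem {w : F[X]} (hw : Irreducible w) :
    ∃ W : Ideal (integers K), W ≠ ⊤ ∧ (∀ f, algebraMap F[X] (integers K) f ∈ W ↔ w ∣ f) ∧
      ∃ σ : Gal(K/RatFunc F), ∀ x : integers K,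
        σ • x - x ^ Fintype.card F ^ w.natDegree ∈ W := by
  have hmax : (Ideal.span {w}).IsMaximal := PrincipalIdealRing.isMaximal_of_irreducible hw
  obtain ⟨W, hWmax, hW⟩ :=
    Ideal.exists_maximal_ideal_liesOver_of_isIntegral (S := integers K) (Ideal.span {w})
  have : Finite (F[X] ⧸ Ideal.span {w}) := finite_quotient_span hw.ne_zero
  have : Finite (integers K ⧸ W) := finite_quotient_of_liesOver (Ideal.span {w}) W
  obtain ⟨σ, hσ⟩ := IsArithFrobAt.exists_of_isInvariant F[X] Gal(K/RatFunc F) W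
  refine ⟨W, hWmax.ne_top, fun f => ?_, σ, fun x => ?_⟩
  · rw [← Ideal.mem_span_singleton, hW.over, Ideal.under_def, Ideal.mem_comap]
  · have hx := hσ x
    rwa [← hW.over, natCard_quotient_span hw.ne_zero, Nat.card_eq_fintype_card] at hx

/-- The Frobenius automorphism at a prime above `w` acts this way: modulo that prime `C_w` is the
`q ^ deg w`-th power map, and both torsion points and constants are determined by their
reductions. -/
theorem exists_actsAs_of_irreducible {n w : F[X]} (hn : n.Monic) (hw : w.Monic)
    (hwirr : Irreducible w) (hwn : ¬ w ∣ n) :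
    ∃ σ : Gal(K/RatFunc F), ActsAs n w w.natDegree σ := by
  obtain ⟨W, hWtop, hWmem, σ, hσ⟩ := exists_smul_sub_pow_mem (K := K) hwirr
  refine ⟨σ, fun z hz => ?_, fun c hc => ?_⟩
  · let y : integers K := ⟨z, isIntegral_of_mem_torsion hn hz⟩
    have hy : y ∈ torsion F (integers K) n := coe_mem_torsion_integers_iff.mp hz
    have hσy : σ • y ∈ torsion F (integers K) n := by
      rw [← coe_mem_torsion_integers_iff, integralClosure.coe_smul]
      exact algEquiv_mem_torsion σ hz
    have hsub : σ • y - carlitz F (integers K) w y ∈ W := by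
      rw [← sub_sub_sub_cancel_right]
      exact W.sub_mem (hσ y) (carlitz_sub_pow_mem hw hwirr ((hWmem w).mpr dvd_rfl) y)
    have heq : σ • y = carlitz F (integers K) w y :=
      sub_eq_zero.mp <| eq_zero_of_mem_torsion_of_mem_ideal (by rwa [hWmem])
        (sub_mem_torsion hσy (carlitz_mem_torsion w hy)) hsub
    exact (congrArg (integers K).val heq).trans (carlitz_map (integers K).val w y)
  · let e : integers K := ⟨c, hc.tower_top⟩
    have hint (x : integers K) : IsIntegral F (x : K) ↔ IsIntegral F x :=
      isIntegral_algHom_iff ((integers K).val.restrictScalars F) Subtype.val_injective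
    have hσe : IsIntegral F (σ • e) := (hint _).mp <| by
      rw [integralClosure.coe_smul]
      exact hc.map ((σ : K →ₐ[RatFunc F] K).restrictScalars F)
    exact congrArg (integers K).val
      (eq_of_isIntegral_of_sub_mem hWtop hσe (((hint e).mp hc).pow _) (hσ e))

theorem exists_actsAs_of_monic {n : F[X]} (hn : n.Monic) (a : F[X]) (ha : a.Monic)
    (han : IsCoprime a n) : ∃ σ : Gal(K/RatFunc F), ActsAs n a a.natDegree σ := by
  induction hk : a.natDegree using Nat.strong_induction_on generalizing a with
  | _ k ih =>
    subst hk
    rcases Nat.eq_zero_or_pos a.natDegree with h0 | hpos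
    · rw [h0, ha.natDegree_eq_zero.mp h0]
      exact ⟨1, actsAs_one n⟩
    · obtain ⟨w, hw, hwirr, b, rfl⟩ := exists_monic_irreducible_factor a
        (not_isUnit_of_natDegree_pos a hpos)
      have hb : b.Monic := hw.of_mul_monic_left ha
      have hwpos := hwirr.natDegree_pos
      rw [hw.natDegree_mul hb] at ih ⊢
      obtain ⟨σ, hσ⟩ := exists_actsAs_of_irreducible (K := K) hn hw hwirr fun h =>
        hwirr.not_isUnit (han.of_mul_left_left.isUnit_of_dvd' dvd_rfl h)
      obtain ⟨τ, hτ⟩ := ih b.natDegree (by lia) b hb han.of_mul_left_right rfl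
      exact ⟨σ * τ, hσ.mul hτ⟩

/-- The residue of `a` modulo `n` does not bound the degree of its monic representatives, so that
the degree can be prescribed modulo `m`. -/
theorem exists_actsAs {n : F[X]} (hn : n.Monic) {m : ℕ} (hm : 0 < m) {a : F[X]}
    (han : IsCoprime a n) (s : ℕ) :
    ∃ (t : ℕ) (σ : Gal(K/RatFunc F)), t ≡ s [MOD m] ∧ ActsAs n a t σ := by
  obtain ⟨D, hD, hmod⟩ : ∃ D, a.natDegree < D ∧ n.natDegree + D ≡ s [MOD m] := by
    refine ⟨s + (m - 1) * n.natDegree + m * (a.natDegree + 1), by nlinarith, ?_⟩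
    refine (Nat.modEq_iff_dvd.mpr ⟨-(n.natDegree + a.natDegree + 1), ?_⟩)
    rw [Nat.cast_add, Nat.cast_add, Nat.cast_add, Nat.cast_mul, Nat.cast_sub (by lia)]
    push_cast
    ring
  have hlt : a.degree < (n * X ^ D).degree := degree_lt_degree <| by
    rw [hn.natDegree_mul (monic_X_pow _), natDegree_X_pow]
    lia
  have hdeg : (n * X ^ D + a).natDegree = n.natDegree + D := by
    rw [natDegree_add_eq_left_of_degree_lt hlt, hn.natDegree_mul (monic_X_pow _), natDegree_X_pow]
  obtain ⟨σ, hσ⟩ := exists_actsAs_of_monic (K := K) hn (n * X ^ D + a)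
    ((hn.mul (monic_X_pow D)).add_of_left hlt) (by
      rw [add_comm]
      exact han.add_mul_left_left _)
  refine ⟨_, σ, hdeg ▸ hmod, fun z hz => ?_, hσ.2⟩
  rw [hσ.1 z hz]
  exact carlitz_eq_of_dvd_sub ⟨X ^ D, by ring⟩ hz

end

end Frobenius

section ConstField

variable {F : Type*} [Field F] [Fintype F]

theorem one_lt_card_pow {m : ℕ} (hm : 0 < m) : 1 < Fintype.card F ^ m :=
  Nat.one_lt_pow hm.ne' Fintype.one_lt_card

theorem frobeniusAlgHom_pow_apply {L : Type*} [CommRing L] [Algebra F L] (m : ℕ) (z : L) :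
    (FiniteField.frobeniusAlgHom F L ^ m) z = z ^ Fintype.card F ^ m := by
  rw [AlgHom.coe_pow, FiniteField.coe_frobeniusAlgHom, pow_iterate]

theorem sub_pow_card_pow {L : Type*} [CommRing L] [Algebra F L] (m : ℕ) (x y : L) :
    (x - y) ^ Fintype.card F ^ m = x ^ Fintype.card F ^ m - y ^ Fintype.card F ^ m := by
  simp only [← frobeniusAlgHom_pow_apply, map_sub]

theorem add_pow_card_pow {L : Type*} [CommRing L] [Algebra F L] (m : ℕ) (x y : L) :
    (x + y) ^ Fintype.card F ^ m = x ^ Fintype.card F ^ m + y ^ Fintype.card F ^ m := by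
  simp only [← frobeniusAlgHom_pow_apply, map_add]

theorem mem_rootSet_X_pow_card_pow_sub_X {m : ℕ} (hm : 0 < m) {k E : Type*} [Field k] [Field E]
    [Algebra k E] {c : E} :
    c ∈ (X ^ Fintype.card F ^ m - X : k[X]).rootSet E ↔ c ^ Fintype.card F ^ m = c := by
  rw [mem_rootSet, map_sub, map_pow, aeval_X, sub_eq_zero]
  exact and_iff_right (FiniteField.X_pow_card_sub_X_ne_zero _ (one_lt_card_pow hm))

theorem separable_X_pow_sub_X {m : ℕ} (hm : 0 < m) (k : Type*) [Field k] [Algebra F k] :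
    (X ^ Fintype.card F ^ m - X : k[X]).Separable := by
  obtain ⟨p, hp⟩ := CharP.exists F
  have : CharP k p := charP_of_injective_algebraMap (algebraMap F k).injective p
  refine galois_poly_separable p _ ?_
  rw [← CharP.cast_eq_zero_iff F p, Nat.cast_pow, FiniteField.cast_card_eq_zero, zero_pow hm.ne']

theorem mem_constField_iff {m : ℕ} (hm : 0 < m) {c : kbar F} :
    c ∈ constField F m ↔ c ^ Fintype.card F ^ m = c := by
  rw [← mem_rootSet_X_pow_card_pow_sub_X (k := F) hm]
  refine ⟨fun hc => ?_, fun hc => IntermediateField.subset_adjoin _ _ hc⟩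
  rw [mem_rootSet_X_pow_card_pow_sub_X hm]
  induction hc using IntermediateField.adjoin_induction with
  | mem x hx => exact (mem_rootSet_X_pow_card_pow_sub_X hm).mp hx
  | algebraMap x => rw [← map_pow, FiniteField.pow_card_pow]
  | add x y _ _ hx hy => rw [add_pow_card_pow, hx, hy]
  | inv x _ hx => rw [inv_pow, hx]
  | mul x y _ _ hx hy => rw [mul_pow, hx, hy]

theorem coe_constField {m : ℕ} (hm : 0 < m) (k : Type*) [Field k] [Algebra k (kbar F)] :
    (constField F m : Set (kbar F)) = (X ^ Fintype.card F ^ m - X : k[X]).rootSet (kbar F) := by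
  ext c
  rw [mem_rootSet_X_pow_card_pow_sub_X hm, SetLike.mem_coe, mem_constField_iff hm]

theorem natCard_constField {m : ℕ} (hm : 0 < m) :
    Nat.card (constField F m) = Fintype.card F ^ m := by
  classical
  have hcard := card_rootSet_eq_natDegree (separable_X_pow_sub_X (F := F) hm F)
    (IsAlgClosed.splits (Polynomial.map (algebraMap F (kbar F)) _))
  rw [FiniteField.X_pow_card_pow_sub_X_natDegree_eq F hm.ne' Fintype.one_lt_card,
    ← Nat.card_eq_fintype_card, ← coe_constField hm F] at hcard
  exact hcard

theorem finite_constField {m : ℕ} (hm : 0 < m) : Finite (constField F m) :=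
  Nat.finite_of_card_ne_zero <| by
    rw [natCard_constField hm]
    exact pow_ne_zero _ Fintype.card_ne_zero

theorem card_constField {m : ℕ} [Fintype (constField F m)] (hm : 0 < m) :
    Fintype.card (constField F m) = Fintype.card F ^ m := by
  rw [← Nat.card_eq_fintype_card, natCard_constField hm]

end ConstField

section GaloisGroup

variable {F : Type*} [Field F] [Fintype F]

theorem isGalois_adjoin_rootSet {k E : Type*} [Field k] [Field E] [Algebra k E] [IsAlgClosed E]
    {p : k[X]} (hp : p.Separable) :
    FiniteDimensional k (IntermediateField.adjoin k (p.rootSet E)) ∧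
      IsGalois k (IntermediateField.adjoin k (p.rootSet E)) := by
  have := IntermediateField.adjoin_rootSet_isSplittingField (p := p) (L := E)
    (IsAlgClosed.splits _)
  exact ⟨IsSplittingField.finiteDimensional _ p, IsGalois.of_separable_splitting_field hp⟩

theorem isGalois_cycField {n : F[X]} (hn : n ≠ 0) :
    FiniteDimensional (RatFunc F) (cycField F n) ∧ IsGalois (RatFunc F) (cycField F n) := by
  have hn' : algebraMap F[X] (RatFunc F) n ≠ 0 :=
    (map_ne_zero_iff _ (IsFractionRing.injective F[X] (RatFunc F))).mpr hn
  have hroots : torsion F (kbar F) n =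
      ((carlitzPoly n).map (algebraMap F[X] (RatFunc F))).rootSet (kbar F) := by
    classical rw [torsion_eq_rootSet hn, rootSet_def, rootSet_def, aroots_map]
  rw [cycField, hroots]
  refine isGalois_adjoin_rootSet ?_
  rw [separable_def, derivative_map, derivative_carlitzPoly, map_C]
  exact isCoprime_one_right.of_isCoprime_of_dvd_right (isUnit_C.mpr hn'.isUnit).dvd

theorem isGalois_compField {n : F[X]} (hn : n ≠ 0) {m : ℕ} (hm : 0 < m) :
    FiniteDimensional (RatFunc F) (compField F n m) ∧ IsGalois (RatFunc F) (compField F n m) := by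
  let E : IntermediateField (RatFunc F) (kbar F) :=
    IntermediateField.adjoin (RatFunc F) (constField F m : Set (kbar F))
  obtain ⟨_, _⟩ := isGalois_cycField hn
  obtain ⟨_, _⟩ : FiniteDimensional (RatFunc F) E ∧ IsGalois (RatFunc F) E := by
    unfold E
    rw [coe_constField hm (RatFunc F)]
    exact isGalois_adjoin_rootSet (separable_X_pow_sub_X hm (RatFunc F))
  have : Normal (RatFunc F) (compField F n m) := IntermediateField.normal_sup _ _ (cycField F n) E
  have : Algebra.IsSeparable (RatFunc F) (compField F n m) :=
    IntermediateField.isSeparable_sup _ _ (cycField F n) E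
  exact ⟨IntermediateField.finiteDimensional_sup (cycField F n) E, ⟨⟩⟩

theorem torsion_subset_cycField (n : F[X]) : torsion F (kbar F) n ⊆ cycField F n :=
  IntermediateField.subset_adjoin _ _

theorem torsion_subset_compField (n : F[X]) (m : ℕ) :
    torsion F (kbar F) n ⊆ compField F n m :=
  (torsion_subset_cycField n).trans (cycField_le_compField n m)

theorem isIntegral_of_coe_mem_constField {K : IntermediateField (RatFunc F) (kbar F)} {m : ℕ}
    {c : K} (hc : (c : kbar F) ∈ constField F m) : IsIntegral F c :=
  (isIntegral_algHom_iff (K.val.restrictScalars F) K.val.injective).mp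
    (isIntegral_of_mem_constField m hc)

theorem pow_card_pow_of_coe_mem_constField {K : IntermediateField (RatFunc F) (kbar F)} {m : ℕ}
    (hm : 0 < m) {c : K} (hc : (c : kbar F) ∈ constField F m) : c ^ Fintype.card F ^ m = c :=
  Subtype.ext ((mem_constField_iff hm).mp hc)

theorem pow_pow_eq_of_modEq {M : Type*} [Monoid M] {Q m s t : ℕ} (hst : s ≡ t [MOD m]) {c : M}
    (hc : c ^ Q ^ m = c) : c ^ Q ^ s = c ^ Q ^ t := by
  have hadd (r k : ℕ) : c ^ Q ^ (r + m * k) = c ^ Q ^ r := by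
    induction k with
    | zero => rw [mul_zero, add_zero]
    | succ k ih => rw [mul_add_one, ← add_assoc, add_comm, pow_add, pow_mul, hc, ih]
  rw [← Nat.mod_add_div s m, ← Nat.mod_add_div t m, hadd, hadd, hst]

theorem sigma_spec {n : F[X]} (hn : n.Monic) {m : ℕ} (hm : 0 < m) {a : F[X]}
    (han : IsCoprime a n) (s : ℕ) :
    (∀ z : compField F n m, z ∈ torsion F (compField F n m) n →
        sigma n m a s z = carlitz F (compField F n m) a z) ∧
      ∀ c : compField F n m, (c : kbar F) ∈ constField F m →
        sigma n m a s c = c ^ Fintype.card F ^ s := by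
  obtain ⟨_, _⟩ := isGalois_compField hn.ne_zero hm
  obtain ⟨t, σ, hts, hσ⟩ := exists_actsAs (K := compField F n m) hn hm han s
  have hex : ∃ σ : Gal(compField F n m/RatFunc F),
      (∀ z : compField F n m, z ∈ torsion F (compField F n m) n →
        σ z = carlitz F (compField F n m) a z) ∧
      ∀ c : compField F n m, (c : kbar F) ∈ constField F m → σ c = c ^ Fintype.card F ^ s := by
    refine ⟨σ, hσ.1, fun c hc => ?_⟩
    rw [hσ.2 c (isIntegral_of_coe_mem_constField hc)]
    exact pow_pow_eq_of_modEq hts (pow_card_pow_of_coe_mem_constField hm hc)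
  rw [sigma, dif_pos hex]
  exact hex.choose_spec

theorem rho_spec {n : F[X]} (hn : n.Monic) {a : F[X]} (han : IsCoprime a n) {z : cycField F n}
    (hz : z ∈ torsion F (cycField F n) n) : rho n a z = carlitz F (cycField F n) a z := by
  obtain ⟨_, _⟩ := isGalois_cycField hn.ne_zero
  obtain ⟨t, σ, -, hσ⟩ := exists_actsAs (K := cycField F n) hn one_pos han 0
  have hex : ∃ σ : Gal(cycField F n/RatFunc F), ∀ z : cycField F n,
      z ∈ torsion F (cycField F n) n → σ z = carlitz F (cycField F n) a z := ⟨σ, hσ.1⟩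
  rw [rho, dif_pos hex]
  exact hex.choose_spec z hz

theorem compField_algHom_ext {n : F[X]} {m : ℕ} {L : Type*} [Field L] [Algebra (RatFunc F) L]
    {σ τ : compField F n m →ₐ[RatFunc F] L}
    (htor : ∀ z : compField F n m, z ∈ torsion F (compField F n m) n → σ z = τ z)
    (hconst : ∀ c : compField F n m, (c : kbar F) ∈ constField F m → σ c = τ c) : σ = τ := by
  have hadj : compField F n m = IntermediateField.adjoin (RatFunc F)
      (torsion F (kbar F) n ∪ (constField F m : Set (kbar F))) := by
    rw [compField, cycField, IntermediateField.adjoin_union]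
  refine IntermediateField.algHom_ext_of_eq_adjoin _ hadj fun x hx => ?_
  rcases hx with hx | hx
  · exact htor _ (coe_mem_torsion_iff.mp hx)
  · exact hconst _ hx

theorem compField_algEquiv_ext {n : F[X]} {m : ℕ} {σ τ : Gal(compField F n m/RatFunc F)}
    (htor : ∀ z : compField F n m, z ∈ torsion F (compField F n m) n → σ z = τ z)
    (hconst : ∀ c : compField F n m, (c : kbar F) ∈ constField F m → σ c = τ c) : σ = τ :=
  AlgEquiv.coe_toAlgHom_injective (compField_algHom_ext htor hconst)

theorem exists_algHom_eq_pow_card_pow {E : Type*} [Field E] [Finite E] [Algebra F E]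
    (f : E →ₐ[F] E) : ∃ s, ∀ c, f c = c ^ Fintype.card F ^ s := by
  have := Fintype.ofFinite E
  obtain ⟨s, hs⟩ := (FiniteField.bijective_frobeniusAlgHom_pow F E).2 f
  exact ⟨s, fun c => hs ▸ frobeniusAlgHom_pow_apply (s : ℕ) c⟩

theorem exists_const_eq_pow_card_pow {K : IntermediateField (RatFunc F) (kbar F)} {m : ℕ}
    (hm : 0 < m) (hK : (constField F m : Set (kbar F)) ⊆ K) (σ : Gal(K/RatFunc F)) :
    ∃ s < m, ∀ c : K, (c : kbar F) ∈ constField F m → σ c = c ^ Fintype.card F ^ s := by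
  have := finite_constField (F := F) hm
  let incl : constField F m →ₐ[F] K :=
    (constField F m).val.codRestrict (K.restrictScalars F).toSubalgebra fun c => hK c.2
  let f : constField F m →ₐ[F] kbar F := (K.val.restrictScalars F).comp
    (((σ : K →ₐ[RatFunc F] K).restrictScalars F).comp incl)
  have hf (c : constField F m) : f c ∈ constField F m := by
    rw [mem_constField_iff hm, ← map_pow]
    exact congrArg f (Subtype.ext ((mem_constField_iff hm).mp c.2))
  obtain ⟨s, hs⟩ := exists_algHom_eq_pow_card_pow (f.codRestrict (constField F m).toSubalgebra hf)
  refine ⟨s % m, Nat.mod_lt _ hm, fun c hc => ?_⟩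
  rw [pow_pow_eq_of_modEq (Nat.mod_modEq s m) (pow_card_pow_of_coe_mem_constField hm hc)]
  exact Subtype.ext (congrArg (fun e : constField F m => (e : kbar F)) (hs ⟨c, hc⟩))

theorem exists_torsion_eq_carlitz {K : IntermediateField (RatFunc F) (kbar F)} {n : F[X]}
    (hn : n ≠ 0) (hK : torsion F (kbar F) n ⊆ K) (σ : Gal(K/RatFunc F)) :
    ∃ a : F[X], IsCoprime a n ∧ ∀ z : K, z ∈ torsion F K n → σ z = carlitz F K a z := by
  have hcard := ncard_torsion hn hK
  obtain ⟨g, hg, hgn⟩ := exists_mem_torsion_forall_dvd hn hcard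
  have hgen {z : K} (hz : z ∈ torsion F K n) : ∃ a, z = carlitz F K a g :=
    exists_eq_carlitz_of_mem_torsion hn hcard hg hgn hz
  obtain ⟨a, ha⟩ := hgen (algEquiv_mem_torsion σ hg)
  obtain ⟨b, hb⟩ := hgen (algEquiv_mem_torsion σ⁻¹ hg)
  refine ⟨a, ?_, fun z hz => ?_⟩
  · have hba : carlitz F K (b * a) g = g := by
      rw [carlitz_mul, ← ha, ← carlitz_algEquiv, ← hb, ← AlgEquiv.mul_apply, mul_inv_cancel,
        AlgEquiv.one_apply]
    obtain ⟨c, hc⟩ := hgn (b * a - 1) (by rw [carlitz_sub, hba, carlitz_one, sub_self])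
    exact ⟨b, -c, by linear_combination hc⟩
  · obtain ⟨c, rfl⟩ := hgen hz
    rw [carlitz_algEquiv, ha, carlitz_comm]

theorem mem_monicCoprime {n a : F[X]} :
    a ∈ monicCoprime F n ↔ a.Monic ∧ a.degree < n.degree ∧ IsCoprime a n := by
  rw [monicCoprime, Set.Finite.mem_toFinset]
  rfl

theorem exists_mem_monicCoprime_dvd_sub {n : F[X]} (hn : 0 < n.natDegree) {a : F[X]}
    (han : IsCoprime a n) : ∃ u : Fˣ, ∃ b ∈ monicCoprime F n, n ∣ a - C (u : F) * b := by
  have hn0 : n ≠ 0 := ne_zero_of_natDegree_gt hn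
  have hmod : a % n = a + n * -(a / n) := by linear_combination EuclideanDomain.mod_add_div a n
  have hcop : IsCoprime (a % n) n := hmod ▸ han.add_mul_left_left _
  have hr : a % n ≠ 0 := fun h => by
    rw [h, isCoprime_zero_left] at hcop
    exact hn.ne' (natDegree_eq_zero_of_isUnit hcop)
  have hlc : (a % n).leadingCoeff ≠ 0 := leadingCoeff_ne_zero.mpr hr
  refine ⟨Units.mk0 _ hlc, a % n * C (a % n).leadingCoeff⁻¹, mem_monicCoprime.mpr
    ⟨monic_mul_leadingCoeff_inv hr, ?_, ?_⟩, a / n, ?_⟩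
  · rw [degree_mul_C (inv_ne_zero hlc)]
    exact EuclideanDomain.mod_lt a hn0
  · exact (isCoprime_mul_unit_right_left (isUnit_C.mpr (inv_ne_zero hlc).isUnit) _ _).mpr hcop
  · rw [Units.val_mk0, mul_left_comm, ← C_mul, mul_inv_cancel₀ hlc, C_1, hmod]
    ring

theorem natCard_gal_compField_le {n : F[X]} (hn : 0 < n.natDegree) {m : ℕ} (hm : 0 < m) :
    Nat.card Gal(compField F n m/RatFunc F) ≤
      m * ((Fintype.card F - 1) * (monicCoprime F n).card) := by
  classical
  have hdata (σ : Gal(compField F n m/RatFunc F)) : ∃ p : Fin m × Fˣ × monicCoprime F n,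
      (∀ z : compField F n m, z ∈ torsion F (compField F n m) n →
        σ z = carlitz F (compField F n m) (C (p.2.1 : F) * p.2.2) z) ∧
      ∀ c : compField F n m, (c : kbar F) ∈ constField F m →
        σ c = c ^ Fintype.card F ^ (p.1 : ℕ) := by
    obtain ⟨s, hs, hconst⟩ := exists_const_eq_pow_card_pow hm
      (fun c hc => mem_compField_of_mem_constField n m hc) σ
    obtain ⟨a, han, htor⟩ := exists_torsion_eq_carlitz (ne_zero_of_natDegree_gt hn)
      (torsion_subset_compField n m) σ
    obtain ⟨u, b, hb, hdvd⟩ := exists_mem_monicCoprime_dvd_sub hn han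
    exact ⟨⟨⟨s, hs⟩, u, ⟨b, hb⟩⟩,
      fun z hz => (htor z hz).trans (carlitz_eq_of_dvd_sub hdvd hz), hconst⟩
  choose f hf using hdata
  have hinj : Function.Injective f := fun σ τ h => compField_algEquiv_ext
    (fun z hz => by rw [(hf σ).1 z hz, (hf τ).1 z hz, h])
    (fun c hc => by rw [(hf σ).2 c hc, (hf τ).2 c hc, h])
  refine (Nat.card_le_card_of_injective f hinj).trans_eq ?_
  rw [Nat.card_prod, Nat.card_prod, Nat.card_fin, Nat.card_units, Nat.card_eq_fintype_card,
    Nat.card_eq_fintype_card, Fintype.card_coe]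

end GaloisGroup

section Infinity

theorem map_sum_pow_le {R Γ₀ ι : Type*} [Ring R] [LinearOrderedCommMonoidWithZero Γ₀]
    (w : Valuation R Γ₀) {k : ℕ} (hk : k ≠ 0) {t : Γ₀} {s : Finset ι} {f : ι → R}
    (h : ∀ i ∈ s, w (f i) ^ k ≤ t) : w (∑ i ∈ s, f i) ^ k ≤ t := by
  refine Finset.sum_induction f (fun x => w x ^ k ≤ t) (fun x y hx hy => ?_) ?_ h
  · rcases le_max_iff.mp (w.map_add x y) with hxy | hxy
    · exact (pow_le_pow_left₀ zero_le hxy k).trans hx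
    · exact (pow_le_pow_left₀ zero_le hxy k).trans hy
  · simp [hk]

variable {F : Type*} [Field F] {L : Type*} [Field L] [Algebra F L] {B : ValuationSubring L}

theorem valuation_algebraMap_eq_one (hB : ∀ c : F, algebraMap F L c ∈ B) {c : F} (hc : c ≠ 0) :
    B.valuation (algebraMap F L c) = 1 := by
  refine le_antisymm ((B.valuation_le_one_iff _).mpr (hB c)) ?_
  have hinv := (B.valuation_le_one_iff _).mpr (hB c⁻¹)
  rw [map_inv₀, map_inv₀] at hinv
  exact (inv_le_one₀ (zero_lt_iff.mpr (by simpa using hc))).mp hinv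

theorem valuation_le_one_of_isIntegral (hB : ∀ c : F, algebraMap F L c ∈ B) {c : L}
    (hc : IsIntegral F c) : B.valuation c ≤ 1 := by
  have hcB : IsIntegral B c := by
    obtain ⟨p, hp, hpc⟩ := hc
    refine ⟨p.map ((algebraMap F L).codRestrict B.toSubring hB), hp.map _, ?_⟩
    rw [eval₂_map]
    exact hpc
  obtain ⟨b, rfl⟩ := IsIntegrallyClosed.isIntegral_iff.mp hcB
  exact B.valuation_le_one b

variable [Algebra F[X] L] [IsScalarTower F F[X] L]

/-- Any proper ideal is dominated by a valuation ring, and `θ⁻¹` is not invertible in `F[θ⁻¹]`. -/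
theorem exists_valuationSubring_infty (hinj : Function.Injective (algebraMap F[X] L)) :
    ∃ B : ValuationSubring L, (∀ c : F, algebraMap F L c ∈ B) ∧
      1 < B.valuation (algebraMap F[X] L X) := by
  set θ := algebraMap F[X] L X with hθ
  have hθ0 : θ ≠ 0 := (map_ne_zero_iff _ hinj).mpr X_ne_zero
  have haeval (p : F[X]) : aeval θ p = algebraMap F[X] L p := by
    rw [hθ, aeval_algebraMap_apply, aeval_X_left_apply]
  let A : Subring L := (aeval θ⁻¹ : F[X] →ₐ[F] L).range.toSubring
  have hmem (p : F[X]) : aeval θ⁻¹ p ∈ A := ⟨p, rfl⟩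
  have hθA : θ⁻¹ ∈ A := by simpa using hmem X
  let I : Ideal A := Ideal.span {⟨θ⁻¹, hθA⟩}
  have hI : I ≠ ⊤ := by
    intro h
    rw [Ideal.span_singleton_eq_top, isUnit_iff_exists_inv] at h
    obtain ⟨⟨_, p, rfl⟩, hp⟩ := h
    have hp' : θ⁻¹ * aeval θ⁻¹ p = 1 := congrArg Subtype.val hp
    have halg : IsAlgebraic F θ⁻¹ := by
      refine ⟨X * p - 1, fun h0 => ?_, by rw [map_sub, map_mul, aeval_X, hp', map_one, sub_self]⟩
      simpa using congrArg (coeff · 0) h0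
    obtain ⟨r, hr0, hr⟩ := IsAlgebraic.inv_iff.mp halg
    rw [haeval, map_eq_zero_iff _ hinj] at hr
    exact hr0 hr
  obtain ⟨B, hAB, hIB⟩ := Ideal.image_subset_nonunits_valuationSubring I hI
  refine ⟨B, fun c => hAB (by simpa using hmem (C c)), ?_⟩
  have hnonunit : θ⁻¹ ∈ B.nonunits :=
    hIB ⟨⟨θ⁻¹, hθA⟩, Ideal.mem_span_singleton_self _, rfl⟩
  rw [ValuationSubring.mem_nonunits_iff, map_inv₀] at hnonunit
  exact (inv_lt_one₀ (zero_lt_iff.mpr ((_root_.map_ne_zero _).mpr hθ0))).mp hnonunit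

theorem valuation_algebraMap_polynomial (hB : ∀ c : F, algebraMap F L c ∈ B)
    (hθ : 1 < B.valuation (algebraMap F[X] L X)) {f : F[X]} (hf : f ≠ 0) :
    B.valuation (algebraMap F[X] L f) = B.valuation (algebraMap F[X] L X) ^ f.natDegree := by
  set θ := algebraMap F[X] L X
  have hsum : algebraMap F[X] L f =
      ∑ i ∈ Finset.range (f.natDegree + 1), algebraMap F L (f.coeff i) * θ ^ i := by
    conv_lhs => rw [f.as_sum_range_C_mul_X_pow]
    simp only [map_sum, map_mul, map_pow, IsScalarTower.algebraMap_apply F F[X] L,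
      algebraMap_eq, θ]
  have hlead : B.valuation (algebraMap F L (f.coeff f.natDegree) * θ ^ f.natDegree) =
      B.valuation θ ^ f.natDegree := by
    rw [coeff_natDegree, map_mul, map_pow,
      valuation_algebraMap_eq_one hB (leadingCoeff_ne_zero.mpr hf), one_mul]
  rw [hsum, Finset.sum_range_succ, Valuation.map_add_eq_of_lt_right, hlead]
  rw [hlead]
  refine Valuation.map_sum_lt _ (pow_ne_zero _ (zero_lt_one.trans hθ).ne') fun i hi => ?_
  rw [map_mul, map_pow]
  exact (mul_le_of_le_one_left' ((B.valuation_le_one_iff _).mpr (hB _))).trans_lt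
    (pow_lt_pow_right₀ hθ (Finset.mem_range.mp hi))

theorem natDegree_mul_le_of_algebraMap_eq_prod (hB : ∀ c : F, algebraMap F L c ∈ B)
    (hθ : 1 < B.valuation (algebraMap F[X] L X)) {k : ℕ} {G : Type*} [Fintype G] {g : G → L}
    (hg : ∀ σ, B.valuation (g σ) ^ k ≤ B.valuation (algebraMap F[X] L X)) {f : F[X]} (hf : f ≠ 0)
    (hprod : algebraMap F[X] L f = ∏ σ, g σ) : f.natDegree * k ≤ Fintype.card G := by
  refine (pow_le_pow_iff_right₀ hθ).mp ?_
  calc B.valuation (algebraMap F[X] L X) ^ (f.natDegree * k)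
      = ∏ σ, B.valuation (g σ) ^ k := by
        rw [pow_mul, ← valuation_algebraMap_polynomial hB hθ hf, hprod, map_prod, Finset.prod_pow]
    _ ≤ ∏ _σ : G, B.valuation (algebraMap F[X] L X) := Finset.prod_le_prod' fun σ _ => hg σ
    _ = B.valuation (algebraMap F[X] L X) ^ Fintype.card G := by
        rw [Finset.prod_const, Finset.card_univ]

variable [Fintype F]

/-- If `y` is a torsion point of largest absolute value and `|y| ^ (q - 1) > |θ|`, then
`C_θ(y) = θ y + y ^ q` is larger than `y`. -/
theorem valuation_pow_le_of_mem_torsion (hθ : 1 < B.valuation (algebraMap F[X] L X))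
    {n : F[X]} (hn : n ≠ 0) {z : L} (hz : z ∈ torsion F L n) :
    B.valuation z ^ (Fintype.card F - 1) ≤ B.valuation (algebraMap F[X] L X) := by
  obtain ⟨y, hy, hmax⟩ := Set.exists_max_image (torsion F L n) B.valuation (finite_torsion hn)
    ⟨z, hz⟩
  refine (pow_le_pow_left₀ zero_le (hmax z hz) _).trans ?_
  by_contra! hlarge
  have hy0 : 0 < B.valuation y := by
    refine zero_lt_iff.mpr fun h0 => (hθ.trans hlarge).not_ge ?_
    exact pow_le_one₀ zero_le (h0 ▸ zero_le_one)
  have hpow : B.valuation (y ^ Fintype.card F) =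
      B.valuation y ^ (Fintype.card F - 1) * B.valuation y := by
    rw [map_pow, pow_sub_one_mul Fintype.card_ne_zero]
  have hdom : B.valuation (algebraMap F[X] L X * y) < B.valuation (y ^ Fintype.card F) := by
    rw [map_mul, hpow]
    exact mul_lt_mul_of_pos_right hlarge hy0
  have hle : B.valuation (carlitz F L X y) ≤ B.valuation y := hmax _ (carlitz_mem_torsion X hy)
  rw [carlitz_X, Valuation.map_add_eq_of_lt_right _ hdom, hpow] at hle
  exact hle.not_gt (lt_mul_of_one_lt_left hy0 (hθ.trans hlarge))

theorem valuation_one_add_sum_pow_le (hB : ∀ c : F, algebraMap F L c ∈ B)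
    (hθ : 1 < B.valuation (algebraMap F[X] L X)) {n : F[X]} (hn : n ≠ 0) {ι : Type*}
    {s : Finset ι} {lam c : ι → L} (hlam : ∀ i ∈ s, lam i ∈ torsion F L n)
    (hc : ∀ i ∈ s, IsIntegral F (c i)) :
    B.valuation (1 + ∑ i ∈ s, lam i * c i) ^ (Fintype.card F - 1) ≤
      B.valuation (algebraMap F[X] L X) := by
  have hsum : B.valuation (∑ i ∈ s, lam i * c i) ^ (Fintype.card F - 1) ≤
      B.valuation (algebraMap F[X] L X) := by
    refine map_sum_pow_le _ (Nat.sub_ne_zero_of_lt Fintype.one_lt_card) fun i hi => ?_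
    refine (pow_le_pow_left₀ zero_le ?_ _).trans (valuation_pow_le_of_mem_torsion hθ hn (hlam i hi))
    rw [map_mul]
    exact mul_le_of_le_one_right' (valuation_le_one_of_isIntegral hB (hc i hi))
  rcases le_max_iff.mp (B.valuation.map_add 1 (∑ i ∈ s, lam i * c i)) with h | h
  · exact (pow_le_one₀ zero_le (h.trans_eq (map_one _))).trans hθ.le
  · exact (pow_le_pow_left₀ zero_le h _).trans hsum

end Infinity

section CharacterSum

theorem dvd_add_sub_iff {N a b : ℕ} (ha : 0 < a) (haN : a ≤ N) (hb : 0 < b) (hbN : b ≤ N) :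
    N ∣ b + (N - a) ↔ a = b := by
  constructor
  · intro h
    have := Nat.eq_of_dvd_of_lt_two_mul (by lia) h (by lia)
    lia
  · rintro rfl
    rw [Nat.add_sub_cancel' haN]

variable {E : Type*} [Field E] [Fintype E] [DecidableEq E]

theorem sum_units_inv_pow_mul_pow {a b : ℕ} (ha : 0 < a) (haE : a ≤ Fintype.card E - 1)
    (hb : 0 < b) (hbE : b ≤ Fintype.card E - 1) :
    ∑ z : Eˣ, ((z⁻¹ : Eˣ) : E) ^ a * (z : E) ^ b = if a = b then -1 else 0 := by
  have hz (z : Eˣ) : ((z⁻¹ : Eˣ) : E) ^ a * (z : E) ^ b =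
      (z : E) ^ (b + (Fintype.card E - 1 - a)) := by
    rw [pow_add, mul_comm, pow_sub₀ _ z.ne_zero haE,
      FiniteField.pow_card_sub_one_eq_one _ z.ne_zero, one_mul, Units.val_inv_eq_inv_val, inv_pow]
  simp only [hz]
  rw [FiniteField.sum_pow_units]
  exact if_congr (dvd_add_sub_iff ha haE hb hbE) rfl rfl

theorem sum_units_inv_pow_pow_mul_pow_pow {Q m : ℕ} (hQ : 1 < Q) (hE : Fintype.card E = Q ^ m)
    {i s : ℕ} (hs : s < m) (hi : i < 2 * m) :
    ∑ z : Eˣ, ((z⁻¹ : Eˣ) : E) ^ Q ^ i * (z : E) ^ Q ^ s =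
      if i = s ∨ i = s + m then -1 else 0 := by
  have hpow (z : E) : z ^ Q ^ i = z ^ Q ^ (i % m) :=
    pow_pow_eq_of_modEq (Nat.mod_modEq i m).symm (by rw [← hE, FiniteField.pow_card])
  have hlt {j : ℕ} (hj : j < m) : Q ^ j ≤ Fintype.card E - 1 :=
    Nat.le_sub_one_of_lt (hE ▸ Nat.pow_lt_pow_right hQ hj)
  have hpos (j : ℕ) : 0 < Q ^ j := pow_pos (by lia) j
  simp only [hpow]
  rw [sum_units_inv_pow_mul_pow (hpos _) (hlt (i.mod_lt (by lia))) (hpos s) (hlt hs)]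
  refine if_congr ((Nat.pow_right_injective hQ).eq_iff.trans ?_) rfl rfl
  rcases lt_or_ge i m with him | him
  · rw [Nat.mod_eq_of_lt him]
    lia
  · rw [Nat.mod_eq_sub_mod him, Nat.mod_eq_of_lt (by lia)]
    lia

end CharacterSum

section Congruence

variable {F : Type*} [Field F] [Fintype F]
variable {O : Type*} [CommRing O] [Algebra F O] [Algebra F[X] O] [IsScalarTower F F[X] O]
variable {E : Type*} [Field E] [Fintype E] [DecidableEq E] {m : ℕ}

theorem sum_carlitz_inv_mul_pow (ι : E →+* O) (hE : Fintype.card E = Fintype.card F ^ m)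
    {b : F[X]} (hb : b.natDegree < 2 * m) {s : ℕ} (hs : s < m) :
    ∑ z : Eˣ, carlitz F O b (ι (z⁻¹ : Eˣ)) * ι z ^ Fintype.card F ^ s =
      -algebraMap F[X] O (carlitzCoeff b s) - algebraMap F[X] O (carlitzCoeff b (s + m)) := by
  calc ∑ z : Eˣ, carlitz F O b (ι (z⁻¹ : Eˣ)) * ι z ^ Fintype.card F ^ s
      = ∑ z : Eˣ, ∑ i ∈ Finset.range (2 * m), algebraMap F[X] O (carlitzCoeff b i) *
          ι (((z⁻¹ : Eˣ) : E) ^ Fintype.card F ^ i * (z : E) ^ Fintype.card F ^ s) :=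
        Finset.sum_congr rfl fun z _ => by
          simp only [carlitz_eq_sum _ _ hb, Finset.sum_mul, map_mul, map_pow, mul_assoc]
    _ = ∑ i ∈ Finset.range (2 * m), algebraMap F[X] O (carlitzCoeff b i) *
          ι (∑ z : Eˣ, ((z⁻¹ : Eˣ) : E) ^ Fintype.card F ^ i * (z : E) ^ Fintype.card F ^ s) := by
        rw [Finset.sum_comm]
        simp only [← Finset.mul_sum, ← map_sum]
    _ = ∑ i ∈ Finset.range (2 * m), if i ∈ ({s, s + m} : Finset ℕ) then
          -algebraMap F[X] O (carlitzCoeff b i) else 0 := by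
        refine Finset.sum_congr rfl fun i hi => ?_
        rw [sum_units_inv_pow_pow_mul_pow_pow Fintype.one_lt_card hE hs (Finset.mem_range.mp hi)]
        simp only [Finset.mem_insert, Finset.mem_singleton]
        split_ifs <;> simp
    _ = _ := by
        have hsub : {s, s + m} ⊆ Finset.range (2 * m) := by
          simp only [Finset.insert_subset_iff, Finset.singleton_subset_iff, Finset.mem_range]
          lia
        rw [Finset.sum_ite_mem, Finset.inter_eq_right.mpr hsub, Finset.sum_pair (by lia),
          sub_eq_add_neg]

variable {v : F[X]} {I : Ideal O} {l : ℕ} {c : F[X]} {φ : E → O}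

theorem one_add_sum_sub_mem_pow_succ (ι : E →+* O) (hE : Fintype.card E = Fintype.card F ^ m)
    (hvirr : Irreducible v) (hvI : algebraMap F[X] O v ∈ I)
    (hφ : ∀ z, carlitz F O (v ^ l) (φ z) = φ z) (hφI : ∀ z, φ z - carlitz F O c (ι z) ∈ I)
    (hdeg : (v ^ l * c).natDegree < 2 * m) {s : ℕ} (hs : s < m) :
    (1 + ∑ z : Eˣ, φ (z⁻¹ : Eˣ) * ι z ^ Fintype.card F ^ s) -
      (1 - algebraMap F[X] O (carlitzCoeff (v ^ l * c) s) -
        algebraMap F[X] O (carlitzCoeff (v ^ l * c) (s + m))) ∈ I ^ (l + 1) := by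
  have hcongr (z : E) : φ z - carlitz F O (v ^ l * c) (ι z) ∈ I ^ (l + 1) := by
    rw [carlitz_mul, ← hφ z, ← map_sub]
    exact carlitz_pow_mem_pow_succ hvirr hvI l (hφI z)
  have hsum : (1 + ∑ z : Eˣ, φ (z⁻¹ : Eˣ) * ι z ^ Fintype.card F ^ s) -
      (1 - algebraMap F[X] O (carlitzCoeff (v ^ l * c) s) -
        algebraMap F[X] O (carlitzCoeff (v ^ l * c) (s + m))) =
      ∑ z : Eˣ, (φ (z⁻¹ : Eˣ) - carlitz F O (v ^ l * c) (ι (z⁻¹ : Eˣ))) *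
        ι z ^ Fintype.card F ^ s := by
    simp only [sub_mul, Finset.sum_sub_distrib, sum_carlitz_inv_mul_pow ι hE hdeg hs]
    ring
  rw [hsum]
  exact Ideal.sum_mem _ fun z _ => Ideal.mul_mem_right _ _ (hcongr _)

/-- For `s = deg c` the coefficient of `τ ^ (s + m)` in `C_{v ^ l c}` is its leading coefficient,
and cancels against the `1`. -/
theorem one_add_sum_mem_pow (ι : E →+* O) (hE : Fintype.card E = Fintype.card F ^ m)
    (hv : v.Monic) (hvirr : Irreducible v) (hvI : algebraMap F[X] O v ∈ I)
    (hm : m = v.natDegree * l) (hc : c.Monic) (hφ : ∀ z, carlitz F O (v ^ l) (φ z) = φ z)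
    (hφI : ∀ z, φ z - carlitz F O c (ι z) ∈ I) (hs : c.natDegree < m) :
    1 + ∑ z : Eˣ, φ (z⁻¹ : Eˣ) * ι z ^ Fintype.card F ^ c.natDegree ∈
      I ^ (l - c.natDegree / v.natDegree) := by
  have hmon : (v ^ l * c).Monic := (hv.pow l).mul hc
  have hdeg : (v ^ l * c).natDegree = c.natDegree + m := by
    rw [(hv.pow l).natDegree_mul hc, hv.natDegree_pow, hm, add_comm, mul_comm l]
  have hcongr := one_add_sum_sub_mem_pow_succ ι hE hvirr hvI hφ hφI (by lia) hs
  rw [← hdeg, carlitzCoeff_natDegree, hmon.leadingCoeff, C_1, map_one] at hcongr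
  have hcoeff : algebraMap F[X] O (carlitzCoeff (v ^ l * c) c.natDegree) ∈
      I ^ (l - c.natDegree / v.natDegree) := by
    obtain ⟨u, hu⟩ := pow_dvd_carlitzCoeff_pow_mul hvirr c l c.natDegree
    rw [hu, map_mul, map_pow]
    exact Ideal.mul_mem_right _ _ (Ideal.pow_mem_pow hvI _)
  convert! Ideal.sub_mem _ (Ideal.pow_le_pow_right (by lia) hcongr) hcoeff using 1
  ring

theorem one_add_sum_sub_one_mem (ι : E →+* O) (hE : Fintype.card E = Fintype.card F ^ m)
    (hv : v.Monic) (hvirr : Irreducible v) (hvI : algebraMap F[X] O v ∈ I)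
    (hm : m = v.natDegree * l) (hφ : ∀ z, carlitz F O (v ^ l) (φ z) = φ z)
    (hφI : ∀ z, φ z - carlitz F O c (ι z) ∈ I) {s : ℕ} (hs : s < m) (hcs : c.natDegree < s) :
    (1 + ∑ z : Eˣ, φ (z⁻¹ : Eˣ) * ι z ^ Fintype.card F ^ s) - 1 ∈ I := by
  have hdeg : (v ^ l * c).natDegree ≤ c.natDegree + m := by
    refine natDegree_mul_le.trans ?_
    rw [hv.natDegree_pow, hm, add_comm, mul_comm l]
  have hcongr := Ideal.pow_le_self (by lia)
    (one_add_sum_sub_mem_pow_succ ι hE hvirr hvI hφ hφI (by lia) hs)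
  rw [carlitzCoeff_of_natDegree_lt (i := s + m) (by lia), map_zero, sub_zero] at hcongr
  have hcoeff : algebraMap F[X] O (carlitzCoeff (v ^ l * c) s) ∈ I := by
    have hsl : s / v.natDegree < l := Nat.div_lt_of_lt_mul (by lia)
    obtain ⟨u, hu⟩ := (dvd_pow_self v (by lia)).trans (pow_dvd_carlitzCoeff_pow_mul hvirr c l s)
    rw [hu, map_mul]
    exact I.mul_mem_right _ hvI
  convert! I.sub_mem hcongr hcoeff using 1
  ring

end Congruence

section Multiplicity

theorem card_le_of_forall_eq_mul_pow {F : Type*} [Field F] {v b : F[X]} (hv : v.Monic)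
    (hb : b.Monic) {N e : ℕ} (he : N ≤ v.natDegree * e + b.natDegree) {T : Finset F[X]}
    (hTN : ∀ a ∈ T, a.natDegree < N) (hT : ∀ a ∈ T, ∃ i, a = b * v ^ i) : T.card ≤ e := by
  classical
  have hsub : T ⊆ (Finset.range e).image fun i => b * v ^ i := by
    intro a ha
    obtain ⟨i, hi⟩ := hT a ha
    refine Finset.mem_image.mpr ⟨i, Finset.mem_range.mpr ?_, hi.symm⟩
    have hlt := hTN a ha
    rw [hi, hb.natDegree_mul (hv.pow i), hv.natDegree_pow, mul_comm i] at hlt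
    exact lt_of_mul_lt_mul_left (a := v.natDegree) (by lia) (Nat.zero_le _)
  simpa using (Finset.card_le_card hsub).trans Finset.card_image_le

theorem prod_dvd_of_forall_pow_card_dvd {O α : Type*} [CommRing O] [DecidableEq (Ideal O)]
    {S : Finset α} {J : α → Ideal O} (hJ : ∀ a ∈ S, (J a).IsMaximal) {K : Ideal O}
    (h : ∀ a ∈ S, J a ^ {b ∈ S | J b = J a}.card ∣ K) : ∏ a ∈ S, J a ∣ K := by
  rw [Finset.prod_comp (fun J : Ideal O => J) J]
  refine Finset.prod_dvd_of_coprime (fun P hP P' hP' hne => ?_) fun P hP => ?_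
  · obtain ⟨a, ha, rfl⟩ := Finset.mem_image.mp hP
    obtain ⟨b, hb, rfl⟩ := Finset.mem_image.mp hP'
    have := hJ a ha
    have := hJ b hb
    exact (Ideal.isCoprime_of_isMaximal hne).pow
  · obtain ⟨a, ha, rfl⟩ := Finset.mem_image.mp hP
    exact h a ha

theorem exists_pow_pow_eq {E : Type*} [Field E] [Fintype E] {Q m : ℕ} (hm : 0 < m)
    (hE : Fintype.card E = Q ^ m) (r : ℕ) (c : E) : ∃ b : E, b ^ Q ^ r = c := by
  refine ⟨c ^ Q ^ (m * r - r), ?_⟩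
  rw [← pow_mul, ← pow_add, Nat.sub_add_cancel (Nat.le_mul_of_pos_left _ hm), pow_mul, ← hE,
    FiniteField.pow_card_pow]

variable {O : Type*} [CommRing O] {G : Type*} [Group G] [MulSemiringAction G O]

theorem isMaximal_smul (g : G) (I : Ideal O) [I.IsMaximal] : (g • I).IsMaximal := by
  rw [Ideal.pointwise_smul_eq_comap]
  exact Ideal.comap_isMaximal_of_equiv _

variable {F : Type*} [Field F] [Fintype F] {E : Type*} [Field E] [Fintype E]

theorem smul_sub_smul_pow_mem [Algebra F O] {ι : E →+* O} {m : ℕ} (hm : 0 < m)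
    (hE : Fintype.card E = Fintype.card F ^ m) {I : Ideal O} (hIE : ∀ x, ∃ c, x - ι c ∈ I)
    {r t : ℕ} {σ τ : G} (hσ : ∀ c, σ • ι c = ι c ^ Fintype.card F ^ (r + t))
    (hτ : ∀ c, τ • ι c = ι c ^ Fintype.card F ^ r) (hστ : σ⁻¹ • I = τ⁻¹ • I) (x : O) :
    σ • x - (τ • x) ^ Fintype.card F ^ t ∈ I := by
  obtain ⟨c, hc⟩ := hIE (τ • x)
  obtain ⟨b, rfl⟩ := exists_pow_pow_eq hm hE r c
  have hτx : τ • (x - ι b) ∈ I := by rwa [smul_sub, hτ, ← map_pow]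
  have hσx : σ • (x - ι b) ∈ I := by
    rwa [← Ideal.mem_inv_pointwise_smul_iff, hστ, Ideal.mem_inv_pointwise_smul_iff]
  rw [smul_sub, hσ, pow_add, pow_mul, ← map_pow] at hσx
  have hpow := I.pow_mem_of_mem hc (Fintype.card F ^ t) (pow_pos Fintype.card_pos _)
  rw [sub_pow_card_pow] at hpow
  simpa using I.sub_mem hσx hpow

variable [Algebra F O] [Algebra F[X] O] [IsScalarTower F F[X] O]

theorem dvd_sub_mul_pow_of_smul_sub_smul_pow_mem [IsDomain O] {v n : F[X]} (hv : v.Monic)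
    (hvirr : Irreducible v) (hn : n ≠ 0)
    (hcard : (torsion F O n).ncard = Fintype.card F ^ n.natDegree) {I : Ideal O}
    (hvI : algebraMap F[X] O v ∈ I) (hnI : algebraMap F[X] O n ∉ I) {a b : F[X]} {σ τ : G}
    (hσ : ∀ z ∈ torsion F O n, σ • z = carlitz F O a z)
    (hτ : ∀ z ∈ torsion F O n, τ • z = carlitz F O b z) {i : ℕ}
    (h : ∀ x : O, σ • x - (τ • x) ^ Fintype.card F ^ (v.natDegree * i) ∈ I) :
    n ∣ a - b * v ^ i := by
  refine dvd_of_forall_carlitz_eq_zero hn hcard fun z hz => ?_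
  rw [carlitz_sub]
  refine eq_zero_of_mem_torsion_of_mem_ideal hnI
    (sub_mem_torsion (carlitz_mem_torsion a hz) (carlitz_mem_torsion (b * v ^ i) hz)) ?_
  rw [mul_comm, carlitz_mul, ← hσ z hz, ← hτ z hz]
  simpa using I.sub_mem (h z) (carlitz_pow_sub_pow_mem hv hvirr hvI i (τ • z))

variable [SMulCommClass G F[X] O]

theorem eq_mul_pow_of_inv_smul_eq [IsDomain O] (ι : E →+* O) {m : ℕ} (hm : 0 < m)
    (hE : Fintype.card E = Fintype.card F ^ m) {v n : F[X]} (hv : v.Monic) (hvirr : Irreducible v)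
    (hvn : IsCoprime v n) (hcard : (torsion F O n).ncard = Fintype.card F ^ n.natDegree)
    {I : Ideal O} (hI : ∀ f : F[X], algebraMap F[X] O f ∈ I ↔ v ∣ f)
    (hIE : ∀ x, ∃ c, x - ι c ∈ I) {a b : F[X]} (ha : a.Monic) (hb : b.Monic)
    (hadeg : a.degree < n.degree) (hab : b.natDegree ≤ a.natDegree) {σ τ : G}
    (hσ : ∀ z ∈ torsion F O n, σ • z = carlitz F O a z)
    (hσE : ∀ c, σ • ι c = ι c ^ Fintype.card F ^ a.natDegree)
    (hτ : ∀ z ∈ torsion F O n, τ • z = carlitz F O b z)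
    (hτE : ∀ c, τ • ι c = ι c ^ Fintype.card F ^ b.natDegree)
    (hστ : σ⁻¹ • I = τ⁻¹ • I) : ∃ i, a = b * v ^ i := by
  obtain ⟨t, ht⟩ := Nat.exists_eq_add_of_le hab
  have hfrob (x : O) : σ • x - (τ • x) ^ Fintype.card F ^ t ∈ I :=
    smul_sub_smul_pow_mem hm hE hIE (ht ▸ hσE) hτE hστ x
  obtain ⟨i, rfl⟩ : v.natDegree ∣ t := by
    refine hvirr.natDegree_dvd_of_dvd_X_pow_card_pow_sub_X ((hI _).mp ?_)
    have hX := hfrob (algebraMap F[X] O X)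
    rw [smul_algebraMap, smul_algebraMap, ← neg_mem_iff, neg_sub] at hX
    rwa [Nat.card_eq_fintype_card, map_sub, map_pow]
  refine ⟨i, sub_eq_zero.mp (eq_zero_of_dvd_of_degree_lt ?_ (?_ : _ < n.degree))⟩
  · exact dvd_sub_mul_pow_of_smul_sub_smul_pow_mem hv hvirr (ne_zero_of_degree_gt hadeg) hcard
      ((hI v).mpr dvd_rfl)
      (fun h => hvirr.not_isUnit (hvn.isUnit_of_dvd' dvd_rfl ((hI n).mp h))) hσ hτ hfrob
  · refine (degree_sub_le _ _).trans_lt (max_lt hadeg ?_)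
    rwa [degree_eq_natDegree (hb.mul (hv.pow i)).ne_zero, hb.natDegree_mul (hv.pow i),
      hv.natDegree_pow, mul_comm i, ← ht, ← degree_eq_natDegree ha.ne_zero]

/-- The `a ∈ S` with the same `σ_a⁻¹(I)` are of the form `b v ^ i`, with `b` of least degree, so
that the multiplicity is bounded by the exponent for `b`. -/
theorem prod_inv_smul_dvd_span [IsDedekindDomain O] (ι : E →+* O) {m : ℕ} (hm : 0 < m)
    (hE : Fintype.card E = Fintype.card F ^ m) {v n : F[X]} (hv : v.Monic) (hvirr : Irreducible v)
    (hvn : IsCoprime v n) (hcard : (torsion F O n).ncard = Fintype.card F ^ n.natDegree)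
    {I : Ideal O} [I.IsMaximal] (hI : ∀ f : F[X], algebraMap F[X] O f ∈ I ↔ v ∣ f)
    (hIE : ∀ x, ∃ c, x - ι c ∈ I) {S : Finset F[X]} (hS : ∀ a ∈ S, a.Monic ∧ a.degree < n.degree)
    {σ : F[X] → G} (hσ : ∀ a ∈ S, ∀ z ∈ torsion F O n, σ a • z = carlitz F O a z)
    (hσE : ∀ a ∈ S, ∀ c, σ a • ι c = ι c ^ Fintype.card F ^ a.natDegree) {x : O}
    (hx : ∀ a ∈ S, ∃ e, n.natDegree ≤ v.natDegree * e + a.natDegree ∧ σ a • x ∈ I ^ e) :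
    ∏ a ∈ S, (σ a)⁻¹ • I ∣ Ideal.span {x} := by
  classical
  refine prod_dvd_of_forall_pow_card_dvd (fun a _ => isMaximal_smul _ I) fun a ha => ?_
  set T := S.filter fun b => (σ b)⁻¹ • I = (σ a)⁻¹ • I
  obtain ⟨b, hbT, hbmin⟩ := T.exists_min_image natDegree ⟨a, Finset.mem_filter.mpr ⟨ha, rfl⟩⟩
  obtain ⟨hbS, hbI⟩ := Finset.mem_filter.mp hbT
  obtain ⟨e, he, hxe⟩ := hx b hbS
  have hTe : T.card ≤ e := by
    refine card_le_of_forall_eq_mul_pow hv (hS b hbS).1 he (fun c hc => ?_) fun c hc => ?_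
    · have hcS := (Finset.mem_filter.mp hc).1
      exact natDegree_lt_natDegree (hS c hcS).1.ne_zero (hS c hcS).2
    · obtain ⟨hcS, hcI⟩ := Finset.mem_filter.mp hc
      exact eq_mul_pow_of_inv_smul_eq ι hm hE hv hvirr hvn hcard hI hIE (hS c hcS).1 (hS b hbS).1
        (hS c hcS).2 (hbmin c hc) (hσ c hcS) (hσE c hcS) (hσ b hbS) (hσE b hbS)
        (hcI.trans hbI.symm)
  refine (pow_dvd_pow _ hTe).trans ?_
  rwa [← hbI, ← smul_pow', Ideal.dvd_span_singleton, Ideal.mem_inv_pointwise_smul_iff]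

end Multiplicity

section ConstantExtension

variable {F : Type*} [Field F] {E : Type*} [Field E] [Algebra F E]
variable {A O : Type*} [CommRing A] [Algebra F A] [CommRing O]

theorem sum_units_inv_mul_sum_pow [Fintype F] [Fintype E] [DecidableEq E] (ι : E →+* O)
    (f : ℕ → O) :
    ∑ z : Eˣ, ι (z⁻¹ : Eˣ) * ∑ s ∈ Finset.range (Module.finrank F E),
      ι z ^ Fintype.card F ^ s * f s = -f 0 := by
  have hm : 0 < Module.finrank F E := Module.finrank_pos
  have horth {s : ℕ} (hs : s < Module.finrank F E) :
      ∑ z : Eˣ, ((z⁻¹ : Eˣ) : E) * (z : E) ^ Fintype.card F ^ s = if s = 0 then -1 else 0 := by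
    have h := sum_units_inv_pow_pow_mul_pow_pow (i := 0) Fintype.one_lt_card
      (Module.card_eq_pow_finrank (K := F) (V := E)) hs (by lia)
    simp only [pow_zero, pow_one] at h
    rw [h]
    exact if_congr (by lia) rfl rfl
  simp only [Finset.mul_sum]
  rw [Finset.sum_comm]
  simp only [← mul_assoc, ← map_pow, ← map_mul, ← Finset.sum_mul, ← map_sum]
  rw [Finset.sum_eq_single_of_mem 0 (Finset.mem_range.mpr hm) fun s hs hs0 => by
    rw [horth (Finset.mem_range.mp hs), if_neg hs0, map_zero, zero_mul]]
  rw [horth hm, if_pos rfl, map_neg, map_one, neg_one_mul]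

theorem algebraMap_trace_eq_sum_pow [Fintype F] [Finite E] (x : E) :
    algebraMap F E (Algebra.trace F E x) =
      ∑ s ∈ Finset.range (Module.finrank F E), x ^ Fintype.card F ^ s := by
  rw [FiniteField.algebraMap_trace_eq_sum_pow, Nat.card_eq_fintype_card]

variable (F E A) in
/-- The `A`-valued trace pairing `t ↦ Tr(z t)` of `E ⊗ A` with an element `z` of `E`, so that
`ε ⊗ α ↦ Tr(z ε) α`. -/
def traceTensor (z : E) : E ⊗[F] A →ₗ[F] A :=
  TensorProduct.lid F A ∘ₗ (Algebra.traceForm F E z).rTensor A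

theorem traceTensor_tmul (z ε : E) (α : A) :
    traceTensor F E A z (ε ⊗ₜ α) = Algebra.trace F E (z * ε) • α := by
  simp [traceTensor]

theorem eq_neg_sum_inv_tmul_traceTensor [Finite F] [Fintype E] [DecidableEq E] (t : E ⊗[F] A) :
    t = -∑ z : Eˣ, ((z⁻¹ : Eˣ) : E) ⊗ₜ[F] traceTensor F E A z t := by
  have := Fintype.ofFinite F
  induction t with
  | zero => simp
  | add x y hx hy =>
    simp only [map_add, TensorProduct.tmul_add, Finset.sum_add_distrib, neg_add]
    rw [← hx, ← hy]
  | tmul ε α =>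
    have hdual : ∑ z : Eˣ, Algebra.trace F E (z * ε) • ((z⁻¹ : Eˣ) : E) = -ε := by
      have h := sum_units_inv_mul_sum_pow (F := F) (RingHom.id E) fun s => ε ^ Fintype.card F ^ s
      simp only [RingHom.id_apply, pow_zero, pow_one, ← mul_pow] at h
      simpa only [Algebra.smul_def, algebraMap_trace_eq_sum_pow, mul_comm] using h
    simp only [traceTensor_tmul, ← TensorProduct.smul_tmul]
    rw [← TensorProduct.sum_tmul, hdual, TensorProduct.neg_tmul, neg_neg]

variable [Fintype F] [Algebra F O]

section

variable {i : A →ₐ[F] O} {ι : E →ₐ[F] O} {τ : O →+* O}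

theorem iterate_const (hι : ∀ c, τ (ι c) = ι c ^ Fintype.card F) (s : ℕ) (c : E) :
    τ^[s] (ι c) = ι c ^ Fintype.card F ^ s := by
  induction s with
  | zero => simp
  | succ s ih => rw [Function.iterate_succ_apply', ih, map_pow, hι, ← pow_mul, ← pow_succ']

theorem map_sum_range_iterate {m : ℕ} {y : O} (hτ : τ^[m] y = y) :
    τ (∑ s ∈ Finset.range m, τ^[s] y) = ∑ s ∈ Finset.range m, τ^[s] y := by
  have h := Finset.sum_range_succ (fun s => τ^[s] y) m
  rw [Finset.sum_range_succ', hτ, Function.iterate_zero, id_eq] at h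
  simp only [map_sum, ← Function.iterate_succ_apply', add_right_cancel h]

theorem map_traceTensor [Finite E] (hi : ∀ x, τ (i x) = i x)
    (hι : ∀ c, τ (ι c) = ι c ^ Fintype.card F)
    (z : E) (t : E ⊗[F] A) :
    i (traceTensor F E A z t) = ∑ s ∈ Finset.range (Module.finrank F E),
      τ^[s] (ι z * Algebra.TensorProduct.productMap ι i t) := by
  induction t with
  | zero => simp [iterate_map_zero]
  | add x y hx hy => simp only [map_add, mul_add, iterate_map_add, Finset.sum_add_distrib, hx, hy]
  | tmul ε α =>
    simp only [Algebra.TensorProduct.productMap_apply_tmul, ← mul_assoc, ← map_mul,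
      iterate_map_mul, iterate_const hι, Function.iterate_fixed (hi α), ← Finset.sum_mul]
    rw [traceTensor_tmul, map_smul, Algebra.smul_def, ← ι.commutes, algebraMap_trace_eq_sum_pow,
      map_sum]
    simp only [map_pow]

theorem eq_neg_sum_inv_mul_sum_iterate [Fintype E] [DecidableEq E]
    (hι : ∀ c, τ (ι c) = ι c ^ Fintype.card F) (y : O) :
    y = -∑ z : Eˣ, ι (z⁻¹ : Eˣ) * ∑ s ∈ Finset.range (Module.finrank F E), τ^[s] (ι z * y) := by
  have h := sum_units_inv_mul_sum_pow (F := F) (ι : E →+* O) fun s => τ^[s] y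
  simp only [RingHom.coe_coe, Function.iterate_zero, id_eq] at h
  simp only [iterate_map_mul, iterate_const hι, h, neg_neg]

end

/-- Galois descent: an element of `E ⊗ A`, respectively of `O`, is recovered from its traces to
`A` against the elements of `E`. -/
theorem productMap_bijective [Finite E] {i : A →ₐ[F] O} {ι : E →ₐ[F] O} {τ : O →+* O}
    (hinj : Function.Injective i) (hi : ∀ x, τ (i x) = i x)
    (hι : ∀ c, τ (ι c) = ι c ^ Fintype.card F) (hτ : ∀ y, τ^[Module.finrank F E] y = y)
    (hfix : ∀ y, τ y = y → ∃ x, i x = y) :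
    Function.Bijective (Algebra.TensorProduct.productMap ι i) := by
  classical
  have := Fintype.ofFinite E
  constructor
  · rw [injective_iff_map_eq_zero]
    intro t ht
    have htrace (z : E) : traceTensor F E A z t = 0 := by
      apply hinj
      rw [map_traceTensor hi hι, ht, mul_zero, map_zero]
      simp only [iterate_map_zero, Finset.sum_const_zero]
    rw [eq_neg_sum_inv_tmul_traceTensor t]
    simp only [htrace, TensorProduct.tmul_zero, Finset.sum_const_zero, neg_zero]
  · intro y
    choose T hT using fun z : E => hfix _ (map_sum_range_iterate (hτ (ι z * y)))
    refine ⟨-∑ z : Eˣ, ((z⁻¹ : Eˣ) : E) ⊗ₜ[F] T z, ?_⟩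
    simp only [map_neg, map_sum, Algebra.TensorProduct.productMap_apply_tmul, hT]
    exact (eq_neg_sum_inv_mul_sum_iterate hι y).symm

end ConstantExtension

section Sigma

variable {F : Type*} [Field F] [Fintype F] {n : F[X]} {m : ℕ}

theorem sigma_mul (hn : n.Monic) (hm : 0 < m) {a b : F[X]} (ha : IsCoprime a n)
    (hb : IsCoprime b n) (s t : ℕ) :
    sigma n m a s * sigma n m b t = sigma n m (a * b) (s + t) := by
  obtain ⟨ha_tor, ha_const⟩ := sigma_spec hn hm ha s
  obtain ⟨hb_tor, hb_const⟩ := sigma_spec hn hm hb t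
  obtain ⟨hab_tor, hab_const⟩ := sigma_spec hn hm (ha.mul_left hb) (s + t)
  refine compField_algEquiv_ext (fun z hz => ?_) (fun c hc => ?_)
  · rw [AlgEquiv.mul_apply, hb_tor z hz, ha_tor _ (carlitz_mem_torsion b hz), hab_tor z hz,
      carlitz_mul]
  · rw [AlgEquiv.mul_apply, hb_const c hc, map_pow, ha_const c hc, hab_const c hc, pow_add,
      pow_mul]

theorem sigma_congr (hn : n.Monic) (hm : 0 < m) {a b : F[X]} (ha : IsCoprime a n)
    (hb : IsCoprime b n) (hab : n ∣ a - b) {s t : ℕ} (hst : s ≡ t [MOD m]) :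
    sigma n m a s = sigma n m b t := by
  obtain ⟨ha_tor, ha_const⟩ := sigma_spec hn hm ha s
  obtain ⟨hb_tor, hb_const⟩ := sigma_spec hn hm hb t
  refine compField_algEquiv_ext (fun z hz => ?_) (fun c hc => ?_)
  · rw [ha_tor z hz, hb_tor z hz, carlitz_eq_of_dvd_sub hab hz]
  · rw [ha_const c hc, hb_const c hc,
      pow_pow_eq_of_modEq hst (pow_card_pow_of_coe_mem_constField hm hc)]

theorem sigma_one_zero (hn : n.Monic) (hm : 0 < m) : sigma n m 1 0 = 1 := by
  obtain ⟨htor, hconst⟩ := sigma_spec hn hm isCoprime_one_left 0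
  refine compField_algEquiv_ext (fun z hz => ?_) (fun c hc => ?_)
  · rw [htor z hz, carlitz_one, AlgEquiv.one_apply]
  · rw [hconst c hc, pow_zero, pow_one, AlgEquiv.one_apply]

theorem sigma_one_one_pow (hn : n.Monic) (hm : 0 < m) (s : ℕ) :
    sigma n m 1 1 ^ s = sigma n m 1 s := by
  induction s with
  | zero => rw [pow_zero, sigma_one_zero hn hm]
  | succ s ih =>
    rw [pow_succ, ih, sigma_mul hn hm isCoprime_one_left isCoprime_one_left, mul_one]

theorem sigma_one_one_pow_eq_one (hn : n.Monic) (hm : 0 < m) : sigma n m 1 1 ^ m = 1 := by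
  rw [sigma_one_one_pow hn hm, ← sigma_one_zero hn hm]
  exact sigma_congr hn hm isCoprime_one_left isCoprime_one_left (by simp) (by simp [Nat.ModEq])

theorem sigma_smul_of_mem_torsion (hn : n.Monic) (hm : 0 < m) {a : F[X]} (ha : IsCoprime a n)
    (s : ℕ) {z : integers (compField F n m)} (hz : z ∈ torsion F (integers (compField F n m)) n) :
    sigma n m a s • z = carlitz F (integers (compField F n m)) a z := by
  apply Subtype.ext
  rw [integralClosure.coe_smul]
  exact ((sigma_spec hn hm ha s).1 _ (coe_mem_torsion_integers_iff.mpr hz)).trans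
    (carlitz_map (integers (compField F n m)).val a z).symm

theorem coe_constIncl (n : F[X]) (m : ℕ) (c : constField F m) :
    ((constIncl n m c : compField F n m) : kbar F) = c := by
  unfold constIncl
  rw [AlgHom.coe_mk]
  rfl

theorem sigma_smul_constIncl (hn : n.Monic) (hm : 0 < m) {a : F[X]} (ha : IsCoprime a n) (s : ℕ)
    (c : constField F m) :
    sigma n m a s • constIncl n m c = constIncl n m c ^ Fintype.card F ^ s := by
  apply Subtype.ext
  rw [integralClosure.coe_smul, SubmonoidClass.coe_pow]
  exact (sigma_spec hn hm ha s).2 _ (by rw [coe_constIncl]; exact c.2)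

theorem cycField_algHom_ext {L : Type*} [Field L] [Algebra (RatFunc F) L]
    {σ τ : cycField F n →ₐ[RatFunc F] L}
    (h : ∀ z : cycField F n, z ∈ torsion F (cycField F n) n → σ z = τ z) : σ = τ :=
  IntermediateField.algHom_ext_of_eq_adjoin (S := cycField F n) _ rfl fun _ hx =>
    h _ (coe_mem_torsion_iff.mp hx)

theorem rho_one (hn : n.Monic) : rho n (1 : F[X]) = 1 := by
  refine AlgEquiv.coe_toAlgHom_injective (cycField_algHom_ext fun z hz => ?_)
  exact (rho_spec hn isCoprime_one_left hz).trans (carlitz_one z)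

theorem sigma_inclusion (hn : n.Monic) (hm : 0 < m) {a : F[X]} (ha : IsCoprime a n) (s : ℕ)
    (x : cycField F n) :
    sigma n m a s (IntermediateField.inclusion (cycField_le_compField n m) x) =
      IntermediateField.inclusion (cycField_le_compField n m) (rho n a x) := by
  set i := IntermediateField.inclusion (cycField_le_compField (F := F) n m)
  suffices h : (sigma n m a s : compField F n m →ₐ[RatFunc F] compField F n m).comp i =
      i.comp (rho n a : cycField F n →ₐ[RatFunc F] cycField F n) from DFunLike.congr_fun h x
  refine cycField_algHom_ext fun z hz => ?_
  have hiz : i z ∈ torsion F (compField F n m) n := map_mem_torsion (i.restrictScalars F[X]) hz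
  calc sigma n m a s (i z) = carlitz F (compField F n m) a (i z) :=
        (sigma_spec hn hm ha s).1 _ hiz
    _ = i (carlitz F (cycField F n) a z) := (carlitz_map (i.restrictScalars F[X]) a z).symm
    _ = i (rho n a z) := congrArg i (rho_spec hn ha hz).symm

theorem sigma_smul_integersIncl (hn : n.Monic) (hm : 0 < m) {a : F[X]} (ha : IsCoprime a n)
    (s : ℕ) (x : integers (cycField F n)) :
    sigma n m a s • integersIncl n m x = integersIncl n m (rho n a • x) :=
  Subtype.ext (sigma_inclusion hn hm ha s x)

theorem sigma_one_one_smul_integersIncl (hn : n.Monic) (hm : 0 < m)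
    (x : integers (cycField F n)) :
    sigma n m 1 1 • integersIncl n m x = integersIncl n m x := by
  rw [sigma_smul_integersIncl hn hm isCoprime_one_left, rho_one hn, one_smul]

theorem sigma_one_one_smul_constIncl (hn : n.Monic) (hm : 0 < m) (c : constField F m) :
    sigma n m 1 1 • constIncl n m c = constIncl n m c ^ Fintype.card F := by
  rw [sigma_smul_constIncl hn hm isCoprime_one_left, pow_one]

theorem integersIncl_injective (n : F[X]) (m : ℕ) :
    Function.Injective (integersIncl (F := F) n m) := fun _ _ h =>
  Subtype.ext ((IntermediateField.inclusion (cycField_le_compField n m)).injective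
    (congrArg Subtype.val h))

theorem exists_eq_sigma_one_one_pow (hn : n.Monic) (hm : 0 < m)
    {σ : Gal(compField F n m/RatFunc F)}
    (hσ : σ ∈ (IntermediateField.inclusion
      (cycField_le_compField n m)).fieldRange.fixingSubgroup) :
    ∃ s, σ = sigma n m 1 1 ^ s := by
  obtain ⟨s, -, hs⟩ := exists_const_eq_pow_card_pow hm
    (fun c hc => mem_compField_of_mem_constField n m hc) σ
  obtain ⟨htor, hconst⟩ := sigma_spec hn hm isCoprime_one_left s
  rw [IntermediateField.mem_fixingSubgroup_iff] at hσ
  refine ⟨s, ?_⟩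
  rw [sigma_one_one_pow hn hm]
  refine compField_algEquiv_ext (fun z hz => ?_) fun c hc => by rw [hs c hc, hconst c hc]
  rw [htor z hz, carlitz_one]
  exact hσ z ⟨⟨z, torsion_subset_cycField n (coe_mem_torsion_iff.mpr hz)⟩, rfl⟩

theorem exists_inclusion_eq (hn : n.Monic) (hm : 0 < m) {y : compField F n m}
    (hy : sigma n m 1 1 y = y) :
    ∃ x, IntermediateField.inclusion (cycField_le_compField n m) x = y := by
  obtain ⟨_, _⟩ := isGalois_compField hn.ne_zero hm
  suffices h : y ∈ (IntermediateField.inclusion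
    (cycField_le_compField (F := F) n m)).fieldRange from h
  rw [← IsGalois.fixedField_fixingSubgroup
    (IntermediateField.inclusion (cycField_le_compField n m)).fieldRange,
    IntermediateField.mem_fixedField_iff]
  intro σ hσ
  obtain ⟨s, rfl⟩ := exists_eq_sigma_one_one_pow hn hm hσ
  have hstab : sigma n m 1 1 ∈ MulAction.stabilizer Gal(compField F n m/RatFunc F) y := hy
  exact pow_mem hstab s

theorem exists_integersIncl_eq (hn : n.Monic) (hm : 0 < m) {y : integers (compField F n m)}
    (hy : sigma n m 1 1 • y = y) : ∃ x, integersIncl n m x = y := by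
  obtain ⟨x, hx⟩ := exists_inclusion_eq hn hm (congrArg Subtype.val hy)
  have hxint : IsIntegral F[X] x := by
    refine (isIntegral_algHom_iff
      ((IntermediateField.inclusion (cycField_le_compField n m)).restrictScalars F[X])
      (IntermediateField.inclusion (cycField_le_compField n m)).injective).mp ?_
    rw [AlgHom.restrictScalars_apply, hx]
    exact y.2
  exact ⟨⟨x, hxint⟩, Subtype.ext hx⟩

theorem finrank_constField (hm : 0 < m) : Module.finrank F (constField F m) = m := by
  have := finite_constField (F := F) hm
  have hcard := Module.natCard_eq_pow_finrank (K := F) (V := constField F m)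
  rw [natCard_constField hm, Nat.card_eq_fintype_card] at hcard
  exact (Nat.pow_right_injective Fintype.one_lt_card hcard).symm

theorem tensorIntegers_bijective (hn : n.Monic) (hm : 0 < m) :
    Function.Bijective (tensorIntegers n m) := by
  have := finite_constField (F := F) hm
  refine productMap_bijective (τ := MulSemiringAction.toRingHom _ _ (sigma n m 1 1))
    (integersIncl_injective n m) (sigma_one_one_smul_integersIncl hn hm)
    (sigma_one_one_smul_constIncl hn hm) (fun y => ?_) fun y hy => exists_integersIncl_eq hn hm hy
  rw [finrank_constField hm]
  exact (smul_iterate_apply _ _ _).trans (by rw [sigma_one_one_pow_eq_one hn hm, one_smul])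

/-- The canonical isomorphism `ε ⊗ α ↦ ε α` from `F_{q ^ m} ⊗ O_n` to `O_{n,m}`. -/
def tensorIntegersEquiv (hn : n.Monic) (hm : 0 < m) :
    constField F m ⊗[F] integers (cycField F n) ≃ₐ[F] integers (compField F n m) :=
  AlgEquiv.ofBijective (tensorIntegers n m) (tensorIntegers_bijective hn hm)

/-- The residue map of the prime `primeAbove P ψ` of `O_{n,m}`: the homomorphism that restricts to
the identity on the constants and to `x ↦ ψ(x mod P)` on `O_n`. -/
def compResidue (hn : n.Monic) (hm : 0 < m) {P : Ideal (integers (cycField F n))}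
    (ψ : (integers (cycField F n) ⧸ P) ≃ₐ[F] constField F m) :
    integers (compField F n m) →ₐ[F] constField F m :=
  (tensorResidue P ψ).comp (tensorIntegersEquiv hn hm).symm.toAlgHom

variable {P : Ideal (integers (cycField F n))}

theorem compResidue_tensorIntegers (hn : n.Monic) (hm : 0 < m)
    (ψ : (integers (cycField F n) ⧸ P) ≃ₐ[F] constField F m)
    (t : constField F m ⊗[F] integers (cycField F n)) :
    compResidue hn hm ψ (tensorIntegers n m t) = tensorResidue P ψ t :=
  congrArg (tensorResidue P ψ) ((tensorIntegersEquiv hn hm).symm_apply_apply t)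

theorem compResidue_constIncl (hn : n.Monic) (hm : 0 < m)
    (ψ : (integers (cycField F n) ⧸ P) ≃ₐ[F] constField F m) (c : constField F m) :
    compResidue hn hm ψ (constIncl n m c) = c := by
  have h := compResidue_tensorIntegers hn hm ψ (c ⊗ₜ 1)
  rwa [tensorIntegers, Algebra.TensorProduct.productMap_left_apply, tensorResidue,
    Algebra.TensorProduct.productMap_left_apply, AlgHom.id_apply] at h

theorem compResidue_integersIncl (hn : n.Monic) (hm : 0 < m)
    (ψ : (integers (cycField F n) ⧸ P) ≃ₐ[F] constField F m) (x : integers (cycField F n)) :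
    compResidue hn hm ψ (integersIncl n m x) = ψ (Ideal.Quotient.mk P x) := by
  have h := compResidue_tensorIntegers hn hm ψ (1 ⊗ₜ x)
  rwa [tensorIntegers, Algebra.TensorProduct.productMap_right_apply, tensorResidue,
    Algebra.TensorProduct.productMap_right_apply] at h

theorem mem_primeAbove_iff (hn : n.Monic) (hm : 0 < m)
    {ψ : (integers (cycField F n) ⧸ P) ≃ₐ[F] constField F m} {y : integers (compField F n m)} :
    y ∈ primeAbove P ψ ↔ compResidue hn hm ψ y = 0 := by
  rw [primeAbove, Ideal.mem_map_iff_of_surjective _ (tensorIntegers_bijective hn hm).2]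
  constructor
  · rintro ⟨t, ht, rfl⟩
    rwa [compResidue_tensorIntegers]
  · intro hy
    obtain ⟨t, rfl⟩ := (tensorIntegers_bijective hn hm).2 y
    exact ⟨t, by rwa [compResidue_tensorIntegers] at hy, rfl⟩

end Sigma

section Teichmuller

variable {F : Type*} [Field F] [Fintype F]
variable {R : Type*} [CommRing R] [Algebra F R] [Algebra F[X] R]
variable {I : Ideal R} {n : F[X]}

theorem carlitz_mem_torsion_of_forall {c : F[X]} (hc : ∀ y : R, carlitz F R (n * c) y = 0)
    (y : R) : carlitz F R c y ∈ torsion F R n := by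
  rw [mem_torsion, ← carlitz_mul, hc]

variable (I n) in
/-- The inverse of the reduction modulo `I` on the `n`-torsion of the Carlitz module. -/
def torsionLift : R ⧸ I → R :=
  Function.invFunOn (Ideal.Quotient.mk I) (torsion F R n)

variable [IsScalarTower F F[X] R]

theorem mk_carlitz (a : F[X]) (x : R) :
    Ideal.Quotient.mk I (carlitz F R a x) = carlitz F (R ⧸ I) a (Ideal.Quotient.mk I x) :=
  carlitz_map (Ideal.Quotient.mkₐ F[X] I) a x

theorem carlitz_pow_sub_one_eq_zero {v : F[X]} (hv : v.Monic) (hvirr : Irreducible v)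
    (hvR : algebraMap F[X] R v = 0) {l : ℕ}
    (hR : ∀ y : R, y ^ Fintype.card F ^ (v.natDegree * l) = y) (y : R) :
    carlitz F R (v ^ l - 1) y = 0 := by
  have h := carlitz_pow_sub_pow_mem (I := ⊥) hv hvirr (Ideal.mem_bot.mpr hvR) l y
  rw [hR, Ideal.mem_bot] at h
  rw [carlitz_sub, carlitz_one, h]

variable [IsDomain R]

theorem injOn_mk_torsion (hnI : algebraMap F[X] R n ∉ I) :
    Set.InjOn (Ideal.Quotient.mk I) (torsion F R n) := fun _ hx _ hy h =>
  sub_eq_zero.mp <|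
    eq_zero_of_mem_torsion_of_mem_ideal hnI (sub_mem_torsion hx hy) (Ideal.Quotient.eq.mp h)

theorem dvd_of_forall_carlitz_quotient_eq_zero (hn : n ≠ 0)
    (hcard : (torsion F R n).ncard = Fintype.card F ^ n.natDegree) {a : F[X]}
    (hnI : algebraMap F[X] R n ∉ I) (ha : ∀ y : R ⧸ I, carlitz F (R ⧸ I) a y = 0) : n ∣ a := by
  refine dvd_of_forall_carlitz_eq_zero hn hcard fun z hz => ?_
  refine eq_zero_of_mem_torsion_of_mem_ideal hnI (carlitz_mem_torsion a hz) ?_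
  rw [← Ideal.Quotient.eq_zero_iff_mem, mk_carlitz, ha]

section

variable [I.IsPrime]

/-- The reduction is injective on torsion, and the residue ring has at most `q ^ deg n` points of
`n`-torsion. -/
theorem image_mk_torsion (hn : n ≠ 0)
    (hcard : (torsion F R n).ncard = Fintype.card F ^ n.natDegree)
    (hnI : algebraMap F[X] R n ∉ I) :
    Ideal.Quotient.mk I '' torsion F R n = torsion F (R ⧸ I) n := by
  refine Set.eq_of_subset_of_ncard_le ?_ ?_ (finite_torsion hn)
  · rintro _ ⟨x, hx, rfl⟩
    exact map_mem_torsion (Ideal.Quotient.mkₐ F[X] I) hx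
  · rw [(injOn_mk_torsion hnI).ncard_image, hcard]
    exact ncard_torsion_le hn

variable (hn : n ≠ 0) (hcard : (torsion F R n).ncard = Fintype.card F ^ n.natDegree)
  (hnI : algebraMap F[X] R n ∉ I) {y : R ⧸ I} (hy : y ∈ torsion F (R ⧸ I) n)

include hn hcard hnI hy

theorem torsionLift_mem_torsion : torsionLift I n y ∈ torsion F R n :=
  Function.invFunOn_mem (by rwa [← image_mk_torsion hn hcard hnI] at hy)

theorem mk_torsionLift : Ideal.Quotient.mk I (torsionLift I n y) = y :=
  Function.invFunOn_eq (by rwa [← image_mk_torsion hn hcard hnI] at hy)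

theorem carlitz_torsionLift (a : F[X]) :
    carlitz F R a (torsionLift I n y) = torsionLift I n (carlitz F (R ⧸ I) a y) := by
  have hay := carlitz_mem_torsion a hy
  refine injOn_mk_torsion hnI (carlitz_mem_torsion a (torsionLift_mem_torsion hn hcard hnI hy))
    (torsionLift_mem_torsion hn hcard hnI hay) ?_
  rw [mk_carlitz, mk_torsionLift hn hcard hnI hy, mk_torsionLift hn hcard hnI hay]

omit hy in
theorem map_torsionLift_sub_mem {S : Type*} [CommRing S] [Algebra F S] [Algebra F[X] S]
    [IsScalarTower F F[X] S] {c : F[X]} {y : R ⧸ I} (hy : carlitz F _ c y ∈ torsion F (R ⧸ I) n)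
    (i : R →ₐ[F[X]] S) {J : Ideal S} (hIJ : I ≤ J.comap i) {w : S}
    (hw : ∀ x, Ideal.Quotient.mk I x = y → i x - w ∈ J) :
    i (torsionLift I n (carlitz F _ c y)) - carlitz F S c w ∈ J := by
  obtain ⟨x, rfl⟩ := Ideal.Quotient.mk_surjective y
  rw [← mk_carlitz] at hy ⊢
  have hlift := hIJ (Ideal.Quotient.eq.mp (mk_torsionLift hn hcard hnI hy))
  rw [Ideal.mem_comap, map_sub, carlitz_map] at hlift
  have hcarlitz := carlitz_mem_ideal J c (hw x rfl)
  rw [map_sub] at hcarlitz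
  exact sub_add_sub_cancel (i (torsionLift I n _)) _ _ ▸ add_mem hlift hcarlitz

end

end Teichmuller

section TeichPoint

variable {F : Type*} [Field F] [Fintype F] {n : F[X]} {P : Ideal (integers (cycField F n))}
variable {m : ℕ}

variable (P) in
/-- The torsion point `ω(C_c(z))` of `K_{n,m}`, where the constant `z` is regarded as an element of
the residue field of `P` through `ψ`. -/
def teichPoint (ψ : (integers (cycField F n) ⧸ P) ≃ₐ[F] constField F m) (c : F[X])
    (z : constField F m) : integers (compField F n m) :=
  integersIncl n m (teichmuller P (carlitz F _ c (ψ.symm z)))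

variable [P.IsPrime] (hn : n.Monic) (hnP : algebraMap F[X] _ n ∉ P) {c : F[X]}
  (hc : ∀ y : integers (cycField F n) ⧸ P, carlitz F _ (n * c) y = 0)
  (ψ : (integers (cycField F n) ⧸ P) ≃ₐ[F] constField F m)

include hn hnP hc

theorem teichPoint_mem_torsion (z : constField F m) :
    teichPoint P ψ c z ∈ torsion F (integers (compField F n m)) n :=
  map_mem_torsion (integersIncl n m) <| torsionLift_mem_torsion hn.ne_zero
    (ncard_torsion_integers hn (torsion_subset_cycField n)) hnP
    (carlitz_mem_torsion_of_forall hc _)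

theorem carlitz_teichPoint (a : F[X]) (z : constField F m) :
    carlitz F _ a (teichPoint P ψ c z) = teichPoint P ψ (a * c) z := by
  have h := carlitz_torsionLift hn.ne_zero
    (ncard_torsion_integers hn (torsion_subset_cycField n)) hnP
    (carlitz_mem_torsion_of_forall hc (ψ.symm z)) a
  rw [← carlitz_mul] at h
  exact (carlitz_map (integersIncl n m) a _).symm.trans (congrArg (integersIncl n m) h)

theorem teichPoint_sub_mem (hm : 0 < m) (z : constField F m) :
    teichPoint P ψ c z - carlitz F _ c (constIncl n m z) ∈ primeAbove P ψ := by
  refine map_torsionLift_sub_mem hn.ne_zero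
    (ncard_torsion_integers hn (torsion_subset_cycField n)) hnP
    (carlitz_mem_torsion_of_forall hc (ψ.symm z)) (integersIncl n m) (fun x hx => ?_)
    fun x hx => ?_
  · rw [Ideal.mem_comap, mem_primeAbove_iff hn hm, compResidue_integersIncl,
      Ideal.Quotient.eq_zero_iff_mem.mpr hx, map_zero]
  · rw [mem_primeAbove_iff hn hm, map_sub, compResidue_constIncl, compResidue_integersIncl, hx,
      AlgEquiv.apply_symm_apply, sub_self]

end TeichPoint

section GaussConj

variable {F : Type*} [Field F] [Fintype F] {n : F[X]} {m : ℕ}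
  [Fintype (constField F m)] [DecidableEq (constField F m)]

/-- The conjugates `1 + ∑ ω(C_c(z⁻¹)) ψ(z) ^ (q ^ s)` of the geometric Gauss sum, as elements of
the ring of integers of `K_{n,m}`. -/
def gaussConj (P : Ideal (integers (cycField F n)))
    (ψ : (integers (cycField F n) ⧸ P) ≃ₐ[F] constField F m) (c : F[X]) (s : ℕ) :
    integers (compField F n m) :=
  1 + ∑ z : (constField F m)ˣ, teichPoint P ψ c (z⁻¹ : (constField F m)ˣ) *
    constIncl n m z ^ Fintype.card F ^ s

variable {P : Ideal (integers (cycField F n))}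

theorem sigma_smul_gaussConj (hn : n.Monic) (hm : 0 < m) [P.IsPrime]
    (hnP : algebraMap F[X] _ n ∉ P) {c : F[X]}
    (hc : ∀ y : integers (cycField F n) ⧸ P, carlitz F _ (n * c) y = 0)
    (ψ : (integers (cycField F n) ⧸ P) ≃ₐ[F] constField F m) {a : F[X]} (ha : IsCoprime a n)
    (s t : ℕ) : sigma n m a t • gaussConj P ψ c s = gaussConj P ψ (a * c) (s + t) := by
  rw [gaussConj, smul_add, smul_one, Finset.smul_sum, gaussConj]
  congr 1
  refine Finset.sum_congr rfl fun z _ => ?_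
  rw [smul_mul', smul_pow', sigma_smul_of_mem_torsion hn hm ha t
    (teichPoint_mem_torsion hn hnP hc ψ _), carlitz_teichPoint hn hnP hc,
    sigma_smul_constIncl hn hm ha, ← pow_mul, ← pow_add, add_comm t]

theorem gaussConj_congr (hm : 0 < m) (ψ : (integers (cycField F n) ⧸ P) ≃ₐ[F] constField F m)
    (c : F[X]) {s t : ℕ} (hst : s ≡ t [MOD m]) : gaussConj P ψ c s = gaussConj P ψ c t := by
  rw [gaussConj, gaussConj]
  congr 1
  refine Finset.sum_congr rfl fun z _ => ?_
  rw [← map_pow, ← map_pow, pow_pow_eq_of_modEq hst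
    (Subtype.ext ((mem_constField_iff hm).mp (z : constField F m).2))]

end GaussConj

section GaussSum

variable {F : Type*} [Field F] [Fintype F] {n v : F[X]} {l : ℕ}
  [Fintype (constField F (v.natDegree * l))] [DecidableEq (constField F (v.natDegree * l))]

theorem num_div_mul_algebraMap {k : Type*} [Field k] {n : k[X]} (hn : n ≠ 0) (a h : k[X]) :
    (algebraMap k[X] (RatFunc k) a / algebraMap k[X] (RatFunc k) n *
      algebraMap k[X] (RatFunc k) (n * h)).num = a * h := by
  have hn' : algebraMap k[X] (RatFunc k) n ≠ 0 := RatFunc.algebraMap_ne_zero hn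
  rw [map_mul, ← mul_assoc, div_mul_cancel₀ _ hn', ← map_mul, RatFunc.num_algebraMap]

theorem finsum_units_inv_mulEquiv {A E M : Type*} [Monoid A] [Monoid E] [AddCommMonoid M]
    [Fintype Eˣ] (e : A ≃* E) (f : A → E → M) :
    ∑ᶠ z : Aˣ, f (z⁻¹ : Aˣ) (e z) = ∑ w : Eˣ, f (e.symm (w⁻¹ : Eˣ)) w := by
  rw [← finsum_eq_sum_of_fintype]
  refine finsum_eq_of_bijective (Units.mapEquiv e) (MulEquiv.bijective _) fun z => ?_
  rw [← map_inv, Units.coe_mapEquiv, Units.coe_mapEquiv, e.symm_apply_apply]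

theorem gaussSum_eq_gaussConj (hn : n ≠ 0) (P : Ideal (integers (cycField F n)))
    (ψ : (integers (cycField F n) ⧸ P) ≃ₐ[F] constField F (v.natDegree * l)) (a : F[X]) {h : F[X]}
    (hh : v ^ l - 1 = n * h) :
    gaussSum P v l ψ (algebraMap F[X] (RatFunc F) a / algebraMap F[X] (RatFunc F) n) =
      (gaussConj P ψ (a * h) 0 : compField F n (v.natDegree * l)) := by
  rw [gaussSum, hh, num_div_mul_algebraMap hn, gaussConj, AddMemClass.coe_add,
    OneMemClass.coe_one, AddSubmonoidClass.coe_finsetSum]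
  simp only [pow_zero, pow_one, MulMemClass.coe_mul, teichPoint]
  congr 1
  exact finsum_units_inv_mulEquiv ψ.toMulEquiv fun z w =>
    (integersIncl n (v.natDegree * l) (teichmuller P (carlitz F _ (a * h) z)) :
      compField F n (v.natDegree * l)) * (constIncl n (v.natDegree * l) w :
        compField F n (v.natDegree * l))

end GaussSum

section NormBound

section

variable (A : Type*) [CommRing A] [IsDedekindDomain A]
variable {O : Type*} [CommRing O] [IsDedekindDomain O] [Algebra A O] [Module.Finite A O]
  [Module.IsTorsionFree A O]

theorem eq_one_of_relNorm_eq_one {J : Ideal O} (hJ : Ideal.relNorm A J = 1) : J = 1 := by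
  rw [Ideal.one_eq_top, Ideal.eq_top_iff_one, ← map_one (algebraMap A O), ← Ideal.mem_comap]
  refine Ideal.relNorm_le_comap A J ?_
  rw [hJ]
  exact Submodule.one_le.mp le_rfl

theorem eq_of_dvd_of_relNorm_eq {I J : Ideal O} (hI : I ≠ 0) (hIJ : I ∣ J)
    (h : Ideal.relNorm A J = Ideal.relNorm A I) : J = I := by
  obtain ⟨J, rfl⟩ := hIJ
  rw [map_mul] at h
  rw [eq_one_of_relNorm_eq_one A
    ((mul_eq_left₀ fun h0 => hI (Ideal.relNorm_eq_bot_iff.mp h0)).mp h), mul_one]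

variable {G : Type*} [Group G] [MulSemiringAction G O]

theorem relNorm_prod_smul [SMulCommClass G A O] (I : Ideal O) {ι : Type*} (s : Finset ι)
    (g : ι → G) : Ideal.relNorm A (∏ i ∈ s, g i • I) = Ideal.relNorm A I ^ s.card := by
  rw [map_prod, Finset.prod_congr rfl fun i _ => Ideal.relNorm_smul A (g i) I, Finset.prod_const]

attribute [local instance] FractionRing.liftAlgebra

variable (G) [Finite G] [IsGaloisGroup G A O]

theorem isGalois_fractionRing (A O G : Type*) [CommRing A] [IsDedekindDomain A] [CommRing O]
    [IsDedekindDomain O] [Algebra A O] [Module.Finite A O] [Module.IsTorsionFree A O] [Group G]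
    [MulSemiringAction G O] [Finite G] [IsGaloisGroup G A O] :
    IsGalois (FractionRing A) (FractionRing O) := by
  let := IsFractionRing.mulSemiringAction G O (FractionRing O)
  have := IsGaloisGroup.to_isFractionRing_of_isIntegral G A O (FractionRing A) (FractionRing O)
  exact IsGaloisGroup.isGalois G _ _

theorem algebraMap_intNorm_eq_finprod_smul (x : O) :
    algebraMap A O (Algebra.intNorm A O x) = ∏ᶠ g : G, g • x := by
  have := isGalois_fractionRing A O G
  cases nonempty_fintype G
  rw [Algebra.algebraMap_intNorm_of_isGalois, finprod_eq_prod_of_fintype]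
  exact (Fintype.prod_equiv (IsGaloisGroup.mulEquivAlgEquiv G A O).toEquiv _ _ fun _ => rfl).symm

end

variable {F : Type*} [Field F]
variable {O : Type*} [CommRing O] [Algebra F[X] O] [Module.Finite F[X] O]

theorem natDegree_mul_inertiaDeg [Finite F] {v : F[X]} (hvirr : Irreducible v) {I : Ideal O}
    [I.IsMaximal] [I.LiesOver (Ideal.span {v})] {m : ℕ}
    (hcard : Nat.card (O ⧸ I) = Nat.card F ^ m) :
    v.natDegree * I.inertiaDeg F[X] = m := by
  have : (Ideal.span {v}).IsMaximal := PrincipalIdealRing.isMaximal_of_irreducible hvirr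
  have : Finite (F[X] ⧸ Ideal.span {v}) := finite_quotient_span hvirr.ne_zero
  have : Finite (O ⧸ I) := finite_quotient_of_liesOver (Ideal.span {v}) I
  let : Field (F[X] ⧸ Ideal.span {v}) := Ideal.Quotient.field _
  have h := Module.natCard_eq_pow_finrank (K := F[X] ⧸ Ideal.span {v}) (V := O ⧸ I)
  rw [← Ideal.inertiaDeg_eq_of_isMaximal, hcard, natCard_quotient_span hvirr.ne_zero,
    ← pow_mul] at h
  exact (Nat.pow_right_injective Finite.one_lt_card h).symm

variable [IsDedekindDomain O] [Module.IsTorsionFree F[X] O]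
variable {G : Type*} [Group G] [Finite G] [MulSemiringAction G O] [IsGaloisGroup G F[X] O]

attribute [local instance] FractionRing.liftAlgebra in
theorem relNorm_prod_smul_eq_span {v : F[X]} (hvirr : Irreducible v) (I : Ideal O)
    [I.IsMaximal] [I.LiesOver (Ideal.span {v})] {ι : Type*} (s : Finset ι) (g : ι → G) :
    Ideal.relNorm F[X] (∏ i ∈ s, g i • I) = Ideal.span {v ^ (I.inertiaDeg F[X] * s.card)} := by
  have := isGalois_fractionRing F[X] O G
  have : (Ideal.span {v}).IsMaximal := PrincipalIdealRing.isMaximal_of_irreducible hvirr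
  have : SMulCommClass G F[X] O := IsGaloisGroup.commutes
  rw [relNorm_prod_smul, Ideal.relNorm_eq_pow_of_isPrime_isGalois I (Ideal.span {v}), ← pow_mul,
    Ideal.span_singleton_pow]

/-- The norm of `x` is too small to leave room for further prime factors. -/
theorem span_singleton_eq_prod_smul_of_dvd [Finite F] {v : F[X]} (hv : v.Monic)
    (hvirr : Irreducible v) {I : Ideal O} [I.IsMaximal] [I.LiesOver (Ideal.span {v})] {m : ℕ}
    (hcard : Nat.card (O ⧸ I) = Nat.card F ^ m) {ι : Type*} {s : Finset ι} {g : ι → G} {x : O}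
    (hx : x ≠ 0) (hdvd : ∏ i ∈ s, g i • I ∣ Ideal.span {x})
    (hdeg : ∀ f : F[X], f ≠ 0 → algebraMap F[X] O f = ∏ᶠ g : G, g • x →
      f.natDegree ≤ m * s.card) :
    Ideal.span {x} = ∏ i ∈ s, g i • I := by
  have hnorm := relNorm_prod_smul_eq_span hvirr I s g
  have hdvd_norm := map_dvd (Ideal.relNorm F[X]) hdvd
  have hnorm_ne_zero : Algebra.intNorm F[X] O x ≠ 0 := Algebra.intNorm_ne_zero.mpr hx
  have hle := hdeg _ hnorm_ne_zero (algebraMap_intNorm_eq_finprod_smul F[X] G x)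
  rw [← natDegree_mul_inertiaDeg hvirr hcard, mul_assoc, mul_comm, ← hv.natDegree_pow] at hle
  rw [hnorm, Ideal.relNorm_singleton, Ideal.span_singleton_dvd_span_singleton_iff_dvd] at hdvd_norm
  refine eq_of_dvd_of_relNorm_eq F[X] (ne_zero_of_dvd_ne_zero ?_ hdvd) hdvd ?_
  · rwa [Ne, Ideal.zero_eq_bot, Ideal.span_singleton_eq_bot]
  · rw [hnorm, Ideal.relNorm_singleton, Ideal.span_singleton_eq_span_singleton]
    exact (associated_of_dvd_of_natDegree_le hdvd_norm hnorm_ne_zero hle).symm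

end NormBound

section PrimeAbove

variable {F : Type*} [Field F]

theorem algebraMap_mem_iff_of_liesOver {R : Type*} [CommRing R] [Algebra F[X] R] {v : F[X]}
    (P : Ideal R) [h : P.LiesOver (Ideal.span {v})] (f : F[X]) :
    algebraMap F[X] R f ∈ P ↔ v ∣ f := by
  rw [← Ideal.mem_span_singleton, h.over]
  rfl

theorem algebraMap_notMem_of_isCoprime {R : Type*} [CommRing R] [Algebra F[X] R] {v n : F[X]}
    (hvirr : Irreducible v) (hvn : IsCoprime v n) (P : Ideal R) [P.LiesOver (Ideal.span {v})] :
    algebraMap F[X] R n ∉ P := by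
  rw [algebraMap_mem_iff_of_liesOver (v := v) P]
  exact fun h => hvirr.not_isUnit (hvn.isUnit_of_dvd' dvd_rfl h)

theorem monic_pow_sub_one {v : F[X]} (hv : v.Monic) {l : ℕ} (hm : 0 < v.natDegree * l) :
    (v ^ l - 1).Monic := by
  refine (hv.pow l).sub_of_left ?_
  rwa [degree_one, ← natDegree_pos_iff_degree_pos, hv.natDegree_pow, mul_comm]

theorem natDegree_pow_sub_one {v : F[X]} (hv : v.Monic) (l : ℕ) :
    (v ^ l - 1).natDegree = v.natDegree * l := by
  rw [← C_1, natDegree_sub_C, hv.natDegree_pow, mul_comm]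

variable [Fintype F] {n v : F[X]} {m : ℕ} {P : Ideal (integers (cycField F n))}

section

variable (hn : n.Monic) (hm : 0 < m) (ψ : (integers (cycField F n) ⧸ P) ≃ₐ[F] constField F m)

include hn hm

theorem compResidue_surjective : Function.Surjective (compResidue hn hm ψ) := fun c =>
  ⟨constIncl n m c, compResidue_constIncl hn hm ψ c⟩

theorem ker_compResidue : RingHom.ker (compResidue hn hm ψ) = primeAbove P ψ :=
  Ideal.ext fun _ => (mem_primeAbove_iff hn hm).symm

theorem isMaximal_primeAbove : (primeAbove P ψ).IsMaximal :=
  ker_compResidue hn hm ψ ▸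
    RingHom.ker_isMaximal_of_surjective _ (compResidue_surjective hn hm ψ)

theorem comap_primeAbove : (primeAbove P ψ).comap (integersIncl n m) = P := by
  ext x
  rw [Ideal.mem_comap, mem_primeAbove_iff hn hm, compResidue_integersIncl,
    EmbeddingLike.map_eq_zero_iff, Ideal.Quotient.eq_zero_iff_mem]

theorem exists_sub_constIncl_mem_primeAbove (x : integers (compField F n m)) :
    ∃ c, x - constIncl n m c ∈ primeAbove P ψ := by
  refine ⟨compResidue hn hm ψ x, ?_⟩
  rw [mem_primeAbove_iff hn hm, map_sub, compResidue_constIncl, sub_self]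

theorem natCard_quotient_primeAbove :
    Nat.card (integers (compField F n m) ⧸ primeAbove P ψ) = Fintype.card F ^ m := by
  rw [← ker_compResidue hn hm ψ, ← natCard_constField hm]
  exact Nat.card_congr
    (Ideal.quotientKerAlgEquivOfSurjective (compResidue_surjective hn hm ψ)).toEquiv

theorem liesOver_primeAbove [h : P.LiesOver (Ideal.span {v})] :
    (primeAbove P ψ).LiesOver (Ideal.span {v}) := by
  constructor
  ext f
  rw [h.over]
  nth_rw 1 [← comap_primeAbove hn hm ψ]
  rw [Ideal.under_def, Ideal.under_def, Ideal.mem_comap, Ideal.mem_comap, Ideal.mem_comap,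
    AlgHom.commutes]

end

theorem carlitz_pow_sub_one_quotient_eq_zero (hv : v.Monic) (hvirr : Irreducible v)
    [P.LiesOver (Ideal.span {v})] {l : ℕ} (hm : 0 < v.natDegree * l)
    (ψ : (integers (cycField F n) ⧸ P) ≃ₐ[F] constField F (v.natDegree * l))
    (y : integers (cycField F n) ⧸ P) : carlitz F _ (v ^ l - 1) y = 0 := by
  refine carlitz_pow_sub_one_eq_zero hv hvirr ?_ (fun y => ψ.injective ?_) y
  · exact Ideal.Quotient.eq_zero_iff_mem.mpr
      ((algebraMap_mem_iff_of_liesOver (v := v) P v).mpr dvd_rfl)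
  · rw [map_pow]
    exact Subtype.ext ((mem_constField_iff hm).mp (ψ y).2)

end PrimeAbove

section Nonzero

variable {F : Type*} [Field F] [Fintype F] {n : F[X]} {m : ℕ}

theorem carlitz_of_natDegree_eq_one {L : Type*} [CommRing L] [Algebra F L] [Algebra F[X] L]
    [IsScalarTower F F[X] L] (hn : n.Monic) (hn1 : n.natDegree = 1) (z : L) :
    carlitz F L n z = algebraMap F[X] L n * z + z ^ Fintype.card F := by
  have hcoeff : carlitzCoeff n 1 = 1 := by
    rw [← hn1, carlitzCoeff_natDegree, hn.leadingCoeff, C_1]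
  rw [carlitz_eq_sum n z (B := 2) (by lia), Finset.sum_range_succ, Finset.sum_range_one,
    carlitzCoeff_zero, hcoeff, map_one, one_mul, pow_zero, pow_one, pow_one]

theorem natDegree_eq_zero_of_algebraMap_eq_constIncl (hm : 0 < m) {f : F[X]} {c : constField F m}
    (h : algebraMap F[X] (integers (compField F n m)) f = constIncl n m c) : f.natDegree = 0 := by
  have hpow : f ^ Fintype.card F ^ m = f := by
    apply FaithfulSMul.algebraMap_injective F[X] (integers (compField F n m))
    rw [map_pow, h, ← map_pow]
    exact congrArg _ (Subtype.ext ((mem_constField_iff hm).mp c.2))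
  by_contra hf
  have hdeg := congrArg natDegree hpow
  rw [natDegree_pow, Nat.mul_eq_right hf] at hdeg
  exact (one_lt_card_pow hm).ne' hdeg

theorem eq_map_neg_inv_of_one_add_mul_eq_zero {E R : Type*} [Field E] [CommRing R] [Nontrivial R]
    (ι : E →+* R) {g : R} {e : E} (h : 1 + g * ι e = 0) : e ≠ 0 ∧ g = ι (-e⁻¹) := by
  have he : e ≠ 0 := by
    rintro rfl
    rw [map_zero, mul_zero, add_zero] at h
    exact one_ne_zero h
  have hinv : ι e * ι e⁻¹ = 1 := by rw [← map_mul, mul_inv_cancel₀ he, map_one]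
  refine ⟨he, ?_⟩
  rw [map_neg]
  linear_combination ι e⁻¹ * h - g * hinv

/-- Otherwise a constant `b ≠ 0` is a torsion point, and `n = -b ^ (q - 1)` is constant. -/
theorem one_add_mul_constIncl_ne_zero (hn : n.Monic) (hn1 : n.natDegree = 1) (hm : 0 < m)
    {g : integers (compField F n m)} (hg : g ∈ torsion F (integers (compField F n m)) n)
    (e : constField F m) : 1 + g * constIncl n m e ≠ 0 := by
  intro h
  obtain ⟨he, rfl⟩ := eq_map_neg_inv_of_one_add_mul_eq_zero
    (constIncl n m : constField F m →+* integers (compField F n m)) h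
  set b := -e⁻¹ with hb
  have hb_inv : constIncl n m b * constIncl n m b⁻¹ = 1 := by
    rw [← map_mul, mul_inv_cancel₀ (neg_ne_zero.mpr (inv_ne_zero he)), map_one]
  rw [mem_torsion, carlitz_of_natDegree_eq_one hn hn1, RingHom.coe_coe] at hg
  have hn_eq : algebraMap F[X] _ n = constIncl n m (-(b ^ Fintype.card F * b⁻¹)) := by
    rw [map_neg, map_mul, map_pow]
    linear_combination constIncl n m b⁻¹ * hg -
      algebraMap F[X] (integers (compField F n m)) n * hb_inv
  exact one_ne_zero (hn1.symm.trans (natDegree_eq_zero_of_algebraMap_eq_constIncl hm hn_eq))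

end Nonzero

section GaussConjNorm

theorem exists_forall_mem_torsion_eq_algebraMap_mul {F : Type*} [Field F] [Fintype F]
    {R : Type*} [CommRing R] [IsDomain R] [Algebra F R] [Algebra F[X] R] [IsScalarTower F F[X] R]
    {n : F[X]} (hn : n.Monic) (hn1 : n.natDegree = 1)
    (hcard : (torsion F R n).ncard = Fintype.card F ^ n.natDegree) :
    ∃ g ∈ torsion F R n, ∀ z ∈ torsion F R n, ∃ b : F, z = algebraMap F R b * g := by
  obtain ⟨g, hg, hgen⟩ := exists_mem_torsion_forall_dvd hn.ne_zero hcard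
  refine ⟨g, hg, fun z hz => ?_⟩
  obtain ⟨a, rfl⟩ := exists_eq_carlitz_of_mem_torsion hn.ne_zero hcard hg hgen hz
  have hlt : (a %ₘ n).natDegree < 1 :=
    hn1 ▸ natDegree_modByMonic_lt a hn (by rintro rfl; simp at hn1)
  refine ⟨(a %ₘ n).coeff 0, ?_⟩
  rw [← carlitz_C, ← eq_C_of_natDegree_le_zero (Nat.le_of_lt_succ hlt)]
  refine carlitz_eq_of_dvd_sub ?_ hg
  rw [modByMonic_eq_sub_mul_div, sub_sub_cancel]
  exact dvd_mul_right _ _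

variable {F : Type*} [Field F] [Fintype F] {n : F[X]} {m : ℕ}
  [Fintype (constField F m)] [DecidableEq (constField F m)] {P : Ideal (integers (cycField F n))}
  [P.IsPrime] (hn : n.Monic) (hm : 0 < m) (hnP : algebraMap F[X] _ n ∉ P) {c : F[X]}
  (hc : ∀ y : integers (cycField F n) ⧸ P, carlitz F _ (n * c) y = 0)
  (ψ : (integers (cycField F n) ⧸ P) ≃ₐ[F] constField F m)

include hn hm hnP hc

theorem gaussConj_ne_zero_of_natDegree_eq_one (hn1 : n.natDegree = 1) (s : ℕ) :
    gaussConj P ψ c s ≠ 0 := by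
  obtain ⟨g, hg, hgen⟩ := exists_forall_mem_torsion_eq_algebraMap_mul hn hn1
    (ncard_torsion_integers hn (torsion_subset_compField n m))
  choose b hb using fun z => hgen _ (teichPoint_mem_torsion hn hnP hc ψ z)
  have hsum : gaussConj P ψ c s = 1 + g * constIncl n m (∑ z : (constField F m)ˣ, algebraMap F _
      (b (z⁻¹ : (constField F m)ˣ)) * (z : constField F m) ^ Fintype.card F ^ s) := by
    rw [gaussConj, map_sum, Finset.mul_sum]
    congr 1
    refine Finset.sum_congr rfl fun z _ => ?_
    rw [hb, map_mul, map_pow, AlgHom.commutes, mul_comm _ g, mul_assoc]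
  rw [hsum]
  exact one_add_mul_constIncl_ne_zero hn hn1 hm hg _

omit hm in
theorem valuation_smul_gaussConj_pow_le {B : ValuationSubring (compField F n m)}
    (hB : ∀ b : F, algebraMap F (compField F n m) b ∈ B)
    (hθ : 1 < B.valuation (algebraMap F[X] (compField F n m) X)) (s : ℕ)
    (σ : Gal(compField F n m/RatFunc F)) :
    B.valuation (σ (gaussConj P ψ c s)) ^ (Fintype.card F - 1) ≤
      B.valuation (algebraMap F[X] (compField F n m) X) := by
  rw [gaussConj, AddMemClass.coe_add, OneMemClass.coe_one, AddSubmonoidClass.coe_finsetSum,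
    map_add, map_one, map_sum]
  simp only [MulMemClass.coe_mul, SubmonoidClass.coe_pow, map_mul, map_pow]
  refine valuation_one_add_sum_pow_le hB hθ hn.ne_zero (fun z _ => ?_) fun z _ => ?_
  · exact map_mem_torsion (σ.toAlgHom.restrictScalars F[X])
      (coe_mem_torsion_integers_iff.mpr (teichPoint_mem_torsion hn hnP hc ψ _))
  · refine (IsIntegral.map (σ.toAlgHom.restrictScalars F) ?_).pow _
    exact isIntegral_of_coe_mem_constField ((coe_constIncl n m z).symm ▸ (z : constField F m).2)

theorem natDegree_le_of_algebraMap_eq_finprod_smul_gaussConj (hn0 : 0 < n.natDegree) (s : ℕ)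
    {f : F[X]} (hf : f ≠ 0) (hprod : algebraMap F[X] (integers (compField F n m)) f =
      ∏ᶠ σ : Gal(compField F n m/RatFunc F), σ • gaussConj P ψ c s) :
    f.natDegree ≤ m * (monicCoprime F n).card := by
  obtain ⟨_, _⟩ := isGalois_compField hn.ne_zero hm
  cases nonempty_fintype Gal(compField F n m/RatFunc F)
  have hinj : Function.Injective (algebraMap F[X] (compField F n m)) :=
    Subtype.val_injective.comp (FaithfulSMul.algebraMap_injective F[X] (integers (compField F n m)))
  obtain ⟨B, hB, hθ⟩ := exists_valuationSubring_infty hinj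
  rw [finprod_eq_prod_of_fintype] at hprod
  have hprod_field := congrArg (Subtype.val : integers (compField F n m) → compField F n m) hprod
  rw [SubmonoidClass.coe_finsetProd] at hprod_field
  have hnorm := natDegree_mul_le_of_algebraMap_eq_prod hB hθ
    (valuation_smul_gaussConj_pow_le hn hnP hc ψ hB hθ s) hf hprod_field
  have hle := hnorm.trans (Nat.card_eq_fintype_card.ge.trans (natCard_gal_compField_le hn0 hm))
  rw [mul_comm (Fintype.card F - 1), ← mul_assoc] at hle
  exact Nat.le_of_mul_le_mul_right hle (Nat.sub_pos_of_lt Fintype.one_lt_card)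

end GaussConjNorm

section Factorization

variable {F : Type*} [Field F] [Fintype F] {n v : F[X]} {m l : ℕ}
  [Fintype (constField F m)] [DecidableEq (constField F m)]
  {P : Ideal (integers (cycField F n))} [P.IsPrime]
  (hv : v.Monic) (hvirr : Irreducible v) (hn : n.Monic) (hm : 0 < m) (hml : m = v.natDegree * l)
  (hnP : algebraMap F[X] _ n ∉ P) (hnv : n ∣ v ^ l - 1) {c : F[X]}
  (hc : ∀ y : integers (cycField F n) ⧸ P, carlitz F _ (n * c) y = 0)
  (ψ : (integers (cycField F n) ⧸ P) ≃ₐ[F] constField F m)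

include hn hnP hnv hc in
omit [Fintype (constField F m)] [DecidableEq (constField F m)] in
theorem carlitz_pow_teichPoint (z : constField F m) :
    carlitz F _ (v ^ l) (teichPoint P ψ c z) = teichPoint P ψ c z := by
  rw [carlitz_eq_of_dvd_sub hnv (teichPoint_mem_torsion hn hnP hc ψ z), carlitz_one]

variable [P.LiesOver (Ideal.span {v})]

include hv hvirr hn hm hml hnP hnv hc

theorem gaussConj_mem_pow (hcm : c.Monic) (hcdeg : c.natDegree < m) :
    gaussConj P ψ c c.natDegree ∈ primeAbove P ψ ^ (l - c.natDegree / v.natDegree) := by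
  have := liesOver_primeAbove (v := v) hn hm ψ
  have hmem := one_add_sum_mem_pow (I := primeAbove P ψ)
    (constIncl n m : constField F m →+* integers (compField F n m)) (card_constField hm) hv hvirr
    ((algebraMap_mem_iff_of_liesOver (v := v) _ v).mpr dvd_rfl) hml hcm
    (carlitz_pow_teichPoint hn hnP hnv hc ψ)
    (fun z => by rw [RingHom.coe_coe]; exact teichPoint_sub_mem hn hnP hc ψ hm z) hcdeg
  simpa only [gaussConj, RingHom.coe_coe] using hmem

theorem gaussConj_sub_one_mem {s : ℕ} (hs : s < m) (hcs : c.natDegree < s) :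
    gaussConj P ψ c s - 1 ∈ primeAbove P ψ := by
  have := liesOver_primeAbove (v := v) hn hm ψ
  have hmem := one_add_sum_sub_one_mem (I := primeAbove P ψ)
    (constIncl n m : constField F m →+* integers (compField F n m)) (card_constField hm) hv hvirr
    ((algebraMap_mem_iff_of_liesOver (v := v) _ v).mpr dvd_rfl) hml
    (carlitz_pow_teichPoint hn hnP hnv hc ψ)
    (fun z => by rw [RingHom.coe_coe]; exact teichPoint_sub_mem hn hnP hc ψ hm z) hs hcs
  simpa only [gaussConj, RingHom.coe_coe] using hmem

/-- For `deg n > 1` some conjugate is `1` modulo a prime. -/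
theorem gaussConj_ne_zero (hn0 : 0 < n.natDegree)
    (hcdeg : n.natDegree + c.natDegree = m) :
    gaussConj P ψ c c.natDegree ≠ 0 := by
  rcases eq_or_lt_of_le (Nat.succ_le_of_lt hn0) with hn1 | hn1
  · exact gaussConj_ne_zero_of_natDegree_eq_one hn hm hnP hc ψ hn1.symm _
  · intro h0
    have hmem : gaussConj P ψ c (c.natDegree + (n.natDegree - 1)) - 1 ∈ primeAbove P ψ :=
      gaussConj_sub_one_mem hv hvirr hn hm hml hnP hnv hc ψ (by omega) (by omega)
    have hconj := sigma_smul_gaussConj hn hm hnP hc ψ isCoprime_one_left c.natDegree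
      (n.natDegree - 1)
    rw [h0, smul_zero, one_mul] at hconj
    rw [← hconj, zero_sub, neg_mem_iff] at hmem
    exact (isMaximal_primeAbove hn hm ψ).ne_top ((Ideal.eq_top_iff_one _).mpr hmem)

variable (hcm : c.Monic) (hcdeg : n.natDegree + c.natDegree = m)

include hcm hcdeg

theorem exists_sigma_smul_gaussConj_mem_pow {a : F[X]} (ha : a ∈ monicCoprime F n) :
    ∃ e, n.natDegree ≤ v.natDegree * e + a.natDegree ∧
      sigma n m a a.natDegree • gaussConj P ψ c c.natDegree ∈
        primeAbove P ψ ^ e := by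
  obtain ⟨ham, hdeg, han⟩ := mem_monicCoprime.mp ha
  have hac_deg : (a * c).natDegree = a.natDegree + c.natDegree := ham.natDegree_mul hcm
  have hlt : a.natDegree < n.natDegree := natDegree_lt_natDegree ham.ne_zero hdeg
  have hac (y : integers (cycField F n) ⧸ P) : carlitz F _ (n * (a * c)) y = 0 := by
    rw [mul_left_comm, carlitz_mul, hc, map_zero]
  refine ⟨l - (a * c).natDegree / v.natDegree, ?_, ?_⟩
  · have hdiv := Nat.mul_div_le (a * c).natDegree v.natDegree
    rw [Nat.mul_sub]
    omega
  · rw [sigma_smul_gaussConj hn hm hnP hc ψ han, add_comm, ← hac_deg]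
    exact gaussConj_mem_pow hv hvirr hn hm hml hnP hnv hac ψ (ham.mul hcm)
      (by omega)

theorem prod_inv_smul_primeAbove_dvd_span_gaussConj (hvn : IsCoprime v n) :
    ∏ a ∈ monicCoprime F n, (sigma n m a a.natDegree)⁻¹ • primeAbove P ψ ∣
      Ideal.span {gaussConj P ψ c c.natDegree} := by
  obtain ⟨_, _⟩ := isGalois_compField hn.ne_zero hm
  have := isMaximal_primeAbove hn hm ψ
  have := liesOver_primeAbove (v := v) hn hm ψ
  refine prod_inv_smul_dvd_span (constIncl n m : constField F m →+* integers (compField F n m))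
    hm (card_constField hm) hv hvirr hvn
    (ncard_torsion_integers hn (torsion_subset_compField n m)) (algebraMap_mem_iff_of_liesOver _)
    (exists_sub_constIncl_mem_primeAbove hn hm ψ)
    (fun a ha => ⟨(mem_monicCoprime.mp ha).1, (mem_monicCoprime.mp ha).2.1⟩)
    (fun a ha z hz => sigma_smul_of_mem_torsion hn hm (mem_monicCoprime.mp ha).2.2 _ hz)
    (fun a ha e => ?_)
    fun a ha => exists_sigma_smul_gaussConj_mem_pow hv hvirr hn hm hml hnP hnv hc ψ hcm hcdeg ha
  rw [RingHom.coe_coe]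
  exact sigma_smul_constIncl hn hm (mem_monicCoprime.mp ha).2.2 _ e

theorem span_gaussConj (hvn : IsCoprime v n) (hn0 : 0 < n.natDegree) :
    Ideal.span {gaussConj P ψ c c.natDegree} =
      ∏ a ∈ monicCoprime F n, (sigma n m a a.natDegree)⁻¹ • primeAbove P ψ := by
  obtain ⟨_, _⟩ := isGalois_compField hn.ne_zero hm
  have := isMaximal_primeAbove hn hm ψ
  have := liesOver_primeAbove (v := v) hn hm ψ
  have : Module.IsTorsionFree F[X] (integers (compField F n m)) :=
    Module.isTorsionFree_iff_algebraMap_injective.mpr (FaithfulSMul.algebraMap_injective _ _)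
  have hcard : Nat.card (integers (compField F n m) ⧸ primeAbove P ψ) = Nat.card F ^ m := by
    rw [natCard_quotient_primeAbove hn hm ψ, Nat.card_eq_fintype_card]
  exact span_singleton_eq_prod_smul_of_dvd hv hvirr hcard
    (gaussConj_ne_zero hv hvirr hn hm hml hnP hnv hc ψ hn0 hcdeg)
    (prod_inv_smul_primeAbove_dvd_span_gaussConj hv hvirr hn hm hml hnP hnv hc ψ hcm hcdeg hvn)
    fun f hf hprod => natDegree_le_of_algebraMap_eq_finprod_smul_gaussConj hn hm hnP hc ψ hn0 _ hf
      hprod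

end Factorization

section IdealPow

theorem pow_toNat_div_pow_toNat {M : Type*} [GroupWithZero M] {x : M} (hx : x ≠ 0) (e : ℤ) :
    x ^ e.toNat / x ^ (-e).toNat = x ^ e := by
  rw [← zpow_natCast, ← zpow_natCast, ← zpow_sub₀ hx, Int.toNat_sub_toNat_neg]

theorem smul_ideal_ne_zero {G R : Type*} [Group G] [CommRing R] [MulSemiringAction G R]
    {I : Ideal R} (hI : I ≠ 0) (g : G) : g • I ≠ 0 := fun h =>
  hI (by rw [← inv_smul_smul g I, h]; exact smul_zero _)

variable {F : Type*} [Field F] {K : IntermediateField (RatFunc F) (kbar F)}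

theorem idealPow_single [IsDedekindDomain (integers K)] (I : Ideal (integers K))
    (σ : Gal(K/RatFunc F)) : idealPow I (MonoidAlgebra.single σ 1) =
      ((σ • I : Ideal (integers K)) : FractionalIdeal _ K) := by
  rw [idealPow, MonoidAlgebra.coeff_single, Finsupp.prod_single_index] <;> simp

variable [IsDedekindDomain (integers K)] {I : Ideal (integers K)} (hI : I ≠ 0)
include hI

theorem idealPow_add (η₁ η₂ : MonoidAlgebra ℤ Gal(K/RatFunc F)) :
    idealPow I (η₁ + η₂) = idealPow I η₁ * idealPow I η₂ := by
  classical
  have hsmul (σ : Gal(K/RatFunc F)) :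
      ((σ • I : Ideal (integers K)) : FractionalIdeal (integers K)⁰ K) ≠ 0 :=
    FractionalIdeal.coeIdeal_ne_zero.mpr (smul_ideal_ne_zero hI σ)
  simp only [idealPow, pow_toNat_div_pow_toNat (hsmul _), MonoidAlgebra.coeff_add]
  exact Finsupp.prod_add_index' (fun σ => zpow_zero _) fun σ a b => zpow_add₀ (hsmul σ) a b

variable {ι : Type*} (S : Finset ι)

theorem idealPow_sum_single (σ : ι → Gal(K/RatFunc F)) :
    idealPow I (∑ a ∈ S, MonoidAlgebra.single (σ a) 1) =
      ((∏ a ∈ S, σ a • I : Ideal (integers K)) : FractionalIdeal _ K) := by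
  classical
  induction S using Finset.induction_on with
  | empty => simp [idealPow]
  | insert a S ha ih =>
    rw [Finset.sum_insert ha, Finset.prod_insert ha, idealPow_add hI, ih, idealPow_single,
      FractionalIdeal.coeIdeal_mul]

theorem spanSingleton_eq_idealPow (τ : Gal(K/RatFunc F)) (σ : ι → Gal(K/RatFunc F))
    {x : integers K} (hx : Ideal.span {x} = ∏ a ∈ S, (τ * σ a) • I) :
    FractionalIdeal.spanSingleton _ (x : K) =
      idealPow I (MonoidAlgebra.single τ 1 * ∑ a ∈ S, MonoidAlgebra.single (σ a) 1) := by
  simp only [Finset.mul_sum, MonoidAlgebra.single_mul_single, mul_one]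
  rw [idealPow_sum_single hI, ← hx, FractionalIdeal.coeIdeal_span_singleton]
  rfl

end IdealPow

section ConstantExtensionIdeals

theorem pow_smul_eq_of_smul_eq {M α : Type*} [Monoid M] [MulAction M α] {g : M} {a : α}
    (h : g • a = a) (s : ℕ) : g ^ s • a = a :=
  (MulAction.stabilizerSubmonoid M a).pow_mem h s

theorem iterate_toRingHom_apply {G R : Type*} [Group G] [Semiring R] [MulSemiringAction G R]
    (g : G) (s : ℕ) (y : R) : (MulSemiringAction.toRingHom G R g)^[s] y = g ^ s • y :=
  smul_iterate_apply g s y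

variable {F : Type*} [Field F] [Fintype F] {E : Type*} [Field E] [Algebra F E]
  {A O : Type*} [CommRing A] [CommRing O] [Algebra F O] {G : Type*} [Group G]
  [MulSemiringAction G O] {i : A →+* O} {ι : E →ₐ[F] O} {g : G}

section Trace

variable {m : ℕ} (hgm : g ^ m = 1) (hfix : ∀ y, g • y = y → ∃ x, i x = y)

include hgm hfix

theorem exists_map_eq_sum_pow_smul (y : O) : ∃ x, i x = ∑ s ∈ Finset.range m, g ^ s • y := by
  have h := map_sum_range_iterate (m := m) (τ := MulSemiringAction.toRingHom G O g) (y := y)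
    (by rw [iterate_toRingHom_apply, hgm, one_smul])
  simp only [iterate_toRingHom_apply] at h
  exact hfix _ h

theorem exists_sum_pow_smul_mul_eq_map (hi : ∀ x, g • i x = i x) {I : Ideal A} {y : O}
    (hy : y ∈ I.map i) (w : O) : ∃ x ∈ I, ∑ s ∈ Finset.range m, g ^ s • (w * y) = i x := by
  induction hy using Submodule.span_induction generalizing w with
  | mem y hy =>
    obtain ⟨x, hx, rfl⟩ := hy
    obtain ⟨x', hx'⟩ := exists_map_eq_sum_pow_smul hgm hfix w
    refine ⟨x' * x, I.mul_mem_left _ hx, ?_⟩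
    simp only [smul_mul', pow_smul_eq_of_smul_eq (hi x), map_mul, hx', Finset.sum_mul]
  | zero => exact ⟨0, I.zero_mem, by simp⟩
  | add y y' _ _ h h' =>
    obtain ⟨x, hx, e⟩ := h w
    obtain ⟨x', hx', e'⟩ := h' w
    refine ⟨x + x', I.add_mem hx hx', ?_⟩
    simp only [mul_add, smul_add, Finset.sum_add_distrib, map_add, e, e']
  | smul c y _ h => simpa only [smul_eq_mul, mul_assoc] using h (w * c)

end Trace

section Frobenius

variable (hι : ∀ c, g • ι c = ι c ^ Fintype.card F)

include hι

theorem pow_smul_const (s : ℕ) (c : E) : g ^ s • ι c = ι c ^ Fintype.card F ^ s := by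
  simpa only [iterate_toRingHom_apply] using
    iterate_const (τ := MulSemiringAction.toRingHom G O g) hι s c

theorem sum_pow_smul_const_pow_card (m : ℕ) (c : E) :
    (∑ s ∈ Finset.range m, g ^ s • ι c) ^ Fintype.card F =
      g • ∑ s ∈ Finset.range m, g ^ s • ι c := by
  rw [Finset.smul_sum, ← FiniteField.frobeniusAlgHom_apply (K := F), map_sum]
  refine Finset.sum_congr rfl fun s _ => ?_
  rw [FiniteField.frobeniusAlgHom_apply, pow_smul_const hι, smul_pow', hι, ← pow_mul, ← pow_mul,
    mul_comm]

theorem pow_smul_ne_self (hi : ∀ x, g • i x = i x) {J : Ideal O} (hJ : J ≠ ⊤)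
    (hJE : ∀ c, ∃ x, i x - ι c ∈ J) {r : ℕ} {c : E} (hc : c ^ Fintype.card F ^ r ≠ c) :
    g ^ r • J ≠ J := by
  intro h
  obtain ⟨x, hx⟩ := hJE c
  have hgx := Ideal.smul_mem_pointwise_smul (g ^ r) _ J hx
  rw [h, smul_sub, pow_smul_eq_of_smul_eq (hi x), pow_smul_const hι] at hgx
  have hsub := J.sub_mem hx hgx
  rw [sub_sub_sub_cancel_left, ← map_pow, ← map_sub] at hsub
  exact hJ (J.eq_top_of_isUnit_mem hsub ((sub_ne_zero.mpr hc).isUnit.map ι))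

variable [Finite E]

theorem exists_sum_pow_smul_const_ne_zero [Nontrivial O] :
    ∃ c : E, ∑ s ∈ Finset.range (Module.finrank F E), g ^ s • ι c ≠ 0 := by
  classical
  cases nonempty_fintype E
  by_contra! h
  have hone := eq_neg_sum_inv_mul_sum_iterate (τ := MulSemiringAction.toRingHom G O g) hι 1
  simp [iterate_toRingHom_apply, h] at hone

theorem comap_map_eq_of_constant_extension [IsDomain A] (hinj : Function.Injective i)
    (hg : g ^ Module.finrank F E = 1) (hi : ∀ x, g • i x = i x)
    (hfix : ∀ y, g • y = y → ∃ x, i x = y) (I : Ideal A) : (I.map i).comap i = I := by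
  refine le_antisymm (fun x hx => ?_) Ideal.le_comap_map
  have := hinj.nontrivial
  obtain ⟨z, hz⟩ := exists_sum_pow_smul_const_ne_zero hι
  obtain ⟨t, ht⟩ := exists_map_eq_sum_pow_smul hg hfix (ι z)
  obtain ⟨r, hr, hrx⟩ := exists_sum_pow_smul_mul_eq_map hg hfix hi hx (ι z)
  have htx : t * x = r := hinj <| by
    simp only [← hrx, map_mul, ht, Finset.sum_mul, smul_mul', pow_smul_eq_of_smul_eq (hi x)]
  have ht0 : t ≠ 0 := fun h => hz (by rw [← ht, h, map_zero])
  -- `t` is a constant, hence a unit of `A`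
  have htq : t ^ Fintype.card F = t := hinj <| by
    rw [map_pow, ht, sum_pow_smul_const_pow_card hι, ← ht, hi]
  have ht1 : t * t ^ (Fintype.card F - 2) = 1 := mul_left_cancel₀ ht0 <| by
    rw [← pow_succ', ← pow_succ', mul_one, Nat.sub_add_cancel Fintype.one_lt_card, htq]
  exact (I.unit_mul_mem_iff_mem (.of_mul_eq_one _ ht1)).mp (htx ▸ hr)

end Frobenius

theorem mem_map_of_forall_mem_pow_smul [Finite E] (hg : g ^ Module.finrank F E = 1)
    (hι : ∀ c, g • ι c = ι c ^ Fintype.card F) (hfix : ∀ y, g • y = y → ∃ x, i x = y)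
    {J : Ideal O} {y : O} (hy : ∀ s < Module.finrank F E, y ∈ g ^ s • J) :
    y ∈ (J.comap i).map i := by
  classical
  cases nonempty_fintype E
  have hJ (s : ℕ) (hs : s < Module.finrank F E) : g ^ s • y ∈ J := by
    rcases s.eq_zero_or_pos with rfl | h0
    · simpa using hy 0 hs
    · have hinv : (g ^ (Module.finrank F E - s))⁻¹ = g ^ s := by
        rw [inv_eq_iff_mul_eq_one, ← pow_add, Nat.sub_add_cancel hs.le, hg]
      have h := hy (Module.finrank F E - s) (Nat.sub_lt (h0.trans hs) h0)
      rwa [Ideal.mem_pointwise_smul_iff_inv_smul_mem, hinv] at h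
  rw [eq_neg_sum_inv_mul_sum_iterate (τ := MulSemiringAction.toRingHom G O g) hι y]
  refine neg_mem (Ideal.sum_mem _ fun z _ => Ideal.mul_mem_left _ _ ?_)
  obtain ⟨x, hx⟩ := exists_map_eq_sum_pow_smul hg hfix (ι z * y)
  simp only [iterate_toRingHom_apply, ← hx]
  refine Ideal.mem_map_of_mem i ?_
  rw [Ideal.mem_comap, hx]
  refine Ideal.sum_mem _ fun s hs => ?_
  rw [smul_mul']
  exact J.mul_mem_left _ (hJ s (Finset.mem_range.mp hs))

theorem map_comap_le_pow_smul (hi : ∀ x, g • i x = i x) (J : Ideal O) (s : ℕ) :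
    (J.comap i).map i ≤ g ^ s • J := by
  refine Ideal.map_le_iff_le_comap.mpr fun x hx => ?_
  rw [Ideal.mem_comap, ← pow_smul_eq_of_smul_eq (hi x) s, Ideal.smul_mem_pointwise_smul_iff]
  exact hx

theorem map_comap_eq_prod_pow_smul [Finite E] (hg : g ^ Module.finrank F E = 1)
    (hi : ∀ x, g • i x = i x) (hι : ∀ c, g • ι c = ι c ^ Fintype.card F)
    (hfix : ∀ y, g • y = y → ∃ x, i x = y) {J : Ideal O} [hJ : J.IsMaximal]
    (hJE : ∀ c, ∃ x, i x - ι c ∈ J)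
    (hdist : ∀ r, 0 < r → r < Module.finrank F E → ∃ c : E, c ^ Fintype.card F ^ r ≠ c) :
    (J.comap i).map i = ∏ s ∈ Finset.range (Module.finrank F E), g ^ s • J := by
  have hlt (s t : ℕ) (hst : s < t) (ht : t < Module.finrank F E) : g ^ s • J ≠ g ^ t • J := by
    obtain ⟨c, hc⟩ := hdist (t - s) (Nat.sub_pos_of_lt hst) ((Nat.sub_le _ _).trans_lt ht)
    rw [← Nat.add_sub_cancel' hst.le, pow_add, mul_smul]
    exact fun h => pow_smul_ne_self hι hi hJ.ne_top hJE hc (smul_left_cancel _ h).symm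
  have hcoprime : Set.Pairwise (Finset.range (Module.finrank F E) : Set ℕ)
      (Function.onFun IsCoprime fun s => g ^ s • J) := fun s hs t ht hst => by
    have := isMaximal_smul (g ^ s) J
    have := isMaximal_smul (g ^ t) J
    refine Ideal.isCoprime_of_isMaximal ?_
    rcases lt_or_gt_of_ne hst with h | h
    · exact hlt s t h (Finset.mem_range.mp ht)
    · exact (hlt t s h (Finset.mem_range.mp hs)).symm
  rw [Ideal.prod_eq_iInf_of_pairwise_isCoprime hcoprime]
  refine le_antisymm (le_iInf₂ fun s _ => map_comap_le_pow_smul hi J s) fun y hy => ?_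
  simp only [Ideal.mem_iInf] at hy
  exact mem_map_of_forall_mem_pow_smul hg hι hfix fun s hs => hy s (Finset.mem_range.mpr hs)

end ConstantExtensionIdeals

section Descent

theorem span_smul_eq_prod_mul_smul {G R ι : Type*} [Group G] [CommRing R] [MulSemiringAction G R]
    (g : G) {x : R} {S : Finset ι} {h : ι → G} {J : Ideal R}
    (hx : Ideal.span {x} = ∏ a ∈ S, h a • J) :
    Ideal.span {g • x} = ∏ a ∈ S, (g * h a) • J := by
  simp only [mul_smul]
  rw [← Finset.smul_prod', ← hx, Ideal.pointwise_smul_def, Ideal.map_span, Set.image_singleton]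
  rfl

theorem smul_prod_range_pow_smul {G M : Type*} [Group G] [CommMonoid M] [MulDistribMulAction G M]
    {g : G} {m : ℕ} (hgm : g ^ m = 1) (y : M) :
    g • ∏ s ∈ Finset.range m, g ^ s • y = ∏ s ∈ Finset.range m, g ^ s • y := by
  simp only [Finset.smul_prod', smul_smul, ← pow_succ']
  cases m with
  | zero => rfl
  | succ m => rw [Finset.prod_range_succ, hgm, Finset.prod_range_succ', pow_zero]

section General

variable {A O G H : Type*} [CommRing A] [CommRing O] [Group G] [Group H] [MulSemiringAction G O]
  [MulSemiringAction H A] {i : A →+* O}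

theorem smul_map_eq_map_smul {g : G} {h : H} (hgh : ∀ x, g • i x = i (h • x)) (I : Ideal A) :
    g • I.map i = (h • I).map i := by
  rw [Ideal.pointwise_smul_def, Ideal.pointwise_smul_def, Ideal.map_map, Ideal.map_map]
  congr 1
  exact RingHom.ext hgh

theorem span_eq_prod_smul_of_map_eq_prod_pow_smul {τ : G} {m : ℕ} {ι : Type*} {S : Finset ι}
    {g : ι → G} {h : ι → H} (hgh : ∀ a ∈ S, ∀ x, g a • i x = i (h a • x))
    (hcomm : ∀ a ∈ S, Commute τ (g a)) (hcomap : ∀ I : Ideal A, (I.map i).comap i = I)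
    {P : Ideal A} {J : Ideal O} (hmap : P.map i = ∏ s ∈ Finset.range m, τ ^ s • J) {x : A} {y : O}
    (hx : i x = ∏ s ∈ Finset.range m, τ ^ s • y) (hy : Ideal.span {y} = ∏ a ∈ S, g a • J) :
    Ideal.span {x} = ∏ a ∈ S, h a • P := by
  have hconj (s : ℕ) : Ideal.span {τ ^ s • y} = ∏ a ∈ S, g a • τ ^ s • J := by
    rw [span_smul_eq_prod_mul_smul _ hy]
    refine Finset.prod_congr rfl fun a ha => ?_
    rw [((hcomm a ha).pow_left s).eq, mul_smul]
  suffices hmap_eq : (Ideal.span {x}).map i = (∏ a ∈ S, h a • P).map i by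
    rw [← hcomap (Ideal.span {x}), hmap_eq, hcomap]
  calc (Ideal.span {x}).map i = ∏ s ∈ Finset.range m, ∏ a ∈ S, g a • τ ^ s • J := by
        rw [Ideal.map_span, Set.image_singleton, hx, ← Ideal.prod_span_singleton]
        exact Finset.prod_congr rfl fun s _ => hconj s
    _ = ∏ a ∈ S, (h a • P).map i := by
        rw [Finset.prod_comm]
        refine Finset.prod_congr rfl fun a ha => ?_
        rw [← smul_map_eq_map_smul (hgh a ha), hmap, Finset.smul_prod']
    _ = (∏ a ∈ S, h a • P).map i := by simp only [← Ideal.mapHom_apply, map_prod]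

end General

variable {F : Type*} [Field F] [Fintype F] {n : F[X]} {m : ℕ}

theorem exists_pow_card_pow_ne {r : ℕ} (hr : 0 < r) (hrm : r < m) :
    ∃ c : constField F m, c ^ Fintype.card F ^ r ≠ c := by
  by_contra! h
  have hle : constField F m ≤ constField F r := fun c hc =>
    (mem_constField_iff hr).mpr (congrArg Subtype.val (h ⟨c, hc⟩))
  have := finite_constField (F := F) hr
  have hcard := Nat.card_le_card_of_injective _ (IntermediateField.inclusion_injective hle)
  rw [natCard_constField (hr.trans hrm), natCard_constField hr] at hcard
  exact hcard.not_gt (Nat.pow_lt_pow_right Fintype.one_lt_card hrm)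

omit [Fintype F] in
theorem coe_prod_pow_smul {K : IntermediateField (RatFunc F) (kbar F)} (σ : Gal(K/RatFunc F))
    (y : integers K) (m : ℕ) : ((∏ s ∈ Finset.range m, σ ^ s • y : integers K) : K) =
      ∏ s ∈ Finset.range m, (σ ^ s) (y : K) :=
  SubmonoidClass.coe_finsetProd _ _

variable (hn : n.Monic) (hm : 0 < m)
include hn hm

theorem comap_map_integersIncl (I : Ideal (integers (cycField F n))) :
    (I.map (integersIncl n m : integers (cycField F n) →+* integers (compField F n m))).comap
      (integersIncl n m : integers (cycField F n) →+* integers (compField F n m)) = I := by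
  have := finite_constField (F := F) hm
  refine comap_map_eq_of_constant_extension (ι := constIncl n m) (g := sigma n m 1 1)
    (sigma_one_one_smul_constIncl hn hm) (integersIncl_injective n m) ?_
    (sigma_one_one_smul_integersIncl hn hm) (fun y => exists_integersIncl_eq hn hm) I
  rw [finrank_constField hm, sigma_one_one_pow_eq_one hn hm]

theorem map_integersIncl_eq_prod_pow_smul {P : Ideal (integers (cycField F n))}
    (ψ : (integers (cycField F n) ⧸ P) ≃ₐ[F] constField F m) :
    P.map (integersIncl n m : integers (cycField F n) →+* integers (compField F n m)) =
      ∏ s ∈ Finset.range m, sigma n m 1 1 ^ s • primeAbove P ψ := by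
  have := finite_constField (F := F) hm
  have := isMaximal_primeAbove hn hm ψ
  have hτ : sigma n m 1 1 ^ Module.finrank F (constField F m) = 1 := by
    rw [finrank_constField hm, sigma_one_one_pow_eq_one hn hm]
  have hE (c : constField F m) : ∃ x, integersIncl n m x - constIncl n m c ∈ primeAbove P ψ := by
    obtain ⟨x, hx⟩ := Ideal.Quotient.mk_surjective (ψ.symm c)
    refine ⟨x, ?_⟩
    rw [mem_primeAbove_iff hn hm, map_sub, compResidue_integersIncl, compResidue_constIncl, hx,
      AlgEquiv.apply_symm_apply, sub_self]
  have hmap := map_comap_eq_prod_pow_smul (ι := constIncl n m) (J := primeAbove P ψ)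
    (i := (integersIncl n m : integers (cycField F n) →+* integers (compField F n m))) hτ
    (sigma_one_one_smul_integersIncl hn hm) (sigma_one_one_smul_constIncl hn hm)
    (fun y => exists_integersIncl_eq hn hm) hE
    (by rw [finrank_constField hm]; exact fun r => exists_pow_card_pow_ne)
  rw [finrank_constField hm] at hmap
  rw [← hmap]
  exact congrArg _ (comap_primeAbove hn hm ψ).symm

theorem commute_sigma_one_one {a : F[X]} (ha : IsCoprime a n) (s : ℕ) :
    Commute (sigma n m 1 1) (sigma n m a s) := by
  rw [Commute, SemiconjBy, sigma_mul hn hm isCoprime_one_left ha,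
    sigma_mul hn hm ha isCoprime_one_left, one_mul, mul_one, add_comm]

theorem sigma_mul_inv_smul_integersIncl {a b : F[X]} (ha : IsCoprime a n) (hb : IsCoprime b n)
    (s t : ℕ) (x : integers (cycField F n)) :
    (sigma n m a s * (sigma n m b t)⁻¹) • integersIncl n m x =
      integersIncl n m ((rho n a * (rho n b)⁻¹) • x) := by
  have hinv : (sigma n m b t)⁻¹ • integersIncl n m x = integersIncl n m ((rho n b)⁻¹ • x) := by
    rw [inv_smul_eq_iff, sigma_smul_integersIncl hn hm hb, smul_inv_smul]
  rw [mul_smul, hinv, sigma_smul_integersIncl hn hm ha, mul_smul]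

theorem exists_inclusion_eq_frobMonomial_and_span_eq {P : Ideal (integers (cycField F n))}
    (ψ : (integers (cycField F n) ⧸ P) ≃ₐ[F] constField F m) {S : Finset F[X]}
    (hS : ∀ a ∈ S, IsCoprime a n) {s₀ : ℕ} {s : F[X] → ℕ} {a₀ : F[X]} (ha₀ : IsCoprime a₀ n)
    {y : integers (compField F n m)}
    (hy : Ideal.span {y} = ∏ a ∈ S, (sigma n m a₀ s₀ * (sigma n m a (s a))⁻¹) • primeAbove P ψ) :
    ∃ x : integers (cycField F n),
      IntermediateField.inclusion (cycField_le_compField n m) x =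
        frobMonomial (y : compField F n m) ∧
      Ideal.span {x} = ∏ a ∈ S, (rho n a₀ * (rho n a)⁻¹) • P := by
  obtain ⟨x, hx⟩ := exists_integersIncl_eq hn hm
    (smul_prod_range_pow_smul (sigma_one_one_pow_eq_one hn hm) y)
  refine ⟨x, (congrArg Subtype.val hx).trans (coe_prod_pow_smul _ _ _), ?_⟩
  exact span_eq_prod_smul_of_map_eq_prod_pow_smul
    (i := (integersIncl n m : integers (cycField F n) →+* integers (compField F n m)))
    (fun a ha => sigma_mul_inv_smul_integersIncl hn hm ha₀ (hS a ha) _ _)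
    (fun a ha => (commute_sigma_one_one hn hm ha₀ s₀).mul_right
      (commute_sigma_one_one hn hm (hS a ha) (s a)).inv_right)
    (comap_map_integersIncl hn hm) (map_integersIncl_eq_prod_pow_smul hn hm ψ) hx hy

end Descent

section Main

variable {F : Type*} [Field F] [Fintype F] {n v : F[X]} {P : Ideal (integers (cycField F n))}
  [P.LiesOver (Ideal.span {v})]

theorem span_gaussConj_zero [P.IsPrime] {m : ℕ} [Fintype (constField F m)]
    [DecidableEq (constField F m)]
    (hv : v.Monic) (hvirr : Irreducible v) (hn : n.Monic) (hvn : IsCoprime v n)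
    (hn0 : 0 < n.natDegree) (hm : 0 < m) (ψ : (integers (cycField F n) ⧸ P) ≃ₐ[F] constField F m)
    {l : ℕ} (hml : m = v.natDegree * l) {c : F[X]} (hnv : n ∣ v ^ l - 1) (hcm : c.Monic)
    (hcdeg : n.natDegree + c.natDegree = m)
    (hc : ∀ y : integers (cycField F n) ⧸ P, carlitz F _ (n * c) y = 0) {a₀ : F[X]}
    (ha₀ : IsCoprime a₀ n) :
    Ideal.span {gaussConj P ψ (a₀ * c) 0} = ∏ a ∈ monicCoprime F n,
      (sigma n m a₀ n.natDegree * (sigma n m a a.natDegree)⁻¹) • primeAbove P ψ := by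
  have hnP : algebraMap F[X] (integers (cycField F n)) n ∉ P :=
    algebraMap_notMem_of_isCoprime hvirr hvn P
  have hmod : c.natDegree + n.natDegree ≡ 0 [MOD m] := by
    rw [add_comm, hcdeg]
    exact Nat.modEq_zero_iff_dvd.mpr dvd_rfl
  rw [← gaussConj_congr hm ψ _ hmod, ← sigma_smul_gaussConj hn hm hnP hc ψ ha₀]
  exact span_smul_eq_prod_mul_smul _
    (span_gaussConj hv hvirr hn hm hml hnP hnv hc ψ hcm hcdeg hvn hn0)

variable {l : ℕ} (hv : v.Monic) (hvirr : Irreducible v) (hn : n.Monic) (hvn : IsCoprime v n)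
  (hm : 0 < v.natDegree * l)
  (ψ : (integers (cycField F n) ⧸ P) ≃ₐ[F] constField F (v.natDegree * l))
include hv hvirr hn hvn hm ψ

theorem dvd_pow_sub_one : n ∣ v ^ l - 1 :=
  dvd_of_forall_carlitz_quotient_eq_zero hn.ne_zero
    (ncard_torsion_integers hn (torsion_subset_cycField n))
    (algebraMap_notMem_of_isCoprime hvirr hvn P)
    (carlitz_pow_sub_one_quotient_eq_zero hv hvirr hm ψ)

theorem exists_coe_eq_gaussSum_and_span_eq [P.IsPrime] (hn0 : 0 < n.natDegree) {a₀ : F[X]}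
    (ha₀ : IsCoprime a₀ n) :
    ∃ y : integers (compField F n (v.natDegree * l)),
      y = gaussSum P v l ψ (algebraMap F[X] (RatFunc F) a₀ / algebraMap F[X] (RatFunc F) n) ∧
      Ideal.span {y} = ∏ a ∈ monicCoprime F n, (sigma n (v.natDegree * l) a₀ n.natDegree *
        (sigma n (v.natDegree * l) a a.natDegree)⁻¹) • primeAbove P ψ := by
  classical
  have := finite_constField (F := F) hm
  have := Fintype.ofFinite (constField F (v.natDegree * l))
  have hdvd := dvd_pow_sub_one hv hvirr hn hvn hm ψ
  obtain ⟨c, hnc⟩ := id hdvd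
  have hcm : c.Monic := hn.of_mul_monic_left (hnc ▸ monic_pow_sub_one hv hm)
  have hcdeg : n.natDegree + c.natDegree = v.natDegree * l := by
    rw [← natDegree_mul hn.ne_zero hcm.ne_zero, ← hnc, natDegree_pow_sub_one hv l]
  have hc (y : integers (cycField F n) ⧸ P) : carlitz F _ (n * c) y = 0 :=
    hnc ▸ carlitz_pow_sub_one_quotient_eq_zero hv hvirr hm ψ y
  exact ⟨gaussConj P ψ (a₀ * c) 0, (gaussSum_eq_gaussConj hn.ne_zero P ψ a₀ hnc).symm,
    span_gaussConj_zero hv hvirr hn hvn hn0 hm ψ rfl hdvd hcm hcdeg hc ha₀⟩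

end Main

end GeometricGauss

end

theorem mainTheorem3 (F : Type*) [Field F] [Fintype F]
    (v n : F[X]) (hv : v.Monic) (hvirr : Irreducible v) (hn : n.Monic) (hvn : IsCoprime v n)
    (P : Ideal (GeometricGauss.integers (GeometricGauss.cycField F n)))
    (hP : P.IsPrime) (hPv : P.LiesOver (Ideal.span {v}))
    (l : ℕ) (hl : l = P.inertiaDeg F[X])
    (ψ : (GeometricGauss.integers (GeometricGauss.cycField F n) ⧸ P) ≃ₐ[F]
      GeometricGauss.constField F (v.natDegree * l))
    (x : RatFunc F)
    (hx0 : 0 < GeometricGauss.inftyAbs F x) (hx1 : GeometricGauss.inftyAbs F x < 1)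
    (a₀ : F[X]) (ha₀ : a₀.degree < n.degree) (ha₀n : IsCoprime a₀ n)
    (hx : x = algebraMap F[X] (RatFunc F) a₀ / algebraMap F[X] (RatFunc F) n) :
    ((GeometricGauss.primeAbove P ψ).IsPrime ∧ (GeometricGauss.primeAbove P ψ).comap
        (GeometricGauss.integersIncl n (v.natDegree * l)) = P) ∧
    FractionalIdeal.spanSingleton _ (GeometricGauss.gaussSum P v l ψ x) =
      GeometricGauss.idealPow (GeometricGauss.primeAbove P ψ)
        (MonoidAlgebra.single (GeometricGauss.sigma n (v.natDegree * l) a₀ n.natDegree) 1 *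
          GeometricGauss.etaComp n (v.natDegree * l)) ∧
    ∃ g : GeometricGauss.cycField F n,
      IntermediateField.inclusion
          (GeometricGauss.cycField_le_compField n (v.natDegree * l)) g =
        GeometricGauss.frobMonomial (GeometricGauss.gaussSum P v l ψ x) ∧
      FractionalIdeal.spanSingleton _ g =
        GeometricGauss.idealPow P
          (MonoidAlgebra.single (GeometricGauss.rho n a₀) 1 * GeometricGauss.etaCyc n) := by
  subst hx
  have ha₀0 : a₀ ≠ 0 := by
    rintro rfl
    simp [GeometricGauss.inftyAbs] at hx0
  have hn0 : 0 < n.natDegree := (Nat.zero_le _).trans_lt (natDegree_lt_natDegree ha₀0 ha₀)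
  obtain ⟨_, _⟩ := GeometricGauss.isGalois_cycField hn.ne_zero
  have hm : 0 < v.natDegree * l :=
    Nat.mul_pos hvirr.natDegree_pos (hl ▸ Ideal.inertiaDeg_pos P F[X])
  obtain ⟨_, _⟩ := GeometricGauss.isGalois_compField hn.ne_zero hm
  have hv0 : Ideal.span {v} ≠ ⊥ := mt Ideal.span_singleton_eq_bot.mp hv.ne_zero
  have hP0 : P ≠ ⊥ := Ideal.ne_bot_of_liesOver_of_ne_bot hv0 P
  have := GeometricGauss.liesOver_primeAbove (v := v) hn hm ψ
  have hQ0 : GeometricGauss.primeAbove P ψ ≠ ⊥ := Ideal.ne_bot_of_liesOver_of_ne_bot hv0 _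
  obtain ⟨y, hy, hyspan⟩ :=
    GeometricGauss.exists_coe_eq_gaussSum_and_span_eq hv hvirr hn hvn hm ψ hn0 ha₀n
  obtain ⟨g, hg, hgspan⟩ := GeometricGauss.exists_inclusion_eq_frobMonomial_and_span_eq hn hm ψ
    (fun a ha => (GeometricGauss.mem_monicCoprime.mp ha).2.2) ha₀n hyspan
  rw [← hy]
  exact ⟨⟨(GeometricGauss.isMaximal_primeAbove hn hm ψ).isPrime,
    GeometricGauss.comap_primeAbove hn hm ψ⟩,
    GeometricGauss.spanSingleton_eq_idealPow hQ0 _ _ _ hyspan,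
    g, hg, GeometricGauss.spanSingleton_eq_idealPow hP0 _ _ _ hgspan⟩
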